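/- **Setting (no label noise).** Let $d,n,m\in\mathbb N$, $\boldsymbol\mu\in\mathbb R^d$, $\sigma_\xi,\sigma_0,\eta>0$. The training set is $\mathbf x_i=[y_i\boldsymbol\mu,\boldsymbol\xi_i]$, $i\in[n]$, with labels $y_i\in\{\pm1\}$ and independent noise patches $\boldsymbol\xi_i\sim\mathcal N(0,\sigma_\xi^2\mathbf I_d)$; the observed labels are the true labels $y_i$. The labels are either (a) independent Rademacher variables, independent of the $\boldsymbol\xi_i$, or (b) any given balanced labels (both classes of the same size). The network is $f(\mathbf W,\mathbf x)=F_{+1}(\mathbf W,\mathbf x)-F_{-1}(\mathbf W,\mathbf x)$ with $F_j(\mathbf W,[\mathbf x^{(1)},\mathbf x^{(2)}])=\frac1m\sum_{r=1}^m\big(\sigma(\langle\mathbf w_{j,r},\mathbf x^{(1)}\rangle)+\sigma(\langle\mathbf w_{j,r},\mathbf x^{(2)}\rangle)\big)$ and $\sigma(z)=\max\{0,z\}$. The initial weights $\mathbf w^{(0)}_{j,r}\sim\mathcal N(0,\sigma_0^2\mathbf I_d)$, $j=\pm1$, $r\in[m]$, are independent of each other and of the data. $\mathbf W^{(t)}$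 are the iterates of full-batch gradient descent with step size $\eta$ on $L_S(\mathbf W)=\frac1n\sum_{i=1}^n\log\big(1+\exp(-y_if(\mathbf W,\mathbf x_i))\big)$, that is, $$\mathbf w_{j,r}^{(t+1)}=\mathbf w_{j,r}^{(t)}-\frac{\eta}{nm}\sum_{i=1}^n\ell_i'^{(t)}\sigma'(\langle\mathbf w_{j,r}^{(t)},\boldsymbol\xi_i\rangle)\,j\,y_i\boldsymbol\xi_i-\frac{\eta}{nm}\sum_{i=1}^n\ell_i'^{(t)}\sigma'(\langle\mathbf w_{j,r}^{(t)},y_i\boldsymbol\mu\rangle)\,j\,\boldsymbol\mu,\qquad \ell_i'^{(t)}=\frac{-1}{1+\exp(y_if(\mathbf W^{(t)},\mathbf x_i))},$$ with $\sigma'(z)=\mathbb 1(z\ge0)$. The test error is $L_D^{0-1}(\mathbf W)=\mathbb P(yf(\mathbf W,[y\boldsymbol\mu,\boldsymbol\xi+\boldsymbol\zeta])<0)$, where $y$ is Rademacher, $\boldsymbol\xi$ is uniform on the training noise patches $\boldsymbol\xi_1,\dots,\boldsymbol\xi_n$ and $\boldsymbol\zeta\sim\mathcal N(0,\sigma_\xi^2\mathbf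 I_d)$, all independent. Put $\mathrm{SNR}=\|\boldsymbol\mu\|_2/(\sigma_\xi\sqrt d)$ and $R=\eta^{-1}nm\sigma_\xi^{-2}d^{-1}$. **Condition.** For constants $C,c_1,c_2$, a tolerance $0<\epsilon\le1$, a failure probability $0<\delta<1$, $n\ge2$ and a maximal number of iterations $T^*\in\mathbb N$: 1. $c_1\le n\cdot\mathrm{SNR}^2\le c_2$; 2. $d\ge C\max\{n^2\log(nm/\delta)\log(T^*)^2,\ n\|\boldsymbol\mu\|_2\sigma_\xi^{-1}\sqrt{\log(n/\delta)}\}$; 3. $m\ge C\log(n/\delta)$ and $n\ge C\log(m/\delta)$; 4. $\|\boldsymbol\mu\|_2^2\ge C\sigma_\xi^2\log(n/\delta)$; 5. $\sigma_0\le C^{-1}\min\{\sqrt n\,\sigma_\xi^{-1}d^{-1},\ \|\boldsymbol\mu\|_2^{-1}\log(m/\delta)^{-1/2}\}$; 6. $\eta\le C^{-1}\min\{\sigma_\xi^{-2}d^{-3/2}n^2m\sqrt{\log(n/\delta)},\ \sigma_\xi^{-2}d^{-1}n\}$; 7. $T^*\ge C\epsilon^{-1}R$. **Theorem.** There is an absolute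 constant $K>0$ such that for all $0<c_1\le c_2$ there are constants $C,C_D,a,b>0$, with $C_D\le Kc_2$, depending only on $c_1,c_2$, for which the following holds. Whenever the Condition is satisfied, there are integers $T_1\le T_1'\le T^*$ with $aR\le T_1\le bR$ and $a\epsilon^{-1}R\le T_1'\le b\epsilon^{-1}R$ such that, in either of the cases (a), (b), with probability at least $1-\delta$ over the training set and the initialization: * $y_if(\mathbf W^{(t)},\mathbf x_i)\ge0$ for all $i\in[n]$ and all $T_1\le t\le T^*$; * there is a time $t^*\in[T_1',T^*]$ with $L_S(\mathbf W^{(t^*)})\le\epsilon$, with $y_if(\mathbf W^{(t^*)},\mathbf x_i)\ge0$ for all $i\in[n]$, and with $$L_D^{0-1}(\mathbf W^{(t^*)})\le\exp\left(\frac dn-\frac{n\|\boldsymbol\mu\|_2^4}{C_D\sigma_\xi^4d}\right).$$ -/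

import Mathlib

open MeasureTheory ProbabilityTheory

noncomputable section

namespace FeatureLearning

/-- `ℝ^d` with the Euclidean norm. -/
abbrev Vec (d : ℕ) : Type := EuclideanSpace ℝ (Fin d)

/-- A label (or the sign `j = ±1` of a branch of the network) is a Boolean:
`true` is `+1` and `false` is `-1`; `sgn` is the corresponding real number. -/
def sgn (b : Bool) : ℝ := if b then 1 else -1

/-- First-layer weights `w_{j,r}`, for `j = ±1` and `r ∈ [m]`. -/
abbrev Weights (d m : ℕ) : Type := Bool → Fin m → Vec d

/-! ### The network -/

/-- ReLU. -/
def relu (z : ℝ) : ℝ := max 0 z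

/-- The derivative of ReLU, with the convention `σ'(0) = 1`. -/
def reluDeriv (z : ℝ) : ℝ := if 0 ≤ z then 1 else 0

/-- The two-patch data point `[y μ, ξ]`.  (The network below is symmetric in the two patches, so
the order in which they appear is irrelevant.) -/
def dataPoint {d : ℕ} (μ : Vec d) (y : Bool) (ξ : Vec d) : Vec d × Vec d := (sgn y • μ, ξ)

/-- `F_j(W_j, x)`. -/
def branch {d m : ℕ} (W : Weights d m) (j : Bool) (x : Vec d × Vec d) : ℝ :=
  (1 / (m : ℝ)) * ∑ r : Fin m, (relu (inner ℝ (W j r) x.1) + relu (inner ℝ (W j r) x.2))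

/-- `f(W, x) = F_{+1}(W_{+1}, x) - F_{-1}(W_{-1}, x)`. -/
def network {d m : ℕ} (W : Weights d m) (x : Vec d × Vec d) : ℝ :=
  branch W true x - branch W false x

/-! ### Loss and gradient descent (no label noise: observed label = true label) -/

/-- Logistic loss of the output `f` at the label `y`. -/
def logisticLoss (f : ℝ) (y : Bool) : ℝ := Real.log (1 + Real.exp (-(f * sgn y)))

/-- The loss derivative `ℓ' = -1 / (1 + exp(y f))`. -/
def lossDeriv (f : ℝ) (y : Bool) : ℝ := -1 / (1 + Real.exp (sgn y * f))

/-- The training loss `L_S(W)` of the training set `x_i = [y_i μ, ξ_i]`. -/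
def trainLoss {d m n : ℕ} (μ : Vec d) (y : Fin n → Bool) (ξ : Fin n → Vec d)
    (W : Weights d m) : ℝ :=
  (1 / (n : ℝ)) * ∑ i : Fin n, logisticLoss (network W (dataPoint μ (y i) (ξ i))) (y i)

/-- One step of full-batch gradient descent on the training loss with step size `η`. -/
def gdStep {d m n : ℕ} (μ : Vec d) (η : ℝ) (y : Fin n → Bool) (ξ : Fin n → Vec d)
    (W : Weights d m) : Weights d m := fun j r =>
  W j r
    - (η / ((n : ℝ) * m)) • ∑ i : Fin n,
        (lossDeriv (network W (dataPoint μ (y i) (ξ i))) (y i)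
          * reluDeriv (inner ℝ (W j r) (ξ i)) * (sgn j * sgn (y i))) • ξ i
    - (η / ((n : ℝ) * m)) • ∑ i : Fin n,
        (lossDeriv (network W (dataPoint μ (y i) (ξ i))) (y i)
          * reluDeriv (inner ℝ (W j r) (sgn (y i) • μ)) * (sgn j * sgn (y i) * sgn (y i))) • μ

/-- The iterate `W^{(t)}` of gradient descent started at `W₀`. -/
def gd {d m n : ℕ} (μ : Vec d) (η : ℝ) (y : Fin n → Bool) (ξ : Fin n → Vec d)
    (W₀ : Weights d m) : ℕ → Weights d m
  | 0 => W₀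
  | t + 1 => gdStep μ η y ξ (gd μ η y ξ W₀ t)

/-! ### Probability laws -/

/-- `N(0, σ² I_d)`. -/
def gaussianVec (d : ℕ) (σ : ℝ) : Measure (Vec d) :=
  (stdGaussian (Vec d)).map (fun x => σ • x)

/-- The Rademacher law of a label. -/
def rademacher : Measure Bool := uniformOn Set.univ

/-- `n` independent Rademacher labels. -/
def labelLaw (n : ℕ) : Measure (Fin n → Bool) := Measure.pi fun _ => rademacher

/-- `n` independent noise patches `ξ_i ∼ N(0, σ² I_d)`. -/
def noiseLaw (d n : ℕ) (σ : ℝ) : Measure (Fin n → Vec d) :=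
  Measure.pi fun _ => gaussianVec d σ

/-- Independent initial weights `w_{j,r} ∼ N(0, σ₀² I_d)`. -/
def initLaw (d m : ℕ) (σ₀ : ℝ) : Measure (Weights d m) :=
  Measure.pi fun _ => Measure.pi fun _ => gaussianVec d σ₀

/-- The training set is balanced: both classes have the same size. -/
def Balanced {n : ℕ} (y : Fin n → Bool) : Prop :=
  (Finset.univ.filter fun i => y i = true).card = (Finset.univ.filter fun i => y i = false).card

/-- The test 0-1 error `P(y f(W, x) < 0)`, where `x = [y μ, ξ + ζ]` with `y` Rademacher, `ξ`
uniform on the training noise patches `ξ_1, …, ξ_n` and `ζ ∼ N(0, σ² I_d)`, all independent. -/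
def testError {d m n : ℕ} (μ : Vec d) (σ : ℝ) (ξ : Fin n → Vec d) (W : Weights d m) : ENNReal :=
  (rademacher.prod ((uniformOn (Set.univ : Set (Fin n))).prod (gaussianVec d σ)))
    {p | sgn p.1 * network W (dataPoint μ p.1 (ξ p.2.1 + p.2.2)) < 0}

/-! ### The standing condition -/

/-- Signal-to-noise ratio `‖μ‖ / (σ_ξ √d)`. -/
def SNR {d : ℕ} (μ : Vec d) (σξ : ℝ) : ℝ := ‖μ‖ / (σξ * √(d : ℝ))

/-- The basic time scale `η⁻¹ n m σ_ξ⁻² d⁻¹`. -/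
def timeScale (d n m : ℕ) (σξ η : ℝ) : ℝ := η⁻¹ * n * m * (σξ ^ 2)⁻¹ * (d : ℝ)⁻¹

/-- The standing condition with constant `C`, where `n · SNR² = Θ(1)` means
`c₁ ≤ n · SNR² ≤ c₂`.  The maximal number of iterations `Tstar` is any integer that is at least `C`
times `ε⁻¹ η⁻¹ n m σ_ξ⁻² d⁻¹`. -/
structure Condition (C c₁ c₂ : ℝ) (d n m Tstar : ℕ) (μ : Vec d) (σξ σ₀ η ε δ : ℝ) : Prop where
  two_le_n : 2 ≤ n
  σξ_pos : 0 < σξ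
  σ₀_pos : 0 < σ₀
  η_pos : 0 < η
  ε_pos : 0 < ε
  ε_le_one : ε ≤ 1
  δ_pos : 0 < δ
  δ_lt_one : δ < 1
  Tstar_ge : C * (ε⁻¹ * timeScale d n m σξ η) ≤ Tstar
  snr_ge : c₁ ≤ n * SNR μ σξ ^ 2
  snr_le : n * SNR μ σξ ^ 2 ≤ c₂
  d_ge : C * max ((n : ℝ) ^ 2 * Real.log (n * m / δ) * Real.log Tstar ^ 2)
      (n * ‖μ‖ * σξ⁻¹ * √(Real.log (n / δ))) ≤ d
  m_ge : C * Real.log (n / δ) ≤ m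
  n_ge : C * Real.log (m / δ) ≤ n
  μ_ge : C * σξ ^ 2 * Real.log (n / δ) ≤ ‖μ‖ ^ 2
  σ₀_le : σ₀ ≤ C⁻¹ * min (√(n : ℝ) * σξ⁻¹ * (d : ℝ)⁻¹) (‖μ‖⁻¹ * (√(Real.log (m / δ)))⁻¹)
  η_le : η ≤ C⁻¹ * min
      ((σξ ^ 2)⁻¹ * (d : ℝ) ^ (-(3 / 2) : ℝ) * (n : ℝ) ^ 2 * m * √(Real.log (n / δ)))
      ((σξ ^ 2)⁻¹ * (d : ℝ)⁻¹ * n)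

/-! ### The training outcome -/

/-- The outcome for one realization of the labels `y`, the noise patches `ξ` and the initialization
`W₀`: every training point is classified correctly during `[T₁, Tstar]`, and at some time in
`[T₁', Tstar]` the training loss is at most `ε`, every training point is classified correctly, and
the test error is at most `exp(d/n - n‖μ‖⁴/(C_D σ_ξ⁴ d))`. -/
def Outcome {d m n : ℕ} (μ : Vec d) (σξ η ε C_D : ℝ) (T₁ T₁' Tstar : ℕ)
    (y : Fin n → Bool) (ξ : Fin n → Vec d) (W₀ : Weights d m) : Prop :=
  (∀ t : ℕ, T₁ ≤ t → t ≤ Tstar → ∀ i : Fin n,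
      0 ≤ sgn (y i) * network (gd μ η y ξ W₀ t) (dataPoint μ (y i) (ξ i))) ∧
  ∃ t : ℕ, T₁' ≤ t ∧ t ≤ Tstar ∧
    trainLoss μ y ξ (gd μ η y ξ W₀ t) ≤ ε ∧
    (∀ i : Fin n, 0 ≤ sgn (y i) * network (gd μ η y ξ W₀ t) (dataPoint μ (y i) (ξ i))) ∧
    testError μ σξ ξ (gd μ η y ξ W₀ t) ≤
      ENNReal.ofReal (Real.exp ((d : ℝ) / n - n * ‖μ‖ ^ 4 / (C_D * σξ ^ 4 * d)))

end FeatureLearning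

end

open FeatureLearning

/-!
With `κ = n · SNR² = n‖μ‖² / (σ_ξ² d)`, time is rescaled by the step `s = η σ_ξ² d / (n m)`. On
typical data the noise patches are almost orthogonal to each other and to `μ`, so each patch is
learned by its own direction: the exponential of the margin of every training point grows linearly
in `s t`, while the margins within a class, driven by the same signal, stay comparable and the
neurons that are active at initialization stay active. Hence after `s t ≳ 1` all points are
classified correctly, and after `s t ≳ ε⁻¹` the loss is at most `ε`.

For the test error let `L = log (s t)`. Up to constants, every neuron of the branch `j` has learned
signal `L` in the direction `j μ` and at most noise `L / κ` on each patch. If `κ ≤ 10¹²`, the bound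
on the test error is at least one. Otherwise the signal dominates the memorized noise, so that a
misclassification forces the fresh Gaussian noise to have a correlation of order `L` with a neuron;
as the weights have norm of order `L √(n / (κ d)) / σ_ξ`, a union bound over the neurons gives a
probability of at most `2 m exp(-c κ d / n)`.
-/

noncomputable section

namespace FeatureLearning

lemma sgn_mul_self (b : Bool) : sgn b * sgn b = 1 := by cases b <;> simp [sgn]

lemma sgn_not (b : Bool) : sgn (!b) = -sgn b := by cases b <;> simp [sgn]

lemma abs_sgn (b : Bool) : |sgn b| = 1 := by cases b <;> simp [sgn]

lemma relu_nonneg (z : ℝ) : 0 ≤ relu z := le_max_left _ _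

lemma le_relu (z : ℝ) : z ≤ relu z := le_max_right _ _

lemma relu_of_nonneg {z : ℝ} (h : 0 ≤ z) : relu z = z := max_eq_right h

lemma relu_of_nonpos {z : ℝ} (h : z ≤ 0) : relu z = 0 := max_eq_left h

lemma relu_mono {a b : ℝ} (h : a ≤ b) : relu a ≤ relu b := max_le_max le_rfl h

lemma relu_add_le (a b : ℝ) : relu (a + b) ≤ relu a + relu b :=
  max_le (add_nonneg (relu_nonneg a) (relu_nonneg b)) (add_le_add (le_relu a) (le_relu b))

lemma relu_sub_le {a b c : ℝ} (hc : 0 ≤ c) (h : a - b ≤ c) : relu a - relu b ≤ c := by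
  have hadd := relu_add_le b (a - b)
  rw [add_sub_cancel] at hadd
  have hdiff : relu (a - b) ≤ c := max_le hc h
  linarith

lemma abs_relu_sub_le (a b : ℝ) : |relu a - relu b| ≤ |a - b| := by
  simpa only [relu, max_comm] using abs_max_sub_max_le_abs a b 0

lemma reluDeriv_of_nonneg {z : ℝ} (h : 0 ≤ z) : reluDeriv z = 1 := if_pos h

lemma reluDeriv_of_neg {z : ℝ} (h : z < 0) : reluDeriv z = 0 := if_neg (not_le.2 h)

lemma reluDeriv_nonneg (z : ℝ) : 0 ≤ reluDeriv z := by unfold reluDeriv; split_ifs <;> norm_num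

lemma reluDeriv_le_one (z : ℝ) : reluDeriv z ≤ 1 := by unfold reluDeriv; split_ifs <;> norm_num

lemma exp_le_one_add_two_mul {x : ℝ} (h0 : 0 ≤ x) (h1 : x ≤ 1) : Real.exp x ≤ 1 + 2 * x := by
  have h := Real.abs_exp_sub_one_le (x := x) (by rwa [abs_of_nonneg h0])
  rw [abs_of_nonneg h0] at h
  linarith [le_abs_self (Real.exp x - 1)]

/-- The correlations of the weights with the training patches along a trajectory: the labels, the
oriented signal correlations `signal t j r = j ⟨w_{j,r}, μ⟩` and the noise correlations
`noise t j r i = ⟨w_{j,r}, ξ_i⟩` at time `t`. The margins, hence the whole dynamics, depend on the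
weights only through them. -/
structure Correlations (n m : ℕ) where
  label : Fin n → Bool
  signal : ℕ → Bool → Fin m → ℝ
  noise : ℕ → Bool → Fin m → Fin n → ℝ

namespace Correlations

variable {n m : ℕ}

section Margins

variable (D : Correlations n m)

/-- The part of the margin of a class `j` that is due to the signal patch. -/
def signalMargin (t : ℕ) (j : Bool) : ℝ :=
  (1 / (m : ℝ)) * ∑ r, (relu (D.signal t j r) - relu (-D.signal t (!j) r))

/-- The part of the margin of a training point that is due to its noise patch. -/
def noiseMargin (t : ℕ) (i : Fin n) : ℝ :=
  (1 / (m : ℝ)) * ∑ r, (relu (D.noise t (D.label i) r i) - relu (D.noise t (!D.label i) r i))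

/-- The margin `y_i f(W, x_i)`. -/
def margin (t : ℕ) (i : Fin n) : ℝ := D.signalMargin t (D.label i) + D.noiseMargin t i

/-- The gradient weight `-ℓ'_i` of a training point. -/
def grad (t : ℕ) (i : Fin n) : ℝ := 1 / (1 + Real.exp (D.margin t i))

/-- The mean gradient weight. -/
def meanGrad (t : ℕ) : ℝ := (1 / (n : ℝ)) * ∑ i, D.grad t i

/-- The contribution of the class `j` to the mean gradient weight. -/
def classGrad (t : ℕ) (j : Bool) : ℝ :=
  (1 / (n : ℝ)) * ∑ i, if D.label i = j then D.grad t i else 0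

/-- The correlations follow gradient descent with normalized step size `s`, signal strength `κ` and
normalized squared patch norms `N`, up to interactions between different patches of relative size
`τ`, from an initialization of size `τ` for which a quarter of the neurons is active on each noise
patch. -/
structure Regular (s κ τ : ℝ) (N : Fin n → ℝ) : Prop where
  n_pos : 0 < n
  m_pos : 0 < m
  s_pos : 0 < s
  τ_pos : 0 < τ
  N_ge : ∀ i, 1 / 2 ≤ N i
  N_le : ∀ i, N i ≤ 2
  noise_step : ∀ t j r i, |D.noise (t + 1) j r i - D.noise t j r i
      - s * (sgn j * sgn (D.label i) * D.grad t i * reluDeriv (D.noise t j r i) * N i)|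
        ≤ s * (2 * τ * D.meanGrad t)
  signal_step : ∀ t j r, |D.signal (t + 1) j r - D.signal t j r
      - s * (κ * ((1 / (n : ℝ)) *
          ∑ i, D.grad t i * reluDeriv (sgn (D.label i) * sgn j * D.signal t j r)))|
        ≤ s * (τ * D.meanGrad t)
  signal_init : ∀ j r, |D.signal 0 j r| ≤ τ
  noise_init : ∀ j r i, |D.noise 0 j r i| ≤ τ
  active : ∀ i,
    (m : ℝ) / 4 ≤ (Finset.univ.filter fun r => 0 ≤ D.noise 0 (D.label i) r i).card
  class_ge : ∀ j, (n : ℝ) / 4 ≤ (Finset.univ.filter fun i => D.label i = j).card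

end Margins

variable {D : Correlations n m} {s κ τ : ℝ} {N : Fin n → ℝ}

lemma grad_pos (t : ℕ) (i : Fin n) : 0 < D.grad t i := by unfold grad; positivity

lemma grad_le_one (t : ℕ) (i : Fin n) : D.grad t i ≤ 1 := by
  unfold grad
  rw [div_le_one (by positivity)]
  linarith [Real.exp_pos (D.margin t i)]

lemma meanGrad_nonneg (t : ℕ) : 0 ≤ D.meanGrad t :=
  mul_nonneg (by positivity) (Finset.sum_nonneg fun i _ => (grad_pos t i).le)

lemma meanGrad_le (hn : 0 < n) {t : ℕ} {c : ℝ} (h : ∀ i, D.grad t i ≤ c) : D.meanGrad t ≤ c := by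
  have hsum : ∑ i, D.grad t i ≤ n * c := by
    simpa using Finset.sum_le_sum (s := Finset.univ) fun i _ => h i
  rwa [meanGrad, one_div, inv_mul_le_iff₀ (by exact_mod_cast hn)]

lemma meanGrad_le_one (hn : 0 < n) (t : ℕ) : D.meanGrad t ≤ 1 := meanGrad_le hn (grad_le_one t)

lemma classGrad_nonneg (t : ℕ) (j : Bool) : 0 ≤ D.classGrad t j :=
  mul_nonneg (by positivity) (Finset.sum_nonneg fun i _ => by
    split_ifs
    exacts [(grad_pos t i).le, le_rfl])

lemma classGrad_le_meanGrad (t : ℕ) (j : Bool) : D.classGrad t j ≤ D.meanGrad t :=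
  mul_le_mul_of_nonneg_left (Finset.sum_le_sum fun i _ => by
    split_ifs
    exacts [le_rfl, (grad_pos t i).le]) (by positivity)

lemma classGrad_le (hn : 0 < n) {t : ℕ} {j : Bool} {c : ℝ} (hc₀ : 0 ≤ c)
    (hc : ∀ i, D.label i = j → D.grad t i ≤ c) : D.classGrad t j ≤ c := by
  have hsum : (∑ i, if D.label i = j then D.grad t i else 0) ≤ ∑ _i : Fin n, c :=
    Finset.sum_le_sum fun i _ => by
      split_ifs with hi
      exacts [hc i hi, hc₀]
  rw [classGrad, one_div, inv_mul_le_iff₀ (by exact_mod_cast hn)]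
  simpa using hsum

lemma noiseMargin_succ_sub (t : ℕ) (i : Fin n) :
    D.noiseMargin (t + 1) i - D.noiseMargin t i = (1 / (m : ℝ)) * ∑ r,
      ((relu (D.noise (t + 1) (D.label i) r i) - relu (D.noise t (D.label i) r i))
        - (relu (D.noise (t + 1) (!D.label i) r i) - relu (D.noise t (!D.label i) r i))) := by
  unfold noiseMargin
  rw [← mul_sub, ← Finset.sum_sub_distrib]
  congr! 2
  ring

namespace Regular

lemma le_classGrad (h : D.Regular s κ τ N) {t : ℕ} {j : Bool} {c : ℝ} (hc₀ : 0 ≤ c)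
    (hc : ∀ i, D.label i = j → c ≤ D.grad t i) : c / 4 ≤ D.classGrad t j := by
  have hsum : ((Finset.univ.filter fun i => D.label i = j).card : ℝ) * c
      ≤ ∑ i, if D.label i = j then D.grad t i else 0 := by
    rw [← Finset.sum_filter, ← nsmul_eq_mul]
    exact Finset.card_nsmul_le_sum _ _ _ fun i hi => hc i (Finset.mem_filter.1 hi).2
  have hcard := mul_le_mul_of_nonneg_right (h.class_ge j) hc₀
  rw [classGrad, one_div, le_inv_mul_iff₀ (by exact_mod_cast h.n_pos)]
  linarith

section NoiseStep

variable {M : ℝ} {t : ℕ} {i : Fin n}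

lemma interaction_le (h : D.Regular s κ τ N) (hτ : 2 * τ * M ≤ 1 / 20)
    (hM : D.meanGrad t ≤ M * D.grad t i) : 2 * τ * D.meanGrad t ≤ D.grad t i / 20 := by
  have hmean := mul_le_mul_of_nonneg_left hM (mul_nonneg zero_le_two h.τ_pos.le)
  have hsmall := mul_le_mul_of_nonneg_right hτ (grad_pos (D := D) t i).le
  linarith

lemma abs_noise_drift_le (h : D.Regular s κ τ N) (j : Bool) (r : Fin m) :
    |s * (sgn j * sgn (D.label i) * D.grad t i * reluDeriv (D.noise t j r i) * N i)|
      ≤ s * D.grad t i * 2 := by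
  have hg := grad_pos (D := D) t i
  have hN : 0 ≤ N i := by linarith [h.N_ge i]
  calc |s * (sgn j * sgn (D.label i) * D.grad t i * reluDeriv (D.noise t j r i) * N i)|
      = s * D.grad t i * (reluDeriv (D.noise t j r i) * N i) := by
        simp only [abs_mul, abs_sgn, abs_of_pos hg, abs_of_pos h.s_pos,
          abs_of_nonneg (reluDeriv_nonneg _), abs_of_nonneg hN]
        ring
    _ ≤ s * D.grad t i * (1 * 2) := by
        have := h.s_pos
        gcongr
        exacts [reluDeriv_le_one _, h.N_le i]
    _ = s * D.grad t i * 2 := by ring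

lemma abs_noise_succ_sub_le (h : D.Regular s κ τ N)
    (hinter : 2 * τ * D.meanGrad t ≤ D.grad t i / 20) (j : Bool) (r : Fin m) :
    |D.noise (t + 1) j r i - D.noise t j r i| ≤ s * D.grad t i * (41 / 20) := by
  have hstep := (abs_sub_abs_le_abs_sub _ _).trans (h.noise_step t j r i)
  have hdrift := h.abs_noise_drift_le (t := t) (i := i) j r
  have herr := mul_le_mul_of_nonneg_left hinter h.s_pos.le
  linarith

lemma noise_succ_own_ge (h : D.Regular s κ τ N)
    (hinter : 2 * τ * D.meanGrad t ≤ D.grad t i / 20) {r : Fin m}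
    (hact : 0 ≤ D.noise t (D.label i) r i) :
    D.noise t (D.label i) r i + s * D.grad t i * (9 / 20) ≤ D.noise (t + 1) (D.label i) r i := by
  have hstep := (abs_le.1 (h.noise_step t (D.label i) r i)).1
  rw [sgn_mul_self, reluDeriv_of_nonneg hact] at hstep
  have herr := mul_le_mul_of_nonneg_left hinter h.s_pos.le
  have hN := mul_le_mul_of_nonneg_left (h.N_ge i) (mul_pos h.s_pos (grad_pos (D := D) t i)).le
  linarith

lemma noise_succ_own_nonneg (h : D.Regular s κ τ N)
    (hinter : 2 * τ * D.meanGrad t ≤ D.grad t i / 20) {r : Fin m}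
    (hact : 0 ≤ D.noise t (D.label i) r i) : 0 ≤ D.noise (t + 1) (D.label i) r i := by
  have hsg := mul_pos h.s_pos (grad_pos (D := D) t i)
  linarith [h.noise_succ_own_ge hinter hact]

lemma le_relu_noise_succ_own_sub (h : D.Regular s κ τ N)
    (hinter : 2 * τ * D.meanGrad t ≤ D.grad t i / 20) (r : Fin m) :
    (if 0 ≤ D.noise t (D.label i) r i then s * D.grad t i * (9 / 20) else 0)
      ≤ relu (D.noise (t + 1) (D.label i) r i) - relu (D.noise t (D.label i) r i) := by
  split_ifs with hact
  · rw [relu_of_nonneg hact, relu_of_nonneg (h.noise_succ_own_nonneg hinter hact)]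
    linarith [h.noise_succ_own_ge hinter hact]
  · rw [relu_of_nonpos (not_le.1 hact).le, sub_zero]
    exact relu_nonneg _

lemma noise_succ_other_le (h : D.Regular s κ τ N)
    (hinter : 2 * τ * D.meanGrad t ≤ D.grad t i / 20) (r : Fin m) :
    D.noise (t + 1) (!D.label i) r i - D.noise t (!D.label i) r i ≤ s * D.grad t i * (1 / 20) := by
  have hstep := (abs_le.1 (h.noise_step t (!D.label i) r i)).2
  rw [sgn_not, neg_mul, sgn_mul_self] at hstep
  have herr := mul_le_mul_of_nonneg_left hinter h.s_pos.le
  have hdrift : 0 ≤ s * (D.grad t i * reluDeriv (D.noise t (!D.label i) r i) * N i) := by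
    have hN : 0 ≤ N i := by linarith [h.N_ge i]
    have hg := grad_pos (D := D) t i
    have := h.s_pos
    have := reluDeriv_nonneg (D.noise t (!D.label i) r i)
    positivity
  linarith

lemma noiseMargin_succ_ge (h : D.Regular s κ τ N)
    (hinter : 2 * τ * D.meanGrad t ≤ D.grad t i / 20)
    (hact : ∀ r, 0 ≤ D.noise 0 (D.label i) r i → 0 ≤ D.noise t (D.label i) r i) :
    D.noiseMargin t i + s * D.grad t i / 16 ≤ D.noiseMargin (t + 1) i := by
  have hsg := mul_pos h.s_pos (grad_pos (D := D) t i)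
  have hneuron : ∀ r, (if 0 ≤ D.noise 0 (D.label i) r i then s * D.grad t i * (9 / 20) else 0)
      - s * D.grad t i * (1 / 20) ≤
      (relu (D.noise (t + 1) (D.label i) r i) - relu (D.noise t (D.label i) r i))
        - (relu (D.noise (t + 1) (!D.label i) r i) - relu (D.noise t (!D.label i) r i)) := by
    intro r
    have hother := relu_sub_le (by positivity) (h.noise_succ_other_le hinter r)
    have hown := h.le_relu_noise_succ_own_sub hinter r
    have hmono : (if 0 ≤ D.noise 0 (D.label i) r i then s * D.grad t i * (9 / 20) else 0)
        ≤ if 0 ≤ D.noise t (D.label i) r i then s * D.grad t i * (9 / 20) else 0 := by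
      split_ifs with h₀ hₜ
      exacts [le_rfl, absurd (hact r h₀) hₜ, by positivity, le_rfl]
    linarith
  have hsum := Finset.sum_le_sum (s := Finset.univ) fun r _ => hneuron r
  rw [Finset.sum_sub_distrib, ← Finset.sum_filter, Finset.sum_const, Finset.sum_const,
    nsmul_eq_mul, nsmul_eq_mul, Finset.card_univ, Fintype.card_fin] at hsum
  have hcard := mul_le_mul_of_nonneg_right (h.active i)
    (show 0 ≤ s * D.grad t i * (9 / 20) by positivity)
  rw [← le_sub_iff_add_le', noiseMargin_succ_sub, one_div,
    le_inv_mul_iff₀ (by exact_mod_cast h.m_pos)]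
  linarith

lemma noiseMargin_succ_le (h : D.Regular s κ τ N)
    (hinter : 2 * τ * D.meanGrad t ≤ D.grad t i / 20) :
    D.noiseMargin (t + 1) i ≤ D.noiseMargin t i + 5 * (s * D.grad t i) := by
  have hsg := mul_pos h.s_pos (grad_pos (D := D) t i)
  have hrelu : ∀ j r, |relu (D.noise (t + 1) j r i) - relu (D.noise t j r i)|
      ≤ s * D.grad t i * (41 / 20) := fun j r =>
    (abs_relu_sub_le _ _).trans (h.abs_noise_succ_sub_le hinter j r)
  have hsum := Finset.sum_le_sum (s := Finset.univ) fun (r : Fin m) _ =>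
    show (relu (D.noise (t + 1) (D.label i) r i) - relu (D.noise t (D.label i) r i))
        - (relu (D.noise (t + 1) (!D.label i) r i) - relu (D.noise t (!D.label i) r i))
        ≤ 5 * (s * D.grad t i) by
      linarith [(abs_le.1 (hrelu (D.label i) r)).2, (abs_le.1 (hrelu (!D.label i) r)).1]
  rw [← sub_le_iff_le_add', noiseMargin_succ_sub, one_div,
    inv_mul_le_iff₀ (by exact_mod_cast h.m_pos)]
  simpa using hsum

end NoiseStep

end Regular

lemma signalMargin_succ_sub (j : Bool) (t : ℕ) :
    D.signalMargin (t + 1) j - D.signalMargin t j = (1 / (m : ℝ)) * ∑ r,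
      ((relu (D.signal (t + 1) j r) - relu (D.signal t j r))
        + (relu (-D.signal t (!j) r) - relu (-D.signal (t + 1) (!j) r))) := by
  unfold signalMargin
  rw [← mul_sub, ← Finset.sum_sub_distrib]
  congr! 2
  ring

lemma signalMargin_le_succ {t : ℕ} (hmono : ∀ j r, D.signal t j r ≤ D.signal (t + 1) j r)
    (j : Bool) : D.signalMargin t j ≤ D.signalMargin (t + 1) j := by
  rw [← sub_nonneg, signalMargin_succ_sub]
  refine mul_nonneg (by positivity) (Finset.sum_nonneg fun r _ => ?_)
  exact add_nonneg (sub_nonneg.2 (relu_mono (hmono j r)))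
    (sub_nonneg.2 (relu_mono (neg_le_neg (hmono (!j) r))))

lemma signalMargin_of_pos {t : ℕ} (hpos : ∀ j r, 0 < D.signal t j r) (j : Bool) :
    D.signalMargin t j = (1 / (m : ℝ)) * ∑ r, D.signal t j r := by
  unfold signalMargin
  congr! 2 with r
  rw [relu_of_nonneg (hpos j r).le, relu_of_nonpos (by linarith [hpos (!j) r]), sub_zero]

lemma classGrad_le_activeGrad {t : ℕ} {j k : Bool} {r : Fin m}
    (hact : 0 ≤ sgn k * sgn j * D.signal t j r) :
    D.classGrad t k ≤ (1 / (n : ℝ)) *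
      ∑ i, D.grad t i * reluDeriv (sgn (D.label i) * sgn j * D.signal t j r) := by
  refine mul_le_mul_of_nonneg_left (Finset.sum_le_sum fun i _ => ?_) (by positivity)
  split_ifs with hi
  · rw [hi, reluDeriv_of_nonneg hact, mul_one]
  · exact mul_nonneg (grad_pos t i).le (reluDeriv_nonneg _)

lemma activeGrad_le_meanGrad (t : ℕ) (j : Bool) (r : Fin m) :
    (1 / (n : ℝ)) * ∑ i, D.grad t i * reluDeriv (sgn (D.label i) * sgn j * D.signal t j r)
      ≤ D.meanGrad t :=
  mul_le_mul_of_nonneg_left (Finset.sum_le_sum fun i _ =>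
    mul_le_of_le_one_right (grad_pos t i).le (reluDeriv_le_one _)) (by positivity)

lemma activeGrad_of_pos {t : ℕ} {j : Bool} {r : Fin m} (hpos : 0 < D.signal t j r) :
    (1 / (n : ℝ)) * ∑ i, D.grad t i * reluDeriv (sgn (D.label i) * sgn j * D.signal t j r)
      = D.classGrad t j := by
  unfold classGrad
  congr! 2 with i
  split_ifs with hi
  · rw [hi, sgn_mul_self, one_mul, reluDeriv_of_nonneg hpos.le, mul_one]
  · rw [show D.label i = !j from Bool.eq_not.2 hi, sgn_not, neg_mul, sgn_mul_self,
      reluDeriv_of_neg (by linarith), mul_zero]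

namespace Regular

variable {t : ℕ}

-- Whatever the sign of the correlation, one of the two classes is active and pushes it upwards.
lemma signal_succ_ge (h : D.Regular s κ τ N) (hκ : 0 ≤ κ) {c : ℝ} (hc₀ : 0 ≤ c)
    (hc : ∀ i, c ≤ D.grad t i) (j : Bool) (r : Fin m) :
    D.signal t j r + s * (κ * (c / 4) - τ * D.meanGrad t) ≤ D.signal (t + 1) j r := by
  obtain ⟨k, hk⟩ : ∃ k, 0 ≤ sgn k * sgn j * D.signal t j r := by
    rcases le_or_gt 0 (D.signal t j r) with hsgn | hsgn
    · exact ⟨j, by rwa [sgn_mul_self, one_mul]⟩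
    · exact ⟨!j, by rw [sgn_not, neg_mul, sgn_mul_self]; linarith⟩
  have hgrad := (h.le_classGrad (j := k) hc₀ fun i _ => hc i).trans (classGrad_le_activeGrad hk)
  have hdrift := mul_le_mul_of_nonneg_left (mul_le_mul_of_nonneg_left hgrad hκ) h.s_pos.le
  linarith [(abs_le.1 (h.signal_step t j r)).1]

lemma signal_succ_sub_le (h : D.Regular s κ τ N) (hκ : 0 ≤ κ) (j : Bool) (r : Fin m) :
    D.signal (t + 1) j r - D.signal t j r ≤ s * ((κ + τ) * D.meanGrad t) := by
  have hdrift := mul_le_mul_of_nonneg_left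
    (mul_le_mul_of_nonneg_left (activeGrad_le_meanGrad (D := D) t j r) hκ) h.s_pos.le
  linarith [(abs_le.1 (h.signal_step t j r)).2]

lemma abs_signal_succ_sub_of_pos (h : D.Regular s κ τ N) {j : Bool} {r : Fin m}
    (hpos : 0 < D.signal t j r) :
    |D.signal (t + 1) j r - D.signal t j r - s * (κ * D.classGrad t j)|
      ≤ s * (τ * D.meanGrad t) := by
  rw [← activeGrad_of_pos hpos]
  exact h.signal_step t j r

lemma signalMargin_succ_le (h : D.Regular s κ τ N) (hκ : 0 ≤ κ) (j : Bool) :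
    D.signalMargin (t + 1) j ≤ D.signalMargin t j + 2 * (s * ((κ + τ) * D.meanGrad t)) := by
  have hnonneg : 0 ≤ s * ((κ + τ) * D.meanGrad t) :=
    mul_nonneg h.s_pos.le (mul_nonneg (add_nonneg hκ h.τ_pos.le) (meanGrad_nonneg t))
  have hsum := Finset.sum_le_sum (s := Finset.univ) fun (r : Fin m) _ =>
    add_le_add (relu_sub_le hnonneg (h.signal_succ_sub_le (t := t) hκ j r))
      (relu_sub_le (a := -D.signal t (!j) r) (b := -D.signal (t + 1) (!j) r) hnonneg
        (by linarith [h.signal_succ_sub_le (t := t) hκ (!j) r]))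
  rw [← sub_le_iff_le_add', signalMargin_succ_sub, one_div,
    inv_mul_le_iff₀ (by exact_mod_cast h.m_pos), two_mul, mul_add]
  simpa using hsum

lemma signalMargin_succ_le_of_pos (h : D.Regular s κ τ N) (hpos : ∀ j r, 0 < D.signal t j r)
    (hpos' : ∀ j r, 0 < D.signal (t + 1) j r) (j : Bool) :
    D.signalMargin (t + 1) j
      ≤ D.signalMargin t j + s * (κ * D.classGrad t j + τ * D.meanGrad t) := by
  have hsum : ∑ r, (D.signal (t + 1) j r - D.signal t j r)
      ≤ ∑ _r : Fin m, s * (κ * D.classGrad t j + τ * D.meanGrad t) :=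
    Finset.sum_le_sum fun r _ => by
      linarith [(abs_le.1 (h.abs_signal_succ_sub_of_pos (hpos j r))).2]
  rw [signalMargin_of_pos hpos, signalMargin_of_pos hpos', ← sub_le_iff_le_add', ← mul_sub,
    ← Finset.sum_sub_distrib, one_div, inv_mul_le_iff₀ (by exact_mod_cast h.m_pos)]
  simpa using hsum

end Regular

/-- The parameters for which the dynamics is controlled: step size and interactions are small
compared with a lower bound `c₁` of the signal strength `κ`, and `b` bounds the growth rate
of the exponentials of the margins. -/
structure SmallParameters (c₁ b s κ τ : ℝ) : Prop where
  c₁_pos : 0 < c₁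
  κ_ge : c₁ ≤ κ
  κ_le : 400 * κ + 6 ≤ b
  τ_le : 2 * τ * (96 * b) ≤ 1 / 20
  τ_le' : 8 * τ * (96 * b) ≤ c₁
  burnIn_le : b * (48 * τ / c₁ + s) + 4 * τ ≤ 1 / 10

/-- A time after which all oriented signal correlations are positive. -/
def burnIn (s κ τ : ℝ) : ℕ := ⌈48 * τ / (κ * s)⌉₊

/-- The invariant of the training dynamics up to time `t`: the exponentials of the margins grow at a
linear rate, those within a class stay comparable, active neurons stay active, and the oriented
signal correlations increase. -/
structure Invariant (D : Correlations n m) (b s κ τ : ℝ) (t : ℕ) : Prop where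
  lower : ∀ i, 1 / 2 + s * t / 48 ≤ Real.exp (D.margin t i)
  upper : ∀ i, Real.exp (D.margin t i) ≤ 2 + 2 * s * b * t
  ratio : ∀ i k, D.label i = D.label k →
    Real.exp (D.margin t i) ≤ 400 * Real.exp (D.margin t k)
  active : ∀ i r, 0 ≤ D.noise 0 (D.label i) r i → 0 ≤ D.noise t (D.label i) r i
  early : t ≤ burnIn s κ τ → ∀ i, D.margin t i ≤ 4 * τ + s * b * t
  signal : ∀ j r, -τ + s * κ / 24 * min (t : ℝ) (burnIn s κ τ) ≤ D.signal t j r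

variable {c₁ b : ℝ}

namespace SmallParameters

lemma κ_pos (hs : SmallParameters c₁ b s κ τ) : 0 < κ := hs.c₁_pos.trans_le hs.κ_ge

lemma b_ge (hs : SmallParameters c₁ b s κ τ) : 6 ≤ b := by linarith [hs.κ_pos, hs.κ_le]

lemma le_burnIn (hs : SmallParameters c₁ b s κ τ) (hs₀ : 0 < s) :
    2 * τ ≤ s * κ / 24 * burnIn s κ τ := by
  have hceil : 48 * τ / (κ * s) ≤ burnIn s κ τ := Nat.le_ceil _
  rw [div_le_iff₀ (mul_pos hs.κ_pos hs₀)] at hceil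
  linarith

lemma mul_burnIn_le (hs : SmallParameters c₁ b s κ τ) (hs₀ : 0 < s) (hτ : 0 < τ) :
    b * (s * burnIn s κ τ) + 4 * τ ≤ 1 / 10 := by
  have hκ := hs.κ_pos
  have hceil : (burnIn s κ τ : ℝ) < 48 * τ / (κ * s) + 1 := Nat.ceil_lt_add_one (by positivity)
  have htime : s * burnIn s κ τ ≤ 48 * τ / c₁ + s := by
    calc s * burnIn s κ τ ≤ s * (48 * τ / (κ * s) + 1) := by gcongr
      _ = 48 * τ / κ + s := by field_simp
      _ ≤ 48 * τ / c₁ + s := by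
          have := hs.c₁_pos
          have := hs.κ_ge
          gcongr
  have hmul := mul_le_mul_of_nonneg_left htime (show 0 ≤ b by linarith [hs.b_ge])
  linarith [hs.burnIn_le]

lemma s_le (hs : SmallParameters c₁ b s κ τ) (hs₀ : 0 < s) (hτ : 0 < τ) : s ≤ 1 / 60 := by
  have hquot : 0 ≤ 48 * τ / c₁ := div_nonneg (by linarith) hs.c₁_pos.le
  nlinarith [hs.burnIn_le, hs.b_ge]

lemma τ_le_one_div (hs : SmallParameters c₁ b s κ τ) (hτ : 0 < τ) : τ ≤ 1 / 40 := by
  nlinarith [hs.τ_le, hs.b_ge]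

lemma interaction_le_signal (hs : SmallParameters c₁ b s κ τ) (t : ℕ) :
    τ * D.meanGrad t ≤ κ / 2 * (D.meanGrad t / (96 * b) / 4) := by
  have hb := hs.b_ge
  have hM := meanGrad_nonneg (D := D) t
  have hτ : τ ≤ κ / 2 / (96 * b * 4) := by
    rw [le_div_iff₀ (by positivity)]
    linarith [hs.τ_le', hs.κ_ge]
  calc τ * D.meanGrad t ≤ κ / 2 / (96 * b * 4) * D.meanGrad t := by gcongr
    _ = κ / 2 * (D.meanGrad t / (96 * b) / 4) := by field_simp

end SmallParameters

namespace Invariant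

variable {t : ℕ}

lemma exp_margin_ge (hI : D.Invariant b s κ τ t) (hs₀ : 0 < s) (i : Fin n) :
    1 / 2 ≤ Real.exp (D.margin t i) := by
  have htime : 0 ≤ s * t / 48 := by positivity
  linarith [hI.lower i]

lemma exp_mul_grad_ge (hI : D.Invariant b s κ τ t) (hs₀ : 0 < s) (i : Fin n) :
    1 / 3 ≤ Real.exp (D.margin t i) * D.grad t i := by
  have hexp := hI.exp_margin_ge hs₀ i
  unfold grad
  rw [mul_one_div, le_div_iff₀ (by positivity)]
  linarith

lemma grad_le_mul (hI : D.Invariant b s κ τ t) {i k : Fin n} (hik : D.label i = D.label k) :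
    D.grad t i ≤ 400 * D.grad t k := by
  have hratio := hI.ratio k i hik.symm
  unfold grad
  rw [mul_one_div, div_le_div_iff₀ (by positivity) (by positivity)]
  linarith

lemma meanGrad_le_mul (hI : D.Invariant b s κ τ t) (h : D.Regular s κ τ N)
    (hs : SmallParameters c₁ b s κ τ) (i : Fin n) : D.meanGrad t ≤ 96 * b * D.grad t i := by
  refine meanGrad_le h.n_pos fun k => ?_
  have hb := hs.b_ge
  have hlower : 0 ≤ b * (Real.exp (D.margin t k) - (1 / 2 + s * t / 48)) :=
    mul_nonneg (by linarith) (by linarith [hI.lower k])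
  have hupper := hI.upper i
  unfold grad
  rw [mul_one_div, div_le_div_iff₀ (by positivity) (by positivity)]
  linarith

lemma meanGrad_div_le (hI : D.Invariant b s κ τ t) (h : D.Regular s κ τ N)
    (hs : SmallParameters c₁ b s κ τ) (i : Fin n) : D.meanGrad t / (96 * b) ≤ D.grad t i := by
  rw [div_le_iff₀ (by linarith [hs.b_ge]), mul_comm]
  exact hI.meanGrad_le_mul h hs i

lemma interaction_le (hI : D.Invariant b s κ τ t) (h : D.Regular s κ τ N)
    (hs : SmallParameters c₁ b s κ τ) (i : Fin n) : 2 * τ * D.meanGrad t ≤ D.grad t i / 20 :=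
  h.interaction_le hs.τ_le (hI.meanGrad_le_mul h hs i)

lemma noiseMargin_succ_ge (hI : D.Invariant b s κ τ t) (h : D.Regular s κ τ N)
    (hs : SmallParameters c₁ b s κ τ) (i : Fin n) :
    D.noiseMargin t i + s * D.grad t i / 16 ≤ D.noiseMargin (t + 1) i :=
  h.noiseMargin_succ_ge (hI.interaction_le h hs i) (hI.active i)

lemma noiseMargin_succ_le (hI : D.Invariant b s κ τ t) (h : D.Regular s κ τ N)
    (hs : SmallParameters c₁ b s κ τ) (i : Fin n) :
    D.noiseMargin (t + 1) i ≤ D.noiseMargin t i + 5 * (s * D.grad t i) :=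
  h.noiseMargin_succ_le (hI.interaction_le h hs i)

lemma signal_le_succ (hI : D.Invariant b s κ τ t) (h : D.Regular s κ τ N)
    (hs : SmallParameters c₁ b s κ τ) (j : Bool) (r : Fin m) :
    D.signal t j r ≤ D.signal (t + 1) j r := by
  have hb := hs.b_ge
  have hc₀ : 0 ≤ D.meanGrad t / (96 * b) := div_nonneg (meanGrad_nonneg t) (by positivity)
  have hstep := h.signal_succ_ge hs.κ_pos.le hc₀ (hI.meanGrad_div_le h hs) j r
  have hκ := mul_nonneg hs.κ_pos.le hc₀
  have hdrift : 0 ≤ s * (κ * (D.meanGrad t / (96 * b) / 4) - τ * D.meanGrad t) :=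
    mul_nonneg h.s_pos.le (by linarith [hs.interaction_le_signal (D := D) t])
  linarith

lemma interaction_le_classGrad (hI : D.Invariant b s κ τ t) (h : D.Regular s κ τ N)
    (hs : SmallParameters c₁ b s κ τ) (j : Bool) :
    τ * D.meanGrad t ≤ κ / 2 * D.classGrad t j := by
  have hb := hs.b_ge
  have hκ := hs.κ_pos
  have hclass := h.le_classGrad (t := t) (j := j) (c := D.meanGrad t / (96 * b))
    (div_nonneg (meanGrad_nonneg t) (by positivity)) (fun i _ => hI.meanGrad_div_le h hs i)
  calc τ * D.meanGrad t ≤ κ / 2 * (D.meanGrad t / (96 * b) / 4) :=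
        hs.interaction_le_signal t
    _ ≤ κ / 2 * D.classGrad t j := by gcongr

lemma signal_pos (hI : D.Invariant b s κ τ t) (h : D.Regular s κ τ N)
    (hs : SmallParameters c₁ b s κ τ) (ht : burnIn s κ τ ≤ t) (j : Bool) (r : Fin m) :
    0 < D.signal t j r := by
  have hsignal := hI.signal j r
  rw [min_eq_right (by exact_mod_cast ht)] at hsignal
  linarith [hs.le_burnIn h.s_pos, h.τ_pos]

lemma margin_succ_ge (hI : D.Invariant b s κ τ t) (h : D.Regular s κ τ N)
    (hs : SmallParameters c₁ b s κ τ) (i : Fin n) :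
    D.margin t i + s * D.grad t i / 16 ≤ D.margin (t + 1) i := by
  have hnoise := hI.noiseMargin_succ_ge h hs i
  have hsignal := signalMargin_le_succ (hI.signal_le_succ h hs) (D.label i)
  unfold margin
  linarith

-- The gradient weight is of order `exp (-margin)`, so each step increases `exp margin` by a
-- constant.
lemma exp_margin_succ_ge (hI : D.Invariant b s κ τ t) (h : D.Regular s κ τ N)
    (hs : SmallParameters c₁ b s κ τ) (i : Fin n) :
    Real.exp (D.margin t i) + s / 48 ≤ Real.exp (D.margin (t + 1) i) := by
  have hstep := Real.exp_le_exp.2 (hI.margin_succ_ge h hs i)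
  rw [Real.exp_add] at hstep
  have hlin := mul_le_mul_of_nonneg_left (Real.add_one_le_exp (s * D.grad t i / 16))
    (Real.exp_pos (D.margin t i)).le
  have hgrad := mul_le_mul_of_nonneg_left (hI.exp_mul_grad_ge h.s_pos i) h.s_pos.le
  linarith

lemma margin_succ_le (hI : D.Invariant b s κ τ t) (h : D.Regular s κ τ N)
    (hs : SmallParameters c₁ b s κ τ) (i : Fin n) : D.margin (t + 1) i ≤ D.margin t i + s * b := by
  have hnoise := hI.noiseMargin_succ_le h hs i
  have hsignal := h.signalMargin_succ_le (t := t) hs.κ_pos.le (D.label i)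
  have hmean : (κ + τ) * D.meanGrad t ≤ (κ + τ) * 1 :=
    mul_le_mul_of_nonneg_left (meanGrad_le_one h.n_pos t) (by linarith [hs.κ_pos, h.τ_pos])
  have hrate : 2 * ((κ + τ) * D.meanGrad t) + 5 * D.grad t i ≤ b := by
    linarith [grad_le_one (D := D) t i, hs.κ_le, hs.κ_pos, hs.τ_le_one_div h.τ_pos]
  have hmul := mul_le_mul_of_nonneg_left hrate h.s_pos.le
  unfold margin
  linarith

lemma margin_succ_le_of_burnIn_le (hI : D.Invariant b s κ τ t) (h : D.Regular s κ τ N)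
    (hs : SmallParameters c₁ b s κ τ) (ht : burnIn s κ τ ≤ t) (i : Fin n) :
    D.margin (t + 1) i ≤ D.margin t i + s * b * D.grad t i := by
  have hg := grad_pos (D := D) t i
  have hpos := hI.signal_pos h hs ht
  have hnoise := hI.noiseMargin_succ_le h hs i
  have hsignal := h.signalMargin_succ_le_of_pos hpos
    (fun j r => (hpos j r).trans_le (hI.signal_le_succ h hs j r)) (D.label i)
  have hclass := mul_le_mul_of_nonneg_left (classGrad_le h.n_pos (t := t) (by positivity)
    fun k (hk : D.label k = D.label i) => hI.grad_le_mul hk) hs.κ_pos.le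
  have hrate : κ * D.classGrad t (D.label i) + τ * D.meanGrad t + 5 * D.grad t i
      ≤ b * D.grad t i := by
    linarith [hI.interaction_le h hs i, mul_le_mul_of_nonneg_right hs.κ_le hg.le]
  have hmul := mul_le_mul_of_nonneg_left hrate h.s_pos.le
  unfold margin
  linarith

lemma margin_succ_sub_le (hI : D.Invariant b s κ τ t) (h : D.Regular s κ τ N)
    (hs : SmallParameters c₁ b s κ τ) {i k : Fin n} (hik : D.label i = D.label k) :
    D.margin (t + 1) i - D.margin (t + 1) k
      ≤ D.margin t i - D.margin t k + s * (5 * D.grad t i - D.grad t k / 16) := by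
  unfold margin
  rw [hik]
  linarith [hI.noiseMargin_succ_le h hs i, hI.noiseMargin_succ_ge h hs k]

lemma grad_le_of_ratio_gt (hI : D.Invariant b s κ τ t) (hs₀ : 0 < s) {i k : Fin n}
    (hgt : 240 * Real.exp (D.margin t k) < Real.exp (D.margin t i)) :
    80 * D.grad t i ≤ D.grad t k := by
  have hexp := hI.exp_margin_ge hs₀ k
  unfold grad
  rw [mul_one_div, div_le_div_iff₀ (by positivity) (by positivity)]
  linarith

-- Within a class the signal margins cancel. Once the ratio exceeds 240, the gradient weight of the
-- larger margin is so small that the ratio decreases; below 240, one step does not lead beyond 400.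
lemma ratio_succ (hI : D.Invariant b s κ τ t) (h : D.Regular s κ τ N)
    (hs : SmallParameters c₁ b s κ τ) {i k : Fin n} (hik : D.label i = D.label k) :
    Real.exp (D.margin (t + 1) i) ≤ 400 * Real.exp (D.margin (t + 1) k) := by
  have hexp : Real.exp (D.margin (t + 1) i) ≤
      Real.exp (D.margin t i) / Real.exp (D.margin t k)
        * Real.exp (s * (5 * D.grad t i - D.grad t k / 16)) * Real.exp (D.margin (t + 1) k) := by
    rw [← Real.exp_sub, ← Real.exp_add, ← Real.exp_add]
    exact Real.exp_le_exp.2 (by linarith [hI.margin_succ_sub_le h hs hik])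
  refine hexp.trans (mul_le_mul_of_nonneg_right ?_ (Real.exp_pos _).le)
  rcases le_or_gt (Real.exp (D.margin t i)) (240 * Real.exp (D.margin t k)) with hle | hgt
  · have hratio : Real.exp (D.margin t i) / Real.exp (D.margin t k) ≤ 240 := by
      rwa [div_le_iff₀ (Real.exp_pos _)]
    have hstep : Real.exp (s * (5 * D.grad t i - D.grad t k / 16)) ≤ 1 + 2 * (1 / 10) := by
      refine le_trans (Real.exp_le_exp.2 ?_) (exp_le_one_add_two_mul (by norm_num) (by norm_num))
      linarith [mul_le_mul_of_nonneg_left (grad_le_one (D := D) t i) h.s_pos.le,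
        mul_pos h.s_pos (grad_pos (D := D) t k), hs.s_le h.s_pos h.τ_pos]
    calc Real.exp (D.margin t i) / Real.exp (D.margin t k)
          * Real.exp (s * (5 * D.grad t i - D.grad t k / 16))
        ≤ 240 * (1 + 2 * (1 / 10)) := by gcongr
      _ ≤ 400 := by norm_num
  · have hratio : Real.exp (D.margin t i) / Real.exp (D.margin t k) ≤ 400 := by
      rw [div_le_iff₀ (Real.exp_pos _)]
      exact hI.ratio i k hik
    have hgrad := hI.grad_le_of_ratio_gt h.s_pos hgt
    have hstep : Real.exp (s * (5 * D.grad t i - D.grad t k / 16)) ≤ 1 :=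
      Real.exp_le_one_iff.2 (mul_nonpos_of_nonneg_of_nonpos h.s_pos.le
        (by linarith [grad_pos (D := D) t i]))
    calc Real.exp (D.margin t i) / Real.exp (D.margin t k)
          * Real.exp (s * (5 * D.grad t i - D.grad t k / 16))
        ≤ 400 * 1 := by gcongr
      _ = 400 := mul_one _

end Invariant

lemma SmallParameters.τ_init_le (hs : SmallParameters c₁ b s κ τ) (hs₀ : 0 < s) (hτ : 0 < τ) :
    4 * τ ≤ 1 / 10 := by
  have hb := hs.b_ge
  have htime : 0 ≤ b * (s * burnIn s κ τ) := by positivity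
  linarith [hs.mul_burnIn_le hs₀ hτ]

lemma SmallParameters.mul_le_one (hs : SmallParameters c₁ b s κ τ) (hτ : 0 < τ) :
    s * b ≤ 1 := by
  have hquot : 0 ≤ b * (48 * τ / c₁) :=
    mul_nonneg (by linarith [hs.b_ge]) (div_nonneg (by linarith) hs.c₁_pos.le)
  linarith [hs.burnIn_le]

lemma exp_mul_grad_le_one (t : ℕ) (i : Fin n) : Real.exp (D.margin t i) * D.grad t i ≤ 1 := by
  unfold grad
  rw [mul_one_div, div_le_one (by positivity)]
  linarith

namespace Invariant

variable {t : ℕ}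

lemma early_succ (hI : D.Invariant b s κ τ t) (h : D.Regular s κ τ N)
    (hs : SmallParameters c₁ b s κ τ) (ht : t + 1 ≤ burnIn s κ τ) (i : Fin n) :
    D.margin (t + 1) i ≤ 4 * τ + s * b * (t + 1 : ℕ) := by
  push_cast
  linarith [hI.early (by omega) i, hI.margin_succ_le h hs i]

lemma exp_le_of_early (h : D.Regular s κ τ N) (hs : SmallParameters c₁ b s κ τ)
    (ht : t ≤ burnIn s κ τ) {i : Fin n} (hearly : D.margin t i ≤ 4 * τ + s * b * t) :
    Real.exp (D.margin t i) ≤ 1 + 2 * (1 / 10) := by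
  have hs₀ := h.s_pos
  have hb := hs.b_ge
  have htime : s * b * t ≤ s * b * burnIn s κ τ := by gcongr
  exact le_trans (Real.exp_le_exp.2 (by linarith [hs.mul_burnIn_le hs₀ h.τ_pos]))
    (exp_le_one_add_two_mul (by norm_num) (by norm_num))

lemma upper_succ (hI : D.Invariant b s κ τ t) (h : D.Regular s κ τ N)
    (hs : SmallParameters c₁ b s κ τ) (i : Fin n) :
    Real.exp (D.margin (t + 1) i) ≤ 2 + 2 * s * b * (t + 1 : ℕ) := by
  have hb := hs.b_ge
  have hs₀ := h.s_pos
  rcases lt_or_ge t (burnIn s κ τ) with ht | ht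
  · have hexp := exp_le_of_early h hs ht (hI.early_succ h hs ht i)
    have htime : 0 ≤ 2 * s * b * (t + 1 : ℕ) := by positivity
    linarith
  · have hg := grad_pos (D := D) t i
    have hstep := Real.exp_le_exp.2 (hI.margin_succ_le_of_burnIn_le h hs ht i)
    rw [Real.exp_add] at hstep
    have hlin := mul_le_mul_of_nonneg_left
      (exp_le_one_add_two_mul (x := s * b * D.grad t i) (by positivity)
        (mul_le_one₀ (hs.mul_le_one h.τ_pos) hg.le (grad_le_one t i)))
      (Real.exp_pos (D.margin t i)).le
    have hgrad := mul_le_mul_of_nonneg_left (exp_mul_grad_le_one (D := D) t i)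
      (show 0 ≤ 2 * s * b by positivity)
    push_cast
    linarith [hI.upper i]

lemma one_third_le_grad (hI : D.Invariant b s κ τ t) (h : D.Regular s κ τ N)
    (hs : SmallParameters c₁ b s κ τ) (ht : t ≤ burnIn s κ τ) (i : Fin n) :
    1 / 3 ≤ D.grad t i := by
  have hexp := exp_le_of_early h hs ht (hI.early ht i)
  unfold grad
  rw [div_le_div_iff₀ (by norm_num) (by positivity)]
  linarith

lemma signal_succ (hI : D.Invariant b s κ τ t) (h : D.Regular s κ τ N)
    (hs : SmallParameters c₁ b s κ τ) (j : Bool) (r : Fin m) :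
    -τ + s * κ / 24 * min ((t + 1 : ℕ) : ℝ) (burnIn s κ τ) ≤ D.signal (t + 1) j r := by
  have hsignal := hI.signal j r
  rcases lt_or_ge t (burnIn s κ τ) with ht | ht
  · have hsucc : ((t : ℝ) + 1) ≤ burnIn s κ τ := by exact_mod_cast ht
    rw [min_eq_left (by linarith)] at hsignal
    push_cast
    rw [min_eq_left hsucc]
    have hstep := h.signal_succ_ge hs.κ_pos.le (by norm_num) (hI.one_third_le_grad h hs ht.le) j r
    have hinter : τ * D.meanGrad t ≤ κ / 24 := by
      have hτ : τ ≤ κ / 24 := by nlinarith [hs.τ_le', hs.κ_ge, hs.b_ge, h.τ_pos]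
      exact (mul_le_of_le_one_right h.τ_pos.le (meanGrad_le_one h.n_pos t)).trans hτ
    linarith [mul_le_mul_of_nonneg_left hinter h.s_pos.le]
  · rw [min_eq_right (by exact_mod_cast ht)] at hsignal
    rw [min_eq_right (by exact_mod_cast ht.trans t.le_succ)]
    exact hsignal.trans (hI.signal_le_succ h hs j r)

lemma succ (hI : D.Invariant b s κ τ t) (h : D.Regular s κ τ N)
    (hs : SmallParameters c₁ b s κ τ) : D.Invariant b s κ τ (t + 1) where
  lower i := by
    push_cast
    linarith [hI.exp_margin_succ_ge h hs i, hI.lower i]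
  upper := hI.upper_succ h hs
  ratio _ _ := hI.ratio_succ h hs
  active i r hr := h.noise_succ_own_nonneg (hI.interaction_le h hs i) (hI.active i r hr)
  early := hI.early_succ h hs
  signal := hI.signal_succ h hs

end Invariant

lemma abs_mean_le (hm : 0 < m) {x : Fin m → ℝ} {c : ℝ} (hx : ∀ r, |x r| ≤ c) :
    |(1 / (m : ℝ)) * ∑ r, x r| ≤ c := by
  have hm' : (0 : ℝ) < m := by exact_mod_cast hm
  rw [abs_mul, abs_of_pos (by positivity), one_div, inv_mul_le_iff₀ hm']
  refine (Finset.abs_sum_le_sum_abs _ _).trans ?_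
  simpa using Finset.sum_le_sum (s := Finset.univ) fun r _ => hx r

lemma abs_relu_sub_relu_le {a a' c : ℝ} (ha : |a| ≤ c) (ha' : |a'| ≤ c) :
    |relu a - relu a'| ≤ 2 * c :=
  (abs_relu_sub_le a a').trans ((abs_sub _ _).trans (by linarith))

namespace Regular

lemma abs_signalMargin_zero_le (h : D.Regular s κ τ N) (j : Bool) :
    |D.signalMargin 0 j| ≤ 2 * τ :=
  abs_mean_le h.m_pos fun r => abs_relu_sub_relu_le (h.signal_init _ r)
    ((abs_neg _).trans_le (h.signal_init _ r))

lemma abs_noiseMargin_zero_le (h : D.Regular s κ τ N) (i : Fin n) :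
    |D.noiseMargin 0 i| ≤ 2 * τ :=
  abs_mean_le h.m_pos fun r => abs_relu_sub_relu_le (h.noise_init _ r i) (h.noise_init _ r i)

lemma abs_margin_zero_le (h : D.Regular s κ τ N) (i : Fin n) : |D.margin 0 i| ≤ 4 * τ :=
  (abs_add_le _ _).trans
    (by linarith [h.abs_signalMargin_zero_le (D.label i), h.abs_noiseMargin_zero_le i])

lemma invariant_zero (h : D.Regular s κ τ N) (hs : SmallParameters c₁ b s κ τ) :
    D.Invariant b s κ τ 0 := by
  have hτ := hs.τ_init_le h.s_pos h.τ_pos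
  have hupper : ∀ i, Real.exp (D.margin 0 i) ≤ 1 + 2 * (1 / 10) := fun i =>
    le_trans (Real.exp_le_exp.2 ((le_abs_self _).trans ((h.abs_margin_zero_le i).trans hτ)))
      (exp_le_one_add_two_mul (by norm_num) (by norm_num))
  have hlower : ∀ i, 9 / 10 ≤ Real.exp (D.margin 0 i) := fun i => by
    linarith [Real.add_one_le_exp (D.margin 0 i), (abs_le.1 (h.abs_margin_zero_le i)).1]
  refine ⟨fun i => ?_, fun i => ?_, fun i k _ => ?_, fun i r hr => hr, fun _ i => ?_,
    fun j r => ?_⟩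
  · norm_num
    linarith [hlower i]
  · norm_num
    linarith [hupper i]
  · linarith [hupper i, hlower k]
  · simpa using (abs_le.1 (h.abs_margin_zero_le i)).2
  · simpa using (abs_le.1 (h.signal_init j r)).1

theorem invariant (h : D.Regular s κ τ N) (hs : SmallParameters c₁ b s κ τ) (t : ℕ) :
    D.Invariant b s κ τ t := by
  induction t with
  | zero => exact h.invariant_zero hs
  | succ t ih => exact ih.succ h hs

end Regular

/-- The accumulated gradient weight of a training point. -/
def accGrad (D : Correlations n m) (s : ℝ) (t : ℕ) (i : Fin n) : ℝ :=
  ∑ u ∈ Finset.range t, s * D.grad u i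

/-- The accumulated contribution of a class to the mean gradient weight. -/
def accClassGrad (D : Correlations n m) (s : ℝ) (t : ℕ) (j : Bool) : ℝ :=
  ∑ u ∈ Finset.range t, s * D.classGrad u j

variable {t : ℕ}

lemma accGrad_zero (i : Fin n) : D.accGrad s 0 i = 0 := rfl

lemma accClassGrad_zero (j : Bool) : D.accClassGrad s 0 j = 0 := rfl

lemma accGrad_succ (t : ℕ) (i : Fin n) :
    D.accGrad s (t + 1) i = D.accGrad s t i + s * D.grad t i := Finset.sum_range_succ _ _

lemma accClassGrad_succ (t : ℕ) (j : Bool) :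
    D.accClassGrad s (t + 1) j = D.accClassGrad s t j + s * D.classGrad t j :=
  Finset.sum_range_succ _ _

lemma accClassGrad_nonneg (hs₀ : 0 ≤ s) (t : ℕ) (j : Bool) : 0 ≤ D.accClassGrad s t j :=
  Finset.sum_nonneg fun u _ => mul_nonneg hs₀ (classGrad_nonneg u j)

namespace Regular

lemma accGrad_le (h : D.Regular s κ τ N) (hs : SmallParameters c₁ b s κ τ) (t : ℕ) (i : Fin n) :
    D.accGrad s t i ≤ 1600 * D.accClassGrad s t (D.label i) := by
  unfold accGrad accClassGrad
  rw [Finset.mul_sum]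
  refine Finset.sum_le_sum fun u _ => ?_
  have hclass := h.le_classGrad (t := u) (j := D.label i) (c := D.grad u i / 400)
    (div_nonneg (grad_pos u i).le (by norm_num)) (fun k hk => by
      linarith [(h.invariant hs u).grad_le_mul hk.symm])
  linarith [mul_le_mul_of_nonneg_left hclass h.s_pos.le]

lemma noise_le_accGrad (h : D.Regular s κ τ N) (hs : SmallParameters c₁ b s κ τ) (t : ℕ)
    (j : Bool) (r : Fin m) (i : Fin n) : D.noise t j r i ≤ τ + 3 * D.accGrad s t i := by
  induction t with
  | zero => simpa [accGrad_zero] using (abs_le.1 (h.noise_init j r i)).2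
  | succ t ih =>
    have hstep := h.abs_noise_succ_sub_le ((h.invariant hs t).interaction_le h hs i) j r
    rw [accGrad_succ]
    linarith [(abs_le.1 hstep).2, mul_pos h.s_pos (grad_pos (D := D) t i)]

lemma noiseMargin_le_accGrad (h : D.Regular s κ τ N) (hs : SmallParameters c₁ b s κ τ) (t : ℕ)
    (i : Fin n) : D.noiseMargin t i ≤ 2 * τ + 5 * D.accGrad s t i := by
  induction t with
  | zero => simpa [accGrad_zero] using (abs_le.1 (h.abs_noiseMargin_zero_le i)).2
  | succ t ih =>
    rw [accGrad_succ]
    linarith [(h.invariant hs t).noiseMargin_succ_le h hs i]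

lemma noiseMargin_ge (h : D.Regular s κ τ N) (hs : SmallParameters c₁ b s κ τ) (t : ℕ)
    (i : Fin n) : -(2 * τ) ≤ D.noiseMargin t i := by
  induction t with
  | zero => exact (abs_le.1 (h.abs_noiseMargin_zero_le i)).1
  | succ t ih =>
    linarith [(h.invariant hs t).noiseMargin_succ_ge h hs i,
      mul_pos h.s_pos (grad_pos (D := D) t i)]

lemma signalMargin_le_accClassGrad (h : D.Regular s κ τ N) (hs : SmallParameters c₁ b s κ τ)
    (t : ℕ) (j : Bool) : D.signalMargin t j
      ≤ 2 * τ + b * (s * min (t : ℝ) (burnIn s κ τ)) + 3 / 2 * κ * D.accClassGrad s t j := by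
  induction t with
  | zero => simpa [accClassGrad_zero] using (abs_le.1 (h.abs_signalMargin_zero_le j)).2
  | succ t ih =>
    have hI := h.invariant hs t
    have hclass := mul_nonneg hs.κ_pos.le
      (mul_nonneg h.s_pos.le (classGrad_nonneg (D := D) t j))
    rw [accClassGrad_succ]
    rcases lt_or_ge t (burnIn s κ τ) with ht | ht
    · have hsucc : ((t : ℝ) + 1) ≤ burnIn s κ τ := by exact_mod_cast ht
      rw [min_eq_left (by linarith)] at ih
      push_cast
      rw [min_eq_left hsucc]
      have hmean : (κ + τ) * D.meanGrad t ≤ (κ + τ) * 1 :=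
        mul_le_mul_of_nonneg_left (meanGrad_le_one h.n_pos t) (by linarith [hs.κ_pos, h.τ_pos])
      have hrate : 2 * ((κ + τ) * D.meanGrad t) ≤ b := by
        linarith [hs.κ_le, hs.κ_pos, hs.τ_le_one_div h.τ_pos]
      linarith [h.signalMargin_succ_le (t := t) hs.κ_pos.le j,
        mul_le_mul_of_nonneg_left hrate h.s_pos.le]
    · rw [min_eq_right (by exact_mod_cast ht)] at ih
      rw [min_eq_right (by exact_mod_cast ht.trans t.le_succ)]
      have hpos := hI.signal_pos h hs ht
      linarith [h.signalMargin_succ_le_of_pos hpos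
          (fun j r => (hpos j r).trans_le (hI.signal_le_succ h hs j r)) j,
        mul_le_mul_of_nonneg_left (hI.interaction_le_classGrad h hs j) h.s_pos.le]

lemma signal_ge_accClassGrad (h : D.Regular s κ τ N) (hs : SmallParameters c₁ b s κ τ) (t : ℕ)
    (j : Bool) (r : Fin m) :
    -τ + κ / 2 * (D.accClassGrad s t j - s * min (t : ℝ) (burnIn s κ τ)) ≤ D.signal t j r := by
  induction t with
  | zero => simpa [accClassGrad_zero] using (abs_le.1 (h.signal_init j r)).1
  | succ t ih =>
    have hI := h.invariant hs t
    rw [accClassGrad_succ]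
    rcases lt_or_ge t (burnIn s κ τ) with ht | ht
    · have hsucc : ((t : ℝ) + 1) ≤ burnIn s κ τ := by exact_mod_cast ht
      rw [min_eq_left (by linarith)] at ih
      push_cast
      rw [min_eq_left hsucc]
      have hclass := mul_le_mul_of_nonneg_left
        ((classGrad_le_meanGrad (D := D) t j).trans (meanGrad_le_one h.n_pos t)) h.s_pos.le
      linarith [hI.signal_le_succ h hs j r,
        mul_le_mul_of_nonneg_left hclass (half_pos hs.κ_pos).le]
    · rw [min_eq_right (by exact_mod_cast ht)] at ih
      rw [min_eq_right (by exact_mod_cast ht.trans t.le_succ)]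
      linarith [(abs_le.1 (h.abs_signal_succ_sub_of_pos (hI.signal_pos h hs ht j r))).1,
        mul_le_mul_of_nonneg_left (hI.interaction_le_classGrad h hs j) h.s_pos.le]

lemma exists_label_eq (h : D.Regular s κ τ N) (j : Bool) : ∃ i, D.label i = j := by
  have hn : (0 : ℝ) < n := by exact_mod_cast h.n_pos
  have hcard : (0 : ℝ) < (Finset.univ.filter fun i => D.label i = j).card := by
    linarith [h.class_ge j]
  obtain ⟨i, hi⟩ := Finset.card_pos.1 (by exact_mod_cast hcard)
  exact ⟨i, (Finset.mem_filter.1 hi).2⟩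

end Regular

lemma SmallParameters.burnIn_time_le (hs : SmallParameters c₁ b s κ τ) (hs₀ : 0 < s)
    (hτ : 0 < τ) : s * burnIn s κ τ ≤ 1 / 60 := by
  have htime : 0 ≤ s * (burnIn s κ τ : ℝ) := by positivity
  nlinarith [hs.mul_burnIn_le hs₀ hτ, hs.b_ge]

lemma Regular.burnIn_le_of_time_ge (h : D.Regular s κ τ N) (hs : SmallParameters c₁ b s κ τ)
    (ht : 2 * b + 2 ≤ s * t) : burnIn s κ τ ≤ t := by
  have htime : s * (burnIn s κ τ : ℝ) ≤ s * t := by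
    linarith [hs.burnIn_time_le h.s_pos h.τ_pos, hs.b_ge]
  exact_mod_cast le_of_mul_le_mul_left htime h.s_pos

lemma log_forty_eight_le : Real.log 48 ≤ 4 := by
  rw [Real.log_le_iff_le_exp (by norm_num)]
  have he : (2.7 : ℝ) ≤ Real.exp 1 := by linarith [Real.exp_one_gt_d9]
  calc (48 : ℝ) ≤ 2.7 ^ 4 := by norm_num
    _ ≤ Real.exp 1 ^ 4 := by gcongr
    _ = Real.exp 4 := by rw [← Real.exp_nat_mul]; norm_num

namespace Invariant

lemma log_sub_le_margin (hI : D.Invariant b s κ τ t) (ht : 0 < s * t) (i : Fin n) :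
    Real.log (s * t) - 4 ≤ D.margin t i := by
  have hlog := Real.log_le_log (by positivity)
    (show s * t / 48 ≤ Real.exp (D.margin t i) by linarith [hI.lower i])
  rw [Real.log_exp, Real.log_div ht.ne' (by norm_num)] at hlog
  linarith [log_forty_eight_le]

lemma margin_le_two_mul_log (hI : D.Invariant b s κ τ t) (hb : 0 ≤ b)
    (ht : 2 * b + 2 ≤ s * t) (i : Fin n) : D.margin t i ≤ 2 * Real.log (s * t) := by
  have hlog := Real.log_le_log (Real.exp_pos _)
    (show Real.exp (D.margin t i) ≤ (s * t) ^ 2 by nlinarith [hI.upper i])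
  rwa [Real.log_exp, Real.log_pow] at hlog

end Invariant

namespace Regular

lemma signal_ge_of_accClassGrad (h : D.Regular s κ τ N) (hs : SmallParameters c₁ b s κ τ)
    (t : ℕ) (j : Bool) (r : Fin m) :
    κ / 2 * D.accClassGrad s t j - 1 / 5 ≤ D.signal t j r := by
  have hmin := mul_le_mul_of_nonneg_left (min_le_right (t : ℝ) (burnIn s κ τ)) h.s_pos.le
  have hburn : κ / 2 * (s * burnIn s κ τ) ≤ 1 / 10 := by
    have htime : 0 ≤ s * (burnIn s κ τ : ℝ) := mul_nonneg h.s_pos.le (Nat.cast_nonneg _)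
    nlinarith [hs.κ_le, hs.κ_pos, hs.mul_burnIn_le h.s_pos h.τ_pos, h.τ_pos]
  linarith [h.signal_ge_accClassGrad hs t j r, hs.τ_le_one_div h.τ_pos,
    mul_le_mul_of_nonneg_left hmin (half_pos hs.κ_pos).le]

/-- The margin of a training point is of order `log (s * t)` and, for a strong signal, mostly due to
the signal patch, so that every neuron has learned a signal of this order. -/
theorem log_le_signal (h : D.Regular s κ τ N) (hs : SmallParameters c₁ b s κ τ)
    (hκ : 16000 ≤ κ) (ht : 0 < s * t) (hlog : 40 ≤ Real.log (s * t)) (j : Bool) (r : Fin m) :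
    Real.log (s * t) / 8 ≤ D.signal t j r := by
  obtain ⟨i, rfl⟩ := h.exists_label_eq j
  have hburn : b * (s * min (t : ℝ) (burnIn s κ τ)) ≤ b * (s * burnIn s κ τ) := by
    have := h.s_pos
    have := hs.b_ge
    gcongr
    exact min_le_right _ _
  have hκacc := mul_nonneg (sub_nonneg.2 hκ)
    (accClassGrad_nonneg (D := D) h.s_pos.le t (D.label i))
  have hmargin := (h.invariant hs t).log_sub_le_margin ht i
  unfold margin at hmargin
  linarith [h.signalMargin_le_accClassGrad hs t (D.label i), h.noiseMargin_le_accGrad hs t i,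
    h.accGrad_le hs t i, h.signal_ge_of_accClassGrad hs t (D.label i) r,
    hs.mul_burnIn_le h.s_pos h.τ_pos, hs.τ_le_one_div h.τ_pos]

/-- The signal patch alone produces a margin of order `κ * accGrad`, while the margin is only
logarithmic, so little noise is memorized when `κ` is large. -/
theorem accGrad_le_log_div (h : D.Regular s κ τ N) (hs : SmallParameters c₁ b s κ τ)
    (ht : 2 * b + 2 ≤ s * t) (hlog : 40 ≤ Real.log (s * t)) (i : Fin n) :
    D.accGrad s t i ≤ 10000 * Real.log (s * t) / κ := by
  have hI := h.invariant hs t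
  have hsignal : κ / 2 * D.accClassGrad s t (D.label i) - 1 / 5
      ≤ D.signalMargin t (D.label i) := by
    rw [signalMargin_of_pos (hI.signal_pos h hs (h.burnIn_le_of_time_ge hs ht)), one_div (m : ℝ),
      le_inv_mul_iff₀ (by exact_mod_cast h.m_pos)]
    simpa using Finset.card_nsmul_le_sum Finset.univ _ _ fun r _ =>
      h.signal_ge_of_accClassGrad hs t (D.label i) r
  have hmargin := hI.margin_le_two_mul_log (by linarith [hs.b_ge]) ht i
  unfold margin at hmargin
  rw [le_div_iff₀ hs.κ_pos]
  linarith [h.noiseMargin_ge hs t i, mul_le_mul_of_nonneg_right (h.accGrad_le hs t i) hs.κ_pos.le,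
    hs.τ_le_one_div h.τ_pos]

end Regular

end Correlations

variable {d n m : ℕ}

/-- The correlations of the iterates of gradient descent with the signal and the noise patches. -/
def correlations (μ : Vec d) (η : ℝ) (y : Fin n → Bool) (ξ : Fin n → Vec d) (W₀ : Weights d m) :
    Correlations n m where
  label := y
  signal t j r := sgn j * inner ℝ (gd μ η y ξ W₀ t j r) μ
  noise t j r i := inner ℝ (gd μ η y ξ W₀ t j r) (ξ i)

/-- Noise patches and initial weights in general position: the patches have squared norm of order
`σ² d`, are nearly orthogonal to each other and to the signal, and the initial weights are small
with a quarter of the neurons of either branch active on each patch. -/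
structure Typical (μ : Vec d) (σ τ : ℝ) (ξ : Fin n → Vec d) (W₀ : Weights d m) : Prop where
  norm_ge : ∀ i, σ ^ 2 * d / 2 ≤ ‖ξ i‖ ^ 2
  norm_le : ∀ i, ‖ξ i‖ ^ 2 ≤ 2 * (σ ^ 2 * d)
  inner_noise : ∀ i k, i ≠ k → n * |inner ℝ (ξ i) (ξ k)| ≤ τ * (σ ^ 2 * d)
  inner_signal : ∀ i, n * |inner ℝ μ (ξ i)| ≤ τ * (σ ^ 2 * d)
  init_noise : ∀ j r i, |inner ℝ (W₀ j r) (ξ i)| ≤ τ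
  init_signal : ∀ j r, |inner ℝ (W₀ j r) μ| ≤ τ
  init_norm : ∀ j r, σ * ‖W₀ j r‖ ≤ τ * √((n : ℝ) / d)
  active : ∀ j i, (m : ℝ) / 4 ≤ (Finset.univ.filter fun r => 0 ≤ inner ℝ (W₀ j r) (ξ i)).card

lemma abs_sum_mul_le {ι : Type*} (S : Finset ι) {a x g : ι → ℝ} {c : ℝ}
    (ha : ∀ k ∈ S, |a k| ≤ g k) (hx : ∀ k ∈ S, |x k| ≤ c) :
    |∑ k ∈ S, a k * x k| ≤ (∑ k ∈ S, g k) * c := by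
  refine (Finset.abs_sum_le_sum_abs _ _).trans ?_
  rw [Finset.sum_mul]
  refine Finset.sum_le_sum fun k hk => ?_
  rw [abs_mul]
  exact mul_le_mul (ha k hk) (hx k hk) (abs_nonneg _) ((abs_nonneg _).trans (ha k hk))

lemma norm_sum_smul_sq_le {E ι : Type*} [SeminormedAddCommGroup E] [InnerProductSpace ℝ E]
    [Fintype ι] {a : ι → ℝ} {v : ι → E} {A B : ℝ} (ha : ∀ k, |a k| ≤ A)
    (hrow : ∀ k, ∑ l, |inner ℝ (v k) (v l)| ≤ B) :
    ‖∑ k, a k • v k‖ ^ 2 ≤ Fintype.card ι * (A ^ 2 * B) := by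
  have hrow' : ∀ k, ∑ l, a k * (a l * inner ℝ (v k) (v l)) ≤ A ^ 2 * B := fun k => by
    have hA := (abs_nonneg _).trans (ha k)
    calc ∑ l, a k * (a l * inner ℝ (v k) (v l))
        ≤ ∑ l, A * (A * |inner ℝ (v k) (v l)|) := Finset.sum_le_sum fun l _ => by
          refine (le_abs_self _).trans ?_
          rw [abs_mul, abs_mul]
          gcongr
          exacts [ha k, ha l]
      _ = A ^ 2 * ∑ l, |inner ℝ (v k) (v l)| := by
          simp only [← Finset.mul_sum]
          ring
      _ ≤ A ^ 2 * B := by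
          gcongr
          exact hrow k
  rw [← real_inner_self_eq_norm_sq, sum_inner]
  simp only [inner_sum, real_inner_smul_left, real_inner_smul_right]
  simpa [mul_left_comm] using Finset.sum_le_sum (s := Finset.univ) fun k _ => hrow' k

namespace Correlations

section Coefficients

variable (D : Correlations n m)

/-- The coefficient of the noise patch `ξ_k` in the negative gradient of the training loss with
respect to the weight `w_{j,r}`, up to the factor `1 / (n m)`. -/
def noiseCoeff (t : ℕ) (j : Bool) (r : Fin m) (k : Fin n) : ℝ :=
  D.grad t k * reluDeriv (D.noise t j r k) * (sgn j * sgn (D.label k))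

/-- The contribution of the `k`-th training point to the coefficient of `μ` in the negative gradient
of the training loss with respect to the weight `w_{j,r}`, up to the factor `1 / (n m)`. -/
def signalCoeff (t : ℕ) (j : Bool) (r : Fin m) (k : Fin n) : ℝ :=
  D.grad t k * reluDeriv (sgn (D.label k) * sgn j * D.signal t j r) * sgn j

end Coefficients

variable {D : Correlations n m}

lemma abs_noiseCoeff_le (t : ℕ) (j : Bool) (r : Fin m) (k : Fin n) :
    |D.noiseCoeff t j r k| ≤ D.grad t k := by
  have hg := grad_pos (D := D) t k
  rw [noiseCoeff, abs_mul, abs_mul, abs_mul, abs_sgn, abs_sgn, mul_one, mul_one, abs_of_pos hg,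
    abs_of_nonneg (reluDeriv_nonneg _)]
  exact mul_le_of_le_one_right hg.le (reluDeriv_le_one _)

lemma abs_signalCoeff_le (t : ℕ) (j : Bool) (r : Fin m) (k : Fin n) :
    |D.signalCoeff t j r k| ≤ D.grad t k := by
  have hg := grad_pos (D := D) t k
  rw [signalCoeff, abs_mul, abs_mul, abs_sgn, mul_one, abs_of_pos hg,
    abs_of_nonneg (reluDeriv_nonneg _)]
  exact mul_le_of_le_one_right hg.le (reluDeriv_le_one _)

lemma sgn_mul_sum_signalCoeff (t : ℕ) (j : Bool) (r : Fin m) :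
    sgn j * ∑ k, D.signalCoeff t j r k
      = ∑ k, D.grad t k * reluDeriv (sgn (D.label k) * sgn j * D.signal t j r) := by
  rw [Finset.mul_sum]
  refine Finset.sum_congr rfl fun k _ => ?_
  rw [signalCoeff, mul_left_comm, sgn_mul_self, mul_one]

end Correlations

open Correlations

section GradientDescent

variable {μ : Vec d} {η : ℝ} {y : Fin n → Bool} {ξ : Fin n → Vec d} {W₀ : Weights d m}

lemma margin_correlations (t : ℕ) (i : Fin n) :
    (correlations μ η y ξ W₀).margin t i
      = sgn (y i) * network (gd μ η y ξ W₀ t) (dataPoint μ (y i) (ξ i)) := by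
  unfold Correlations.margin signalMargin noiseMargin network branch dataPoint
  rw [← mul_add, ← Finset.sum_add_distrib, ← mul_sub, ← Finset.sum_sub_distrib, mul_left_comm,
    Finset.mul_sum (a := sgn (y i))]
  congr! 2 with r
  simp only [correlations]
  cases y i <;> simp [sgn] <;> ring

lemma lossDeriv_network_gd (t : ℕ) (i : Fin n) :
    lossDeriv (network (gd μ η y ξ W₀ t) (dataPoint μ (y i) (ξ i))) (y i)
      = -(correlations μ η y ξ W₀).grad t i := by
  rw [lossDeriv, grad, margin_correlations, neg_div]

lemma inner_gd_sgn_smul (t : ℕ) (j b : Bool) (r : Fin m) :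
    inner ℝ (gd μ η y ξ W₀ t j r) (sgn b • μ)
      = sgn b * sgn j * (correlations μ η y ξ W₀).signal t j r := by
  simp only [correlations]
  rw [inner_smul_right, mul_assoc, ← mul_assoc (sgn j), sgn_mul_self, one_mul]

lemma gd_succ (t : ℕ) (j : Bool) (r : Fin m) :
    gd μ η y ξ W₀ (t + 1) j r = gd μ η y ξ W₀ t j r
      + (η / ((n : ℝ) * m)) • ∑ k, (correlations μ η y ξ W₀).noiseCoeff t j r k • ξ k
      + (η / ((n : ℝ) * m)) • (∑ k, (correlations μ η y ξ W₀).signalCoeff t j r k) • μ := by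
  conv_lhs => rw [gd]
  unfold gdStep
  simp only [lossDeriv_network_gd, inner_gd_sgn_smul]
  rw [sub_eq_add_neg, sub_eq_add_neg, ← smul_neg, ← smul_neg, ← Finset.sum_neg_distrib,
    ← Finset.sum_neg_distrib, Finset.sum_smul]
  congr 2
  · congr! 2 with k
    rw [← neg_smul, noiseCoeff]
    congr 1
    simp only [correlations]
    ring
  · refine Finset.sum_congr rfl fun k _ => ?_
    rw [← neg_smul, signalCoeff, mul_assoc (sgn j), sgn_mul_self]
    congr 1
    simp only [correlations]
    ring

lemma noise_succ_correlations (t : ℕ) (j : Bool) (r : Fin m) (i : Fin n) :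
    (correlations μ η y ξ W₀).noise (t + 1) j r i = (correlations μ η y ξ W₀).noise t j r i
      + η / (n * m) * (∑ k, (correlations μ η y ξ W₀).noiseCoeff t j r k * inner ℝ (ξ k) (ξ i)
        + ∑ k, (correlations μ η y ξ W₀).signalCoeff t j r k * inner ℝ μ (ξ i)) := by
  change inner ℝ (gd μ η y ξ W₀ (t + 1) j r) (ξ i) = inner ℝ (gd μ η y ξ W₀ t j r) (ξ i) + _
  rw [gd_succ, inner_add_left, inner_add_left, real_inner_smul_left, real_inner_smul_left,
    real_inner_smul_left, sum_inner, Finset.sum_mul]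
  simp only [real_inner_smul_left]
  ring

lemma signal_succ_correlations (t : ℕ) (j : Bool) (r : Fin m) :
    (correlations μ η y ξ W₀).signal (t + 1) j r = (correlations μ η y ξ W₀).signal t j r
      + η / (n * m) * (sgn j * ∑ k, (correlations μ η y ξ W₀).noiseCoeff t j r k * inner ℝ (ξ k) μ
        + ‖μ‖ ^ 2 * (sgn j * ∑ k, (correlations μ η y ξ W₀).signalCoeff t j r k)) := by
  change sgn j * inner ℝ (gd μ η y ξ W₀ (t + 1) j r) μ
    = sgn j * inner ℝ (gd μ η y ξ W₀ t j r) μ + _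
  rw [gd_succ, inner_add_left, inner_add_left, real_inner_smul_left, real_inner_smul_left,
    real_inner_smul_left, sum_inner, real_inner_self_eq_norm_sq]
  simp only [real_inner_smul_left]
  ring

lemma sum_grad_eq (hn : 0 < n) (D : Correlations n m) (t : ℕ) :
    ∑ k, D.grad t k = n * D.meanGrad t := by
  have hn' : (n : ℝ) ≠ 0 := by exact_mod_cast hn.ne'
  rw [meanGrad, ← mul_assoc, mul_one_div_cancel hn', one_mul]

lemma abs_noise_interaction_le (hn : 0 < n) {c : ℝ}
    (hξ : ∀ i k, i ≠ k → n * |inner ℝ (ξ i) (ξ k)| ≤ c)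
    (hμ : ∀ i, n * |inner ℝ μ (ξ i)| ≤ c) (t : ℕ) (j : Bool) (r : Fin m) (i : Fin n) :
    |∑ k ∈ Finset.univ.erase i, (correlations μ η y ξ W₀).noiseCoeff t j r k * inner ℝ (ξ k) (ξ i)
      + ∑ k, (correlations μ η y ξ W₀).signalCoeff t j r k * inner ℝ μ (ξ i)|
      ≤ 2 * c * (correlations μ η y ξ W₀).meanGrad t := by
  set D := correlations μ η y ξ W₀
  have hn' : (0 : ℝ) < n := by exact_mod_cast hn
  have hc : 0 ≤ c := (mul_nonneg hn'.le (abs_nonneg _)).trans (hμ i)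
  have hnoise : |∑ k ∈ Finset.univ.erase i, D.noiseCoeff t j r k * inner ℝ (ξ k) (ξ i)|
      ≤ (∑ k, D.grad t k) * (c / n) := by
    refine (abs_sum_mul_le _ (fun k _ => abs_noiseCoeff_le t j r k) fun k hk =>
      (le_div_iff₀' hn').2 (hξ k i (Finset.ne_of_mem_erase hk))).trans ?_
    refine mul_le_mul_of_nonneg_right ?_ (by positivity)
    exact Finset.sum_le_sum_of_subset_of_nonneg (Finset.erase_subset _ _)
      fun k _ _ => (grad_pos t k).le
  have hsignal : |∑ k, D.signalCoeff t j r k * inner ℝ μ (ξ i)| ≤ (∑ k, D.grad t k) * (c / n) :=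
    abs_sum_mul_le _ (fun k _ => abs_signalCoeff_le t j r k) fun k _ => (le_div_iff₀' hn').2 (hμ i)
  rw [sum_grad_eq hn] at hnoise hsignal
  calc _ ≤ n * D.meanGrad t * (c / n) + n * D.meanGrad t * (c / n) :=
        (abs_add_le _ _).trans (add_le_add hnoise hsignal)
    _ = 2 * c * D.meanGrad t := by
        field_simp
        ring

lemma abs_signal_interaction_le (hn : 0 < n) {c : ℝ} (hμ : ∀ i, n * |inner ℝ μ (ξ i)| ≤ c) (t : ℕ)
    (j : Bool) (r : Fin m) :
    |sgn j * ∑ k, (correlations μ η y ξ W₀).noiseCoeff t j r k * inner ℝ (ξ k) μ|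
      ≤ c * (correlations μ η y ξ W₀).meanGrad t := by
  have hn' : (0 : ℝ) < n := by exact_mod_cast hn
  rw [abs_mul, abs_sgn, one_mul]
  calc _ ≤ (∑ k, (correlations μ η y ξ W₀).grad t k) * (c / n) :=
        abs_sum_mul_le _ (fun k _ => abs_noiseCoeff_le t j r k) fun k _ => by
          rw [real_inner_comm, le_div_iff₀' hn']
          exact hμ k
    _ = c * (correlations μ η y ξ W₀).meanGrad t := by
        rw [sum_grad_eq hn]
        field_simp

variable {σ τ : ℝ}

namespace Typical

lemma abs_noise_step_le (h : Typical μ σ τ ξ W₀) (hn : 0 < n) (hm : 0 < m) (hd : 0 < d)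
    (hσ : 0 < σ) (hη : 0 < η) (t : ℕ) (j : Bool) (r : Fin m) (i : Fin n) :
    |(correlations μ η y ξ W₀).noise (t + 1) j r i - (correlations μ η y ξ W₀).noise t j r i
      - η * (σ ^ 2 * d) / (n * m) * (sgn j * sgn (y i) * (correlations μ η y ξ W₀).grad t i
        * reluDeriv ((correlations μ η y ξ W₀).noise t j r i) * (‖ξ i‖ ^ 2 / (σ ^ 2 * d)))|
      ≤ η * (σ ^ 2 * d) / (n * m) * (2 * τ * (correlations μ η y ξ W₀).meanGrad t) := by
  set D := correlations μ η y ξ W₀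
  have hself : η * (σ ^ 2 * d) / (n * m) * (sgn j * sgn (y i) * D.grad t i
      * reluDeriv (D.noise t j r i) * (‖ξ i‖ ^ 2 / (σ ^ 2 * d)))
      = η / (n * m) * (D.noiseCoeff t j r i * inner ℝ (ξ i) (ξ i)) := by
    rw [real_inner_self_eq_norm_sq, noiseCoeff, show D.label i = y i from rfl]
    field_simp
  rw [hself, noise_succ_correlations, ← Finset.add_sum_erase _ _ (Finset.mem_univ i),
    add_sub_cancel_left, ← mul_sub, add_assoc, add_sub_cancel_left, abs_mul,
    abs_of_pos (by positivity)]
  calc _ ≤ η / (n * m) * (2 * (τ * (σ ^ 2 * d)) * D.meanGrad t) := by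
        gcongr
        exact abs_noise_interaction_le hn h.inner_noise h.inner_signal t j r i
    _ = _ := by ring

lemma abs_signal_step_le (h : Typical μ σ τ ξ W₀) (hn : 0 < n) (hm : 0 < m) (hd : 0 < d)
    (hσ : 0 < σ) (hη : 0 < η) (t : ℕ) (j : Bool) (r : Fin m) :
    |(correlations μ η y ξ W₀).signal (t + 1) j r - (correlations μ η y ξ W₀).signal t j r
      - η * (σ ^ 2 * d) / (n * m) * (n * ‖μ‖ ^ 2 / (σ ^ 2 * d) * ((1 / (n : ℝ)) *
        ∑ i, (correlations μ η y ξ W₀).grad t i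
          * reluDeriv (sgn (y i) * sgn j * (correlations μ η y ξ W₀).signal t j r)))|
      ≤ η * (σ ^ 2 * d) / (n * m) * (τ * (correlations μ η y ξ W₀).meanGrad t) := by
  set D := correlations μ η y ξ W₀
  have hself : η * (σ ^ 2 * d) / (n * m) * (n * ‖μ‖ ^ 2 / (σ ^ 2 * d) * ((1 / (n : ℝ)) *
      ∑ i, D.grad t i * reluDeriv (sgn (y i) * sgn j * D.signal t j r)))
      = η / (n * m) * (‖μ‖ ^ 2 * (sgn j * ∑ k, D.signalCoeff t j r k)) := by
    rw [sgn_mul_sum_signalCoeff]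
    change _ = η / (n * m) * (‖μ‖ ^ 2 * ∑ k, D.grad t k * reluDeriv (sgn (y k) * sgn j
      * D.signal t j r))
    generalize ∑ k, D.grad t k * reluDeriv (sgn (y k) * sgn j * D.signal t j r) = g
    field_simp
  rw [hself, signal_succ_correlations, add_sub_cancel_left, ← mul_sub, add_sub_cancel_right,
    abs_mul, abs_of_pos (by positivity)]
  calc _ ≤ η / (n * m) * (τ * (σ ^ 2 * d) * D.meanGrad t) := by
        gcongr
        exact abs_signal_interaction_le hn h.inner_signal t j r
    _ = _ := by ring

theorem regular (h : Typical μ σ τ ξ W₀) (hn : 0 < n) (hm : 0 < m) (hd : 0 < d)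
    (hσ : 0 < σ) (hη : 0 < η) (hτ : 0 < τ)
    (hy : ∀ j, (n : ℝ) / 4 ≤ (Finset.univ.filter fun i => y i = j).card) :
    (correlations μ η y ξ W₀).Regular (η * (σ ^ 2 * d) / (n * m)) (n * ‖μ‖ ^ 2 / (σ ^ 2 * d)) τ
      (fun i => ‖ξ i‖ ^ 2 / (σ ^ 2 * d)) := by
  have hV : 0 < σ ^ 2 * (d : ℝ) := by positivity
  refine
    { n_pos := hn
      m_pos := hm
      s_pos := by positivity
      τ_pos := hτ
      N_ge := fun i => ?_
      N_le := fun i => (div_le_iff₀ hV).2 (h.norm_le i)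
      noise_step := h.abs_noise_step_le hn hm hd hσ hη
      signal_step := h.abs_signal_step_le hn hm hd hσ hη
      signal_init := fun j r => ?_
      noise_init := h.init_noise
      active := fun i => h.active (y i) i
      class_ge := hy }
  · rw [le_div_iff₀ hV]
    linarith [h.norm_ge i]
  · change |sgn j * inner ℝ (W₀ j r) μ| ≤ τ
    rw [abs_mul, abs_sgn, one_mul]
    exact h.init_signal j r

end Typical

lemma gd_eq_sum (hη : 0 ≤ η) {V : ℝ} (hV : 0 ≤ V) (t : ℕ) (j : Bool) (r : Fin m) :
    ∃ (a : Fin n → ℝ) (c : ℝ), gd μ η y ξ W₀ t j r = W₀ j r + ∑ k, a k • ξ k + c • μ ∧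
      (∀ k, V * |a k| ≤ (correlations μ η y ξ W₀).accGrad (η * V / (n * m)) t k) ∧
      V * |c| ≤ ∑ k, (correlations μ η y ξ W₀).accGrad (η * V / (n * m)) t k := by
  induction t with
  | zero => exact ⟨0, 0, by simp [gd], by simp [accGrad], by simp [accGrad]⟩
  | succ t ih =>
    obtain ⟨a, c, hgd, ha, hc⟩ := ih
    set D := correlations μ η y ξ W₀
    have hη' : 0 ≤ η / ((n : ℝ) * m) := by positivity
    have habs : ∀ {x z g : ℝ}, |z| ≤ g →
        V * |x + η / (n * m) * z| ≤ V * |x| + η * V / (n * m) * g := fun {x z g} hz => by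
      calc V * |x + η / (n * m) * z| ≤ V * (|x| + η / (n * m) * g) := by
            refine mul_le_mul_of_nonneg_left ((abs_add_le _ _).trans ?_) hV
            rw [abs_mul, abs_of_nonneg hη']
            gcongr
        _ = V * |x| + η * V / (n * m) * g := by ring
    refine ⟨fun k => a k + η / (n * m) * D.noiseCoeff t j r k,
      c + η / (n * m) * ∑ k, D.signalCoeff t j r k, ?_, fun k => ?_, ?_⟩
    · rw [gd_succ, hgd]
      simp only [add_smul, Finset.sum_add_distrib, mul_smul, ← Finset.smul_sum]
      abel
    · rw [accGrad_succ]
      exact (habs (abs_noiseCoeff_le t j r k)).trans (add_le_add_left (ha k) _)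
    · simp only [accGrad_succ]
      rw [Finset.sum_add_distrib, ← Finset.mul_sum]
      refine (habs ?_).trans (add_le_add_left hc _)
      exact (Finset.abs_sum_le_sum_abs _ _).trans
        (Finset.sum_le_sum fun k _ => abs_signalCoeff_le t j r k)

namespace Typical

lemma sum_abs_inner_noise_le (h : Typical μ σ τ ξ W₀) (hτ₀ : 0 ≤ τ) (hτ : τ ≤ 1) (k : Fin n) :
    ∑ l, |inner ℝ (ξ k) (ξ l)| ≤ 4 * (σ ^ 2 * d) := by
  have hn : (0 : ℝ) < n := by exact_mod_cast k.pos
  have hentry : ∀ l, |inner ℝ (ξ k) (ξ l)|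
      ≤ (if k = l then 2 * (σ ^ 2 * d) else 0) + τ * (σ ^ 2 * d) / n := fun l => by
    split_ifs with hkl
    · rw [← hkl, real_inner_self_eq_norm_sq, abs_of_nonneg (by positivity)]
      exact (h.norm_le k).trans (le_add_of_nonneg_right (by positivity))
    · rw [zero_add, le_div_iff₀' hn]
      exact h.inner_noise k l hkl
  refine (Finset.sum_le_sum fun l _ => hentry l).trans ?_
  simp only [Finset.sum_add_distrib, Finset.sum_ite_eq, Finset.mem_univ, if_true,
    Finset.sum_const, Finset.card_univ, Fintype.card_fin, nsmul_eq_mul]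
  rw [mul_div_cancel₀ _ hn.ne']
  have hτd := mul_le_mul_of_nonneg_right hτ (show 0 ≤ σ ^ 2 * (d : ℝ) by positivity)
  have : 0 ≤ σ ^ 2 * (d : ℝ) := by positivity
  linarith

lemma norm_sum_smul_noise_le (h : Typical μ σ τ ξ W₀) (hd : 0 < d) (hσ : 0 < σ)
    (hτ₀ : 0 ≤ τ) (hτ : τ ≤ 1) {Γ : ℝ} (hΓ₀ : 0 ≤ Γ) {a : Fin n → ℝ}
    (ha : ∀ k, σ ^ 2 * d * |a k| ≤ Γ) :
    σ * ‖∑ k, a k • ξ k‖ ≤ √((n : ℝ) / d) * (2 * Γ) := by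
  have hV : 0 < σ ^ 2 * (d : ℝ) := by positivity
  have hsq := norm_sum_smul_sq_le (fun k => (le_div_iff₀' hV).2 (ha k))
    (h.sum_abs_inner_noise_le hτ₀ hτ)
  rw [Fintype.card_fin] at hsq
  refine le_of_sq_le_sq ?_ (by positivity)
  rw [mul_pow, mul_pow, Real.sq_sqrt (by positivity)]
  calc σ ^ 2 * ‖∑ k, a k • ξ k‖ ^ 2
      ≤ σ ^ 2 * (n * ((Γ / (σ ^ 2 * d)) ^ 2 * (4 * (σ ^ 2 * d)))) := by gcongr
    _ = n / d * (2 * Γ) ^ 2 := by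
        field_simp
        ring

end Typical

lemma norm_smul_signal_le (hd : 0 < d) (hσ : 0 < σ) {Γ : ℝ} (hΓ₀ : 0 ≤ Γ) {c : ℝ}
    (hc : σ ^ 2 * d * |c| ≤ n * Γ) :
    σ * ‖c • μ‖ ≤ √((n : ℝ) / d) * (√(n * ‖μ‖ ^ 2 / (σ ^ 2 * d)) * Γ) := by
  have hc' : |c| ≤ n * Γ / (σ ^ 2 * d) := (le_div_iff₀' (by positivity)).2 hc
  refine le_of_sq_le_sq ?_ (by positivity)
  rw [norm_smul, Real.norm_eq_abs, mul_pow, mul_pow, mul_pow, mul_pow,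
    Real.sq_sqrt (by positivity), Real.sq_sqrt (by positivity)]
  calc σ ^ 2 * (|c| ^ 2 * ‖μ‖ ^ 2) ≤ σ ^ 2 * ((n * Γ / (σ ^ 2 * d)) ^ 2 * ‖μ‖ ^ 2) := by gcongr
    _ = n / d * (n * ‖μ‖ ^ 2 / (σ ^ 2 * d) * Γ ^ 2) := by field_simp

lemma Typical.norm_gd_le (h : Typical μ σ τ ξ W₀) (hd : 0 < d) (hσ : 0 < σ)
    (hη : 0 ≤ η) (hτ₀ : 0 ≤ τ) (hτ : τ ≤ 1) {t : ℕ} {Γ : ℝ} (hΓ₀ : 0 ≤ Γ)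
    (hΓ : ∀ k, (correlations μ η y ξ W₀).accGrad (η * (σ ^ 2 * d) / (n * m)) t k ≤ Γ)
    (j : Bool) (r : Fin m) :
    σ * ‖gd μ η y ξ W₀ t j r‖
      ≤ √((n : ℝ) / d) * (τ + (2 + √(n * ‖μ‖ ^ 2 / (σ ^ 2 * d))) * Γ) := by
  obtain ⟨a, c, hgd, ha, hc⟩ := gd_eq_sum (μ := μ) (y := y) (ξ := ξ) (W₀ := W₀) hη
    (V := σ ^ 2 * d) (by positivity) t j r
  have hsum : ∑ k, (correlations μ η y ξ W₀).accGrad (η * (σ ^ 2 * d) / (n * m)) t k ≤ n * Γ := by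
    simpa using Finset.sum_le_sum (s := Finset.univ) fun k _ => hΓ k
  have hnoise := h.norm_sum_smul_noise_le hd hσ hτ₀ hτ hΓ₀ fun k => (ha k).trans (hΓ k)
  have hsignal := norm_smul_signal_le (μ := μ) hd hσ hΓ₀ (hc.trans hsum)
  rw [hgd]
  calc _ ≤ σ * (‖W₀ j r‖ + ‖∑ k, a k • ξ k‖ + ‖c • μ‖) := by
        gcongr
        exact norm_add₃_le
    _ ≤ τ * √((n : ℝ) / d) + √((n : ℝ) / d) * (2 * Γ)
        + √((n : ℝ) / d) * (√(n * ‖μ‖ ^ 2 / (σ ^ 2 * d)) * Γ) := by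
        linarith [h.init_norm j r]
    _ = _ := by ring

end GradientDescent

/-! ### Concentration -/

instance isProbabilityMeasure_gaussianVec (d : ℕ) (σ : ℝ) :
    IsProbabilityMeasure (gaussianVec d σ) :=
  Measure.isProbabilityMeasure_map (by fun_prop)

instance isProbabilityMeasure_rademacher : IsProbabilityMeasure rademacher :=
  isProbabilityMeasure_uniformOn Set.finite_univ Set.univ_nonempty

instance isProbabilityMeasure_labelLaw (n : ℕ) : IsProbabilityMeasure (labelLaw n) := by
  unfold labelLaw; infer_instance

instance isProbabilityMeasure_noiseLaw (d n : ℕ) (σ : ℝ) :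
    IsProbabilityMeasure (noiseLaw d n σ) := by
  unfold noiseLaw; infer_instance

instance isProbabilityMeasure_initLaw (d m : ℕ) (σ : ℝ) :
    IsProbabilityMeasure (initLaw d m σ) := by
  unfold initLaw; infer_instance

section GaussianTails

variable {σ : ℝ} {w : Vec d} {B s : ℝ}

lemma gaussianVec_map_inner (σ : ℝ) (w : Vec d) :
    (gaussianVec d σ).map (fun x => inner ℝ w x) = gaussianReal 0 (σ ^ 2 * ‖w‖ ^ 2).toNNReal := by
  have h := IsGaussian.map_eq_gaussianReal (μ := stdGaussian (Vec d)) (innerSL ℝ (σ • w))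
  rw [variance_dual_stdGaussian, integral_strongDual_stdGaussian, innerSL_apply_norm, norm_smul,
    mul_pow, Real.norm_eq_abs, sq_abs] at h
  rw [← h, gaussianVec, Measure.map_map (by fun_prop) (by fun_prop)]
  congr 1
  ext x
  simp [inner_smul_right]

lemma hasSubgaussianMGF_inner_gaussianVec (hw : |σ| * ‖w‖ ≤ B) :
    HasSubgaussianMGF (fun x => inner ℝ w x) (B ^ 2).toNNReal (gaussianVec d σ) where
  integrable_exp_mul s := by
    have h := integrable_exp_mul_gaussianReal (μ := 0) (v := (σ ^ 2 * ‖w‖ ^ 2).toNNReal) s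
    rwa [← gaussianVec_map_inner, integrable_map_measure (by fun_prop) (by fun_prop)] at h
  mgf_le s := by
    rw [mgf_gaussianReal (gaussianVec_map_inner σ w), Real.coe_toNNReal _ (by positivity),
      Real.coe_toNNReal _ (by positivity), zero_mul, zero_add, ← sq_abs σ, ← mul_pow]
    gcongr

lemma gaussianVec_le_inner (hw : |σ| * ‖w‖ ≤ B) (hs : 0 ≤ s) :
    gaussianVec d σ {x | s ≤ inner ℝ w x} ≤ ENNReal.ofReal (Real.exp (-(s ^ 2 / (2 * B ^ 2)))) := by
  have h := (hasSubgaussianMGF_inner_gaussianVec hw).measure_ge_le hs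
  rw [Real.coe_toNNReal _ (by positivity), neg_div] at h
  rw [← ofReal_measureReal]
  exact ENNReal.ofReal_le_ofReal h

lemma gaussianVec_mul_lt_abs_inner (hB : 0 < B) (hw : |σ| * ‖w‖ ≤ B) (hs : 0 ≤ s) :
    gaussianVec d σ {x | s * B < |inner ℝ w x|}
      ≤ ENNReal.ofReal (2 * Real.exp (-(s ^ 2 / 2))) := by
  have hexp : (s * B) ^ 2 / (2 * B ^ 2) = s ^ 2 / 2 := by field_simp
  have hright := gaussianVec_le_inner hw (mul_nonneg hs hB.le)
  have hleft := gaussianVec_le_inner (w := -w) (B := B) (by rwa [norm_neg]) (mul_nonneg hs hB.le)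
  rw [hexp] at hright hleft
  rw [two_mul, ENNReal.ofReal_add (by positivity) (by positivity)]
  refine (measure_mono fun x hx => ?_).trans
    ((measure_union_le _ _).trans (add_le_add hright hleft))
  rw [Set.mem_ofPred_eq] at hx
  rw [Set.mem_union, Set.mem_ofPred_eq, Set.mem_ofPred_eq, inner_neg_left]
  exact (lt_abs.1 hx).imp le_of_lt le_of_lt

lemma half_le_gaussianVec_inner_nonneg (σ : ℝ) (w : Vec d) :
    1 / 2 ≤ gaussianVec d σ {x | 0 ≤ inner ℝ w x} := by
  have hmap := gaussianVec_map_inner σ (-w)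
  rw [norm_neg, ← gaussianVec_map_inner σ w] at hmap
  have hsymm : gaussianVec d σ {x | inner ℝ w x ≤ 0} = gaussianVec d σ {x | 0 ≤ inner ℝ w x} := by
    have h := congrArg (fun ν => ν (Set.Ici 0)) hmap
    rw [Measure.map_apply (by fun_prop) measurableSet_Ici,
      Measure.map_apply (by fun_prop) measurableSet_Ici] at h
    simpa only [Set.preimage, Set.mem_Ici, inner_neg_left, neg_nonneg] using h
  have hcover : 1 ≤ gaussianVec d σ {x | 0 ≤ inner ℝ w x}
      + gaussianVec d σ {x | inner ℝ w x ≤ 0} := by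
    rw [← measure_univ (μ := gaussianVec d σ)]
    exact (measure_mono fun x _ => le_total 0 (inner ℝ w x)).trans (measure_union_le _ _)
  rw [hsymm, ← two_mul] at hcover
  rwa [ENNReal.div_le_iff_le_mul (by simp) (by simp), mul_comm]

end GaussianTails

section ProductMeasures

variable {ι X : Type*} [Fintype ι] [MeasurableSpace X] {ν : Measure X} [IsProbabilityMeasure ν]

lemma measure_pi_one_le_prod_le {f : X → ENNReal} (hf : Measurable f) :
    Measure.pi (fun _ : ι => ν) {x | 1 ≤ ∏ i, f (x i)} ≤ (∫⁻ x, f x ∂ν) ^ Fintype.card ι := by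
  have hind : iIndepFun (fun i (x : ι → X) => f (x i)) (Measure.pi fun _ : ι => ν) :=
    iIndepFun_pi fun _ => hf.aemeasurable
  have hmarkov := mul_meas_ge_le_lintegral (μ := Measure.pi fun _ : ι => ν)
    (f := fun x => ∏ i, f (x i)) (by fun_prop) 1
  rw [one_mul, lintegral_prod_eq_prod_lintegral_of_indepFun Finset.univ _ hind fun i => by
    fun_prop] at hmarkov
  refine hmarkov.trans_eq ?_
  rw [← Finset.card_univ, ← Finset.prod_const]
  exact Finset.prod_congr rfl fun i _ =>
    (measurePreserving_eval (fun _ : ι => ν) i).lintegral_comp hf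

open scoped Classical in
lemma measureReal_pi_card_le {A : Set X} (hA : MeasurableSet A) {ε : ℝ} (hε : 0 ≤ ε) :
    (Measure.pi fun _ : ι => ν).real
        {x | ((Finset.univ.filter fun i => x i ∈ A).card : ℝ) ≤ Fintype.card ι * (ν.real A - ε)}
      ≤ Real.exp (-(2 * Fintype.card ι * ε ^ 2)) := by
  set Y : X → ℝ := -fun x => A.indicator 1 x - ν[A.indicator 1] with hY
  have hsub : HasSubgaussianMGF Y ((‖(1 : ℝ) - 0‖₊ / 2) ^ 2) ν :=
    (hasSubgaussianMGF_of_mem_Icc (measurable_one.indicator hA).aemeasurable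
      (.of_forall fun x => ⟨Set.indicator_nonneg (by simp) x,
        Set.indicator_le_self' (by simp) x⟩)).neg
  have hind : iIndepFun (fun i (x : ι → X) => Y (x i)) (Measure.pi fun _ : ι => ν) :=
    iIndepFun_pi fun _ => hsub.aemeasurable
  have hsubᵢ : ∀ i ∈ Finset.univ, HasSubgaussianMGF (fun x : ι → X => Y (x i))
      ((‖(1 : ℝ) - 0‖₊ / 2) ^ 2) (Measure.pi fun _ : ι => ν) := fun i _ => by
    refine HasSubgaussianMGF.of_map (Y := fun x : ι → X => x i)
      (measurable_pi_apply i).aemeasurable ?_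
    rwa [(measurePreserving_eval (fun _ : ι => ν) i).map_eq]
  have hsum : ∀ x : ι → X, ∑ i, Y (x i)
      = Fintype.card ι * ν.real A - (Finset.univ.filter fun i => x i ∈ A).card := fun x => by
    simp only [hY, Pi.neg_apply, integral_indicator_one hA,
      Finset.sum_sub_distrib, neg_sub]
    simp [Set.indicator_apply]
  have hhoeffding := HasSubgaussianMGF.measure_sum_ge_le_of_iIndepFun hind hsubᵢ
    (mul_nonneg (Nat.cast_nonneg (Fintype.card ι)) hε)
  simp only [hsum, mul_sub, le_sub_comm] at hhoeffding ⊢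
  refine hhoeffding.trans_eq (congrArg Real.exp ?_)
  rcases eq_or_ne (Fintype.card ι : ℝ) 0 with h | h
  · simp [h]
  · simp only [sub_zero, nnnorm_one, one_div, inv_pow, Finset.sum_const, Finset.card_univ,
      nsmul_eq_mul, NNReal.coe_mul, NNReal.coe_natCast, NNReal.coe_inv, NNReal.coe_pow,
      NNReal.coe_ofNat]
    field

open scoped Classical in
lemma measure_pi_card_lt {A : Set X} (hA : MeasurableSet A) (hν : 1 / 2 ≤ ν A) :
    Measure.pi (fun _ : ι => ν)
        {x | ((Finset.univ.filter fun i => x i ∈ A).card : ℝ) < (Fintype.card ι : ℝ) / 4}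
      ≤ ENNReal.ofReal (Real.exp (-(Fintype.card ι / 8))) := by
  have hν' : (1 : ℝ) / 2 ≤ ν.real A := by
    simpa [Measure.real] using ENNReal.toReal_mono (measure_ne_top ν A) hν
  rw [← ofReal_measureReal]
  refine ENNReal.ofReal_le_ofReal ((measureReal_mono fun x hx => ?_).trans
    ((measureReal_pi_card_le hA (by norm_num : (0 : ℝ) ≤ 1 / 4)).trans_eq ?_))
  · rw [Set.mem_ofPred_eq] at hx ⊢
    refine hx.le.trans ?_
    rw [div_eq_mul_inv]
    gcongr
    linarith
  · congr 1
    ring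

end ProductMeasures

section GaussianNorm

variable {σ : ℝ}

lemma lintegral_exp_sq_gaussianReal {a : ℝ} (ha : a < 1 / 2) (c : ℝ) :
    ∫⁻ x, ENNReal.ofReal (Real.exp (c + a * x ^ 2)) ∂gaussianReal 0 1
      = ENNReal.ofReal (Real.exp c * √(1 / (1 - 2 * a))) := by
  have ha' : 0 < 1 / 2 - a := by linarith
  have hdensity : ∀ x : ℝ,
      (gaussianPDF 0 1 * fun x => ENNReal.ofReal (Real.exp (c + a * x ^ 2))) x
        = ENNReal.ofReal ((√(2 * Real.pi))⁻¹ * Real.exp c * Real.exp (-(1 / 2 - a) * x ^ 2)) := by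
    intro x
    rw [Pi.mul_apply, gaussianPDF, ← ENNReal.ofReal_mul (gaussianPDFReal_nonneg _ _ _),
      gaussianPDFReal]
    simp only [NNReal.coe_one, mul_one, sub_zero]
    rw [mul_assoc, mul_assoc, ← Real.exp_add, ← Real.exp_add]
    congr 3
    ring
  have hsqrt : √(Real.pi / (1 / 2 - a)) = √(2 * Real.pi) * √(1 / (1 - 2 * a)) := by
    rw [← Real.sqrt_mul (by positivity)]
    congr 1
    have : 1 - 2 * a ≠ 0 := by linarith
    field_simp
  rw [gaussianReal_of_var_ne_zero 0 one_ne_zero,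
    lintegral_withDensity_eq_lintegral_mul _ (measurable_gaussianPDF 0 1) (by fun_prop)]
  simp_rw [hdensity]
  rw [← ofReal_integral_eq_lintegral_ofReal
    ((integrable_exp_neg_mul_sq ha').const_mul _) (.of_forall fun x => by positivity),
    integral_const_mul, integral_gaussian, hsqrt]
  congr 1
  field_simp

lemma gaussianVec_apply (σ : ℝ) {S : Set (Vec d)} (hS : MeasurableSet S) :
    gaussianVec d σ S = Measure.pi (fun _ : Fin d => gaussianReal 0 1)
      {x | σ • (WithLp.toLp 2 x : Vec d) ∈ S} := by
  rw [gaussianVec, Measure.map_apply (by fun_prop) hS, ← map_pi_eq_stdGaussian,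
    Measure.map_apply (by fun_prop) (hS.preimage (by fun_prop))]
  rfl

lemma gaussianVec_add_mul_norm_sq_pos_le {a : ℝ} (ha : a < 1 / 2) (c : ℝ) :
    gaussianVec d σ {x | 0 < c * (σ ^ 2 * d) + a * ‖x‖ ^ 2}
      ≤ ENNReal.ofReal ((Real.exp c * √(1 / (1 - 2 * a))) ^ d) := by
  have hchernoff := measure_pi_one_le_prod_le (ι := Fin d) (ν := gaussianReal 0 1)
    (f := fun x => ENNReal.ofReal (Real.exp (c + a * x ^ 2))) (by fun_prop)
  rw [lintegral_exp_sq_gaussianReal ha, Fintype.card_fin,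
    ← ENNReal.ofReal_pow (by positivity)] at hchernoff
  rw [gaussianVec_apply σ (measurableSet_lt (by fun_prop) (by fun_prop))]
  refine (measure_mono fun x hx => ?_).trans hchernoff
  rw [Set.mem_ofPred_eq, Set.mem_ofPred_eq, norm_smul, mul_pow, EuclideanSpace.norm_sq_eq] at hx
  simp only [Real.norm_eq_abs, sq_abs] at hx
  have hpos : 0 < σ ^ 2 * ∑ i, (c + a * x i ^ 2) := by
    rw [Finset.sum_add_distrib, ← Finset.mul_sum, Finset.sum_const, Finset.card_univ,
      Fintype.card_fin, nsmul_eq_mul]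
    linarith
  rw [Set.mem_ofPred_eq, ← ENNReal.ofReal_prod_of_nonneg fun i _ => (Real.exp_pos _).le,
    ← Real.exp_sum, ENNReal.one_le_ofReal]
  exact Real.one_le_exp (pos_of_mul_pos_right hpos (sq_nonneg σ)).le

lemma sqrt_two_eq_exp : √2 = Real.exp (Real.log 2 / 2) := by
  rw [Real.exp_half, Real.exp_log two_pos]

lemma gaussianVec_two_mul_lt_norm_sq :
    gaussianVec d σ {x | 2 * (σ ^ 2 * d) < ‖x‖ ^ 2} ≤ ENNReal.ofReal (Real.exp (-(d / 20))) := by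
  refine (measure_mono fun x hx => ?_).trans ((gaussianVec_add_mul_norm_sq_pos_le
    (a := 1 / 4) (by norm_num) (-(1 / 2))).trans (ENNReal.ofReal_le_ofReal ?_))
  · rw [Set.mem_ofPred_eq] at hx ⊢
    linarith
  · rw [show -((d : ℝ) / 20) = d * (-(1 / 20)) by ring, Real.exp_nat_mul]
    gcongr
    rw [show (1 : ℝ) / (1 - 2 * (1 / 4)) = 2 by norm_num, sqrt_two_eq_exp, ← Real.exp_add,
      Real.exp_le_exp]
    linarith [Real.log_two_lt_d9]

lemma gaussianVec_norm_sq_lt :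
    gaussianVec d σ {x | ‖x‖ ^ 2 < σ ^ 2 * d / 2} ≤ ENNReal.ofReal (Real.exp (-(d / 20))) := by
  refine (measure_mono fun x hx => ?_).trans ((gaussianVec_add_mul_norm_sq_pos_le
    (a := -(1 / 2)) (by norm_num) (1 / 4)).trans (ENNReal.ofReal_le_ofReal ?_))
  · rw [Set.mem_ofPred_eq] at hx ⊢
    linarith
  · rw [show -((d : ℝ) / 20) = d * (-(1 / 20)) by ring, Real.exp_nat_mul]
    gcongr
    rw [show (1 : ℝ) / (1 - 2 * -(1 / 2)) = 2⁻¹ by norm_num, Real.sqrt_inv,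
      sqrt_two_eq_exp, ← Real.exp_neg, ← Real.exp_add, Real.exp_le_exp]
    linarith [Real.log_two_gt_d9]

end GaussianNorm

/-! ### Typical data are likely -/

/-- The joint law of the noise patches and the initial weights. -/
abbrev dataLaw (d n m : ℕ) (σ σ₀ : ℝ) : Measure ((Fin n → Vec d) × Weights d m) :=
  (noiseLaw d n σ).prod (initLaw d m σ₀)

section Marginals

variable (σ σ₀ : ℝ)

lemma measurePreserving_noise (i : Fin n) :
    MeasurePreserving (fun ω => ω.1 i) (dataLaw d n m σ σ₀) (gaussianVec d σ) :=
  (measurePreserving_eval (fun _ : Fin n => gaussianVec d σ) i).comp measurePreserving_fst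

lemma measurePreserving_branch (j : Bool) :
    MeasurePreserving (fun W : Weights d m => W j) (initLaw d m σ₀)
      (Measure.pi fun _ : Fin m => gaussianVec d σ₀) :=
  measurePreserving_eval (fun _ : Bool => Measure.pi fun _ : Fin m => gaussianVec d σ₀) j

lemma measurePreserving_neuron (j : Bool) (r : Fin m) :
    MeasurePreserving (fun W : Weights d m => W j r) (initLaw d m σ₀) (gaussianVec d σ₀) :=
  (measurePreserving_eval (fun _ : Fin m => gaussianVec d σ₀) r).comp
    (measurePreserving_branch σ₀ j)

lemma measurePreserving_init (j : Bool) (r : Fin m) :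
    MeasurePreserving (fun ω => ω.2 j r) (dataLaw d n m σ σ₀) (gaussianVec d σ₀) :=
  (measurePreserving_neuron σ₀ j r).comp measurePreserving_snd

lemma measurePreserving_noise_noise {i k : Fin n} (hik : i ≠ k) :
    MeasurePreserving (fun ω => (ω.1 i, ω.1 k)) (dataLaw d n m σ σ₀)
      ((gaussianVec d σ).prod (gaussianVec d σ)) := by
  have hind : iIndepFun (fun i (ξ : Fin n → Vec d) => ξ i) (noiseLaw d n σ) :=
    iIndepFun_pi (X := fun _ x => x) fun _ => aemeasurable_id
  have hprod := (indepFun_iff_map_prod_eq_prod_map_map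
    (measurable_pi_apply i).aemeasurable (measurable_pi_apply k).aemeasurable).1
    (hind.indepFun hik)
  have hmap : ∀ i, (noiseLaw d n σ).map (fun ξ : Fin n → Vec d => ξ i) = gaussianVec d σ :=
    fun i => (measurePreserving_eval (fun _ : Fin n => gaussianVec d σ) i).map_eq
  rw [hmap, hmap] at hprod
  exact (MeasurePreserving.mk ((measurable_pi_apply i).prodMk (measurable_pi_apply k)) hprod).comp
    measurePreserving_fst

lemma measurePreserving_noise_neuron (i : Fin n) (j : Bool) (r : Fin m) :
    MeasurePreserving (fun ω => (ω.1 i, ω.2 j r)) (dataLaw d n m σ σ₀)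
      ((gaussianVec d σ).prod (gaussianVec d σ₀)) :=
  (measurePreserving_eval (fun _ : Fin n => gaussianVec d σ) i).prod
    (measurePreserving_neuron σ₀ j r)

lemma measurePreserving_noise_branch (i : Fin n) (j : Bool) :
    MeasurePreserving (fun ω => (ω.1 i, ω.2 j)) (dataLaw d n m σ σ₀)
      ((gaussianVec d σ).prod (Measure.pi fun _ : Fin m => gaussianVec d σ₀)) :=
  (measurePreserving_eval (fun _ : Fin n => gaussianVec d σ) i).prod
    (measurePreserving_branch σ₀ j)

end Marginals

section ProductBounds

lemma measure_exists_le {Ω κ : Type*} [MeasurableSpace Ω] [Fintype κ] {P : Measure Ω}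
    {S : κ → Ω → Prop} {p : ℝ} (h : ∀ k, P {ω | S k ω} ≤ ENNReal.ofReal p) :
    P {ω | ∃ k, S k ω} ≤ ENNReal.ofReal (Fintype.card κ * p) := by
  rw [Set.ofPred_exists]
  refine (measure_iUnion_fintype_le P _).trans ((Finset.sum_le_sum fun k _ => h k).trans_eq ?_)
  rw [Finset.sum_const, Finset.card_univ, nsmul_eq_mul,
    ENNReal.ofReal_mul (Nat.cast_nonneg _), ENNReal.ofReal_natCast]

lemma measure_prod_le_of_forall_slice_le {α β : Type*} [MeasurableSpace α] [MeasurableSpace β]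
    {ν : Measure α} {ρ : Measure β} [IsProbabilityMeasure ν] [SFinite ρ]
    {S : Set (α × β)} (hS : MeasurableSet S) {p : ENNReal} (h : ∀ x, ρ {z | (x, z) ∈ S} ≤ p) :
    ν.prod ρ S ≤ p := by
  rw [Measure.prod_apply hS]
  exact (lintegral_mono (g := fun _ => p) fun x => h x).trans_eq (by simp)

variable {σ σ₀ s : ℝ}

lemma gaussianVec_prod_mul_lt_abs_inner {A : ℝ} (hσ₀ : 0 < σ₀) (hA : 0 < A) (hs : 0 ≤ s) :
    (gaussianVec d σ).prod (gaussianVec d σ₀)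
        {p | ‖p.1‖ ^ 2 ≤ A ∧ s * (σ₀ * √A) < |inner ℝ p.1 p.2|}
      ≤ ENNReal.ofReal (2 * Real.exp (-(s ^ 2 / 2))) := by
  refine measure_prod_le_of_forall_slice_le ?_ fun v => ?_
  · rw [Set.ofPred_and]
    exact (measurableSet_le (by fun_prop) (by fun_prop)).inter
      (measurableSet_lt (by fun_prop) (by fun_prop))
  · by_cases hv : ‖v‖ ^ 2 ≤ A
    · have hB : |σ₀| * ‖v‖ ≤ σ₀ * √A := by
        rw [abs_of_pos hσ₀]
        gcongr
        exact Real.le_sqrt_of_sq_le hv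
      exact (measure_mono fun z hz => hz.2).trans
        (gaussianVec_mul_lt_abs_inner (by positivity) hB hs)
    · simp [hv]

lemma measurable_card_filter_inner_nonneg :
    Measurable fun p : Vec d × (Fin m → Vec d) =>
      ((Finset.univ.filter fun r => 0 ≤ inner ℝ (p.2 r) p.1).card : ℝ) := by
  simp only [Finset.card_filter, Nat.cast_sum, Nat.cast_ite, Nat.cast_one, Nat.cast_zero]
  exact Finset.measurable_fun_sum _ fun r _ => Measurable.ite
    (measurableSet_le (by fun_prop) (by fun_prop)) measurable_const measurable_const

lemma gaussianVec_prod_card_active_lt :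
    (gaussianVec d σ).prod (Measure.pi fun _ : Fin m => gaussianVec d σ₀)
        {p | ((Finset.univ.filter fun r => 0 ≤ inner ℝ (p.2 r) p.1).card : ℝ) < (m : ℝ) / 4}
      ≤ ENNReal.ofReal (Real.exp (-(m / 8))) := by
  refine measure_prod_le_of_forall_slice_le
    (measurableSet_lt measurable_card_filter_inner_nonneg measurable_const) fun v => ?_
  have h := measure_pi_card_lt (ι := Fin m) (ν := gaussianVec d σ₀) (A := {w | 0 ≤ inner ℝ v w})
    (measurableSet_le (by fun_prop) (by fun_prop)) (half_le_gaussianVec_inner_nonneg σ₀ v)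
  rw [Fintype.card_fin] at h
  convert h using 4 with x
  simp only [Set.mem_ofPred_eq, real_inner_comm]

end ProductBounds

section AtypicalEvents

variable {μ : Vec d} {σ σ₀ τ s : ℝ}

lemma dataLaw_exists_noise_norm_sq_lt :
    dataLaw d n m σ σ₀ {ω | ∃ i, ‖ω.1 i‖ ^ 2 < σ ^ 2 * d / 2}
      ≤ ENNReal.ofReal (n * Real.exp (-(d / 20))) := by
  refine (measure_exists_le fun i => ?_).trans_eq (by rw [Fintype.card_fin])
  exact ((measurePreserving_noise σ σ₀ i).measure_preimage_le _).trans gaussianVec_norm_sq_lt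

lemma dataLaw_exists_lt_noise_norm_sq :
    dataLaw d n m σ σ₀ {ω | ∃ i, 2 * (σ ^ 2 * d) < ‖ω.1 i‖ ^ 2}
      ≤ ENNReal.ofReal (n * Real.exp (-(d / 20))) := by
  refine (measure_exists_le fun i => ?_).trans_eq (by rw [Fintype.card_fin])
  exact ((measurePreserving_noise σ σ₀ i).measure_preimage_le _).trans
    gaussianVec_two_mul_lt_norm_sq

lemma dataLaw_exists_lt_init_norm_sq :
    dataLaw d n m σ σ₀ {ω | ∃ k : Bool × Fin m, 2 * (σ₀ ^ 2 * d) < ‖ω.2 k.1 k.2‖ ^ 2}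
      ≤ ENNReal.ofReal (2 * m * Real.exp (-(d / 20))) := by
  refine (measure_exists_le (p := Real.exp (-((d : ℝ) / 20))) fun k => ?_).trans_eq
    (by simp)
  exact ((measurePreserving_init σ σ₀ k.1 k.2).measure_preimage_le _).trans
    gaussianVec_two_mul_lt_norm_sq

lemma dataLaw_exists_lt_abs_inner_noise (hd : 0 < d) (hσ : 0 < σ) (hs : 0 ≤ s) :
    dataLaw d n m σ σ₀ {ω | ∃ k : Fin n × Fin n, k.1 ≠ k.2 ∧ ‖ω.1 k.1‖ ^ 2 ≤ 2 * (σ ^ 2 * d) ∧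
        s * (σ * √(2 * (σ ^ 2 * d))) < |inner ℝ (ω.1 k.1) (ω.1 k.2)|}
      ≤ ENNReal.ofReal (n * n * (2 * Real.exp (-(s ^ 2 / 2)))) := by
  refine (measure_exists_le (p := 2 * Real.exp (-(s ^ 2 / 2))) fun k => ?_).trans_eq
    (by simp)
  rcases eq_or_ne k.1 k.2 with hk | hk
  · simp [hk]
  · exact (measure_mono fun ω hω => hω.2).trans
      (((measurePreserving_noise_noise σ σ₀ hk).measure_preimage_le _).trans
        (gaussianVec_prod_mul_lt_abs_inner hσ (by positivity) hs))

lemma dataLaw_exists_lt_abs_inner_signal_noise (hσ : 0 < σ) (hμ : μ ≠ 0) (hs : 0 ≤ s) :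
    dataLaw d n m σ σ₀ {ω | ∃ i, s * (σ * ‖μ‖) < |inner ℝ μ (ω.1 i)|}
      ≤ ENNReal.ofReal (n * (2 * Real.exp (-(s ^ 2 / 2)))) := by
  have := norm_pos_iff.2 hμ
  refine (measure_exists_le fun i => ?_).trans_eq (by rw [Fintype.card_fin])
  exact ((measurePreserving_noise σ σ₀ i).measure_preimage_le _).trans
    (gaussianVec_mul_lt_abs_inner (by positivity) (by rw [abs_of_pos hσ]) hs)

lemma dataLaw_exists_lt_abs_inner_init_noise (hd : 0 < d) (hσ : 0 < σ) (hσ₀ : 0 < σ₀)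
    (hs : 0 ≤ s) :
    dataLaw d n m σ σ₀ {ω | ∃ k : (Bool × Fin m) × Fin n, ‖ω.1 k.2‖ ^ 2 ≤ 2 * (σ ^ 2 * d) ∧
        s * (σ₀ * √(2 * (σ ^ 2 * d))) < |inner ℝ (ω.1 k.2) (ω.2 k.1.1 k.1.2)|}
      ≤ ENNReal.ofReal (2 * m * n * (2 * Real.exp (-(s ^ 2 / 2)))) := by
  refine (measure_exists_le (p := 2 * Real.exp (-(s ^ 2 / 2))) fun k => ?_).trans_eq
    (by simp)
  exact ((measurePreserving_noise_neuron σ σ₀ k.2 k.1.1 k.1.2).measure_preimage_le _).trans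
    (gaussianVec_prod_mul_lt_abs_inner hσ₀ (by positivity) hs)

lemma dataLaw_exists_lt_abs_inner_signal_init (hσ₀ : 0 < σ₀) (hμ : μ ≠ 0) (hs : 0 ≤ s) :
    dataLaw d n m σ σ₀ {ω | ∃ k : Bool × Fin m, s * (σ₀ * ‖μ‖) < |inner ℝ μ (ω.2 k.1 k.2)|}
      ≤ ENNReal.ofReal (2 * m * (2 * Real.exp (-(s ^ 2 / 2)))) := by
  have := norm_pos_iff.2 hμ
  refine (measure_exists_le (p := 2 * Real.exp (-(s ^ 2 / 2))) fun k => ?_).trans_eq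
    (by simp)
  exact ((measurePreserving_init σ σ₀ k.1 k.2).measure_preimage_le _).trans
    (gaussianVec_mul_lt_abs_inner (by positivity) (by rw [abs_of_pos hσ₀]) hs)

lemma dataLaw_exists_card_active_lt :
    dataLaw d n m σ σ₀ {ω | ∃ k : Bool × Fin n,
        ((Finset.univ.filter fun r => 0 ≤ inner ℝ (ω.2 k.1 r) (ω.1 k.2)).card : ℝ) < (m : ℝ) / 4}
      ≤ ENNReal.ofReal (2 * n * Real.exp (-(m / 8))) := by
  refine (measure_exists_le (p := Real.exp (-((m : ℝ) / 8))) fun k => ?_).trans_eq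
    (by simp)
  exact ((measurePreserving_noise_branch σ σ₀ k.2 k.1).measure_preimage_le _).trans
    gaussianVec_prod_card_active_lt

lemma setOf_not_typical_subset
    (h_noise : n * (s * (σ * √(2 * (σ ^ 2 * d)))) ≤ τ * (σ ^ 2 * d))
    (h_signal : n * (s * (σ * ‖μ‖)) ≤ τ * (σ ^ 2 * d))
    (h_init_noise : s * (σ₀ * √(2 * (σ ^ 2 * d))) ≤ τ)
    (h_init_signal : s * (σ₀ * ‖μ‖) ≤ τ)
    (hσ : 0 ≤ σ) (h_init_norm : σ * √(2 * (σ₀ ^ 2 * d)) ≤ τ * √((n : ℝ) / d)) :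
    {ω : (Fin n → Vec d) × Weights d m | ¬ Typical μ σ τ ω.1 ω.2} ⊆
      {ω | ∃ i, ‖ω.1 i‖ ^ 2 < σ ^ 2 * d / 2} ∪
      {ω | ∃ i, 2 * (σ ^ 2 * d) < ‖ω.1 i‖ ^ 2} ∪
      {ω | ∃ k : Bool × Fin m, 2 * (σ₀ ^ 2 * d) < ‖ω.2 k.1 k.2‖ ^ 2} ∪
      {ω | ∃ k : Fin n × Fin n, k.1 ≠ k.2 ∧ ‖ω.1 k.1‖ ^ 2 ≤ 2 * (σ ^ 2 * d) ∧
        s * (σ * √(2 * (σ ^ 2 * d))) < |inner ℝ (ω.1 k.1) (ω.1 k.2)|} ∪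
      {ω | ∃ i, s * (σ * ‖μ‖) < |inner ℝ μ (ω.1 i)|} ∪
      {ω | ∃ k : (Bool × Fin m) × Fin n, ‖ω.1 k.2‖ ^ 2 ≤ 2 * (σ ^ 2 * d) ∧
        s * (σ₀ * √(2 * (σ ^ 2 * d))) < |inner ℝ (ω.1 k.2) (ω.2 k.1.1 k.1.2)|} ∪
      {ω | ∃ k : Bool × Fin m, s * (σ₀ * ‖μ‖) < |inner ℝ μ (ω.2 k.1 k.2)|} ∪
      {ω | ∃ k : Bool × Fin n,
        ((Finset.univ.filter fun r => 0 ≤ inner ℝ (ω.2 k.1 r) (ω.1 k.2)).card : ℝ)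
          < (m : ℝ) / 4} := by
  refine fun ω hω => by_contra fun hgood => hω ?_
  simp only [Set.mem_union, Set.mem_ofPred_eq, not_or, not_exists, not_and, not_lt, Prod.forall,
    ne_eq] at hgood
  obtain ⟨⟨⟨⟨⟨⟨⟨hge, hle⟩, hinit⟩, hnoise⟩, hsignal⟩, hinit_noise⟩, hinit_signal⟩, hactive⟩ := hgood
  exact {
    norm_ge := hge
    norm_le := hle
    inner_noise := fun i k hik => le_trans (by gcongr; exact hnoise i k hik (hle i)) h_noise
    inner_signal := fun i => le_trans (by gcongr; exact hsignal i) h_signal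
    init_noise := fun j r i => by
      rw [real_inner_comm]
      exact (hinit_noise j r i (hle i)).trans h_init_noise
    init_signal := fun j r => by
      rw [real_inner_comm]
      exact (hinit_signal j r).trans h_init_signal
    init_norm := fun j r => le_trans (by
      gcongr
      exact Real.le_sqrt_of_sq_le (hinit j r)) h_init_norm
    active := hactive }

lemma dataLaw_not_typical_le (hd : 0 < d) (hσ : 0 < σ) (hσ₀ : 0 < σ₀) (hμ : μ ≠ 0) (hs : 0 ≤ s)
    (h_noise : n * (s * (σ * √(2 * (σ ^ 2 * d)))) ≤ τ * (σ ^ 2 * d))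
    (h_signal : n * (s * (σ * ‖μ‖)) ≤ τ * (σ ^ 2 * d))
    (h_init_noise : s * (σ₀ * √(2 * (σ ^ 2 * d))) ≤ τ)
    (h_init_signal : s * (σ₀ * ‖μ‖) ≤ τ)
    (h_init_norm : σ * √(2 * (σ₀ ^ 2 * d)) ≤ τ * √((n : ℝ) / d)) :
    dataLaw d n m σ σ₀ {ω | ¬ Typical μ σ τ ω.1 ω.2}
      ≤ ENNReal.ofReal ((2 * n + 2 * m) * Real.exp (-(d / 20))
        + (n * n + n + 2 * m * n + 2 * m) * (2 * Real.exp (-(s ^ 2 / 2)))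
        + 2 * n * Real.exp (-(m / 8))) := by
  refine (measure_mono (setOf_not_typical_subset h_noise h_signal h_init_noise h_init_signal hσ.le
    h_init_norm)).trans ?_
  set pd := Real.exp (-((d : ℝ) / 20))
  set ps := Real.exp (-(s ^ 2 / 2))
  set pm := Real.exp (-((m : ℝ) / 8))
  rw [show (2 * n + 2 * m) * pd + (n * n + n + 2 * m * n + 2 * m) * (2 * ps) + 2 * n * pm
    = n * pd + n * pd + 2 * m * pd + n * n * (2 * ps) + n * (2 * ps) + 2 * m * n * (2 * ps)
      + 2 * m * (2 * ps) + 2 * n * pm by ring]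
  iterate 7 rw [ENNReal.ofReal_add (by positivity) (by positivity)]
  refine (measure_union_le _ _).trans (add_le_add ?_ dataLaw_exists_card_active_lt)
  refine (measure_union_le _ _).trans
    (add_le_add ?_ (dataLaw_exists_lt_abs_inner_signal_init hσ₀ hμ hs))
  refine (measure_union_le _ _).trans
    (add_le_add ?_ (dataLaw_exists_lt_abs_inner_init_noise hd hσ hσ₀ hs))
  refine (measure_union_le _ _).trans
    (add_le_add ?_ (dataLaw_exists_lt_abs_inner_signal_noise hσ hμ hs))
  refine (measure_union_le _ _).trans
    (add_le_add ?_ (dataLaw_exists_lt_abs_inner_noise hd hσ hs))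
  refine (measure_union_le _ _).trans (add_le_add ?_ dataLaw_exists_lt_init_norm_sq)
  exact (measure_union_le _ _).trans
    (add_le_add dataLaw_exists_noise_norm_sq_lt dataLaw_exists_lt_noise_norm_sq)

end AtypicalEvents

lemma labelLaw_card_lt (n : ℕ) (j : Bool) :
    labelLaw n {y | ((Finset.univ.filter fun i => y i = j).card : ℝ) < (n : ℝ) / 4}
      ≤ ENNReal.ofReal (Real.exp (-(n / 8))) := by
  have hj : 1 / 2 ≤ rademacher {j} := by
    rw [rademacher, uniformOn_univ]
    simp
  have h := measure_pi_card_lt (ι := Fin n) (MeasurableSet.singleton j) hj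
  simpa only [labelLaw, Fintype.card_fin, Set.mem_singleton_iff] using h

/-! ### The test error -/

lemma sgn_mul_network (W : Weights d m) (μ v : Vec d) (y : Bool) :
    sgn y * network W (dataPoint μ y v) = (1 / (m : ℝ)) * ∑ r,
      (relu (sgn y * inner ℝ (W y r) μ) - relu (-(sgn (!y) * inner ℝ (W (!y) r) μ))
        + (relu (inner ℝ (W y r) v) - relu (inner ℝ (W (!y) r) v))) := by
  unfold network branch dataPoint
  rw [← mul_sub, ← Finset.sum_sub_distrib, mul_left_comm, Finset.mul_sum (a := sgn y)]
  congr 1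
  refine Finset.sum_congr rfl fun r _ => ?_
  cases y <;> simp [sgn] <;> ring

lemma sgn_mul_network_nonneg {W : Weights d m} {μ v : Vec d} {θ : ℝ} (hθ : 0 ≤ θ)
    (hsignal : ∀ j r, θ ≤ sgn j * inner ℝ (W j r) μ) (hnoise : ∀ j r, inner ℝ (W j r) v ≤ θ)
    (y : Bool) : 0 ≤ sgn y * network W (dataPoint μ y v) := by
  rw [sgn_mul_network]
  refine mul_nonneg (by positivity) (Finset.sum_nonneg fun r _ => ?_)
  have hother : relu (-(sgn (!y) * inner ℝ (W (!y) r) μ)) = 0 :=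
    relu_of_nonpos (by linarith [hsignal (!y) r])
  have hopposed : relu (inner ℝ (W (!y) r) v) ≤ θ := max_le hθ (hnoise (!y) r)
  linarith [(hsignal y r).trans (le_relu _), relu_nonneg (inner ℝ (W y r) v)]

lemma isProbabilityMeasure_uniformOn_fin (hn : 0 < n) :
    IsProbabilityMeasure (uniformOn (Set.univ : Set (Fin n))) :=
  isProbabilityMeasure_uniformOn Set.finite_univ ⟨⟨0, hn⟩, trivial⟩

section TestError

variable {μ : Vec d} {σ : ℝ} {ξ : Fin n → Vec d} {W : Weights d m}

lemma testError_le_one (hn : 0 < n) : testError μ σ ξ W ≤ 1 :=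
  have := isProbabilityMeasure_uniformOn_fin hn
  prob_le_one

/-- A misclassified test point needs a fresh noise patch whose correlation with some neuron exceeds
the excess `θ` of the learned signal over the memorized noise. -/
lemma testError_le {θ θ' B : ℝ} (hn : 0 < n) (hθ : 0 ≤ θ) (hθ' : 0 ≤ θ')
    (hsignal : ∀ j r, θ' + θ ≤ sgn j * inner ℝ (W j r) μ)
    (hnoise : ∀ j r i, inner ℝ (W j r) (ξ i) ≤ θ') (hW : ∀ j r, |σ| * ‖W j r‖ ≤ B) :
    testError μ σ ξ W ≤ ENNReal.ofReal (2 * m * Real.exp (-(θ ^ 2 / (2 * B ^ 2)))) := by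
  have := isProbabilityMeasure_uniformOn_fin hn
  set P := rademacher.prod ((uniformOn (Set.univ : Set (Fin n))).prod (gaussianVec d σ))
  have hfresh : MeasurePreserving (fun p : Bool × Fin n × Vec d => p.2.2) P (gaussianVec d σ) :=
    (measurePreserving_snd (μ := uniformOn Set.univ) (ν := gaussianVec d σ)).comp
      (measurePreserving_snd (μ := rademacher)
        (ν := (uniformOn Set.univ).prod (gaussianVec d σ)))
  have hneuron : P {p | ∃ k : Bool × Fin m, θ ≤ inner ℝ (W k.1 k.2) p.2.2}
      ≤ ENNReal.ofReal (2 * m * Real.exp (-(θ ^ 2 / (2 * B ^ 2)))) := by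
    refine (measure_exists_le (P := P)
      (S := fun (k : Bool × Fin m) p => θ ≤ inner ℝ (W k.1 k.2) p.2.2)
      (p := Real.exp (-(θ ^ 2 / (2 * B ^ 2)))) fun k => ?_).trans_eq (by simp)
    exact (hfresh.measure_preimage_le {x | θ ≤ inner ℝ (W k.1 k.2) x}).trans
      (gaussianVec_le_inner (hW k.1 k.2) hθ)
  refine (measure_mono fun p hp => ?_).trans hneuron
  by_contra hsmall
  simp only [Set.mem_ofPred_eq, not_exists, not_le, Prod.forall] at hsmall
  refine absurd hp (not_lt.2 (sgn_mul_network_nonneg (add_nonneg hθ' hθ) hsignal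
    (fun j r => ?_) p.1))
  rw [inner_add_right]
  exact add_le_add (hnoise j r p.2.1) (hsmall j r).le

end TestError

/-! ### The outcome of training on typical data -/

lemma logisticLoss_le (f : ℝ) (y : Bool) : logisticLoss f y ≤ Real.exp (-(sgn y * f)) := by
  unfold logisticLoss
  rw [mul_comm]
  have := Real.log_le_sub_one_of_pos (x := 1 + Real.exp (-(sgn y * f))) (by positivity)
  linarith

lemma trainLoss_le {μ : Vec d} {y : Fin n → Bool} {ξ : Fin n → Vec d} {W : Weights d m} {ε : ℝ}
    (hn : 0 < n)
    (h : ∀ i, Real.exp (-(sgn (y i) * network W (dataPoint μ (y i) (ξ i)))) ≤ ε) :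
    trainLoss μ y ξ W ≤ ε := by
  have hn' : (0 : ℝ) < n := by exact_mod_cast hn
  unfold trainLoss
  rw [one_div, inv_mul_le_iff₀ hn']
  simpa using Finset.sum_le_sum (s := Finset.univ) fun i _ => (logisticLoss_le _ (y i)).trans (h i)

lemma add_mul_div_le_div_sqrt {κ τ x : ℝ} (hκ : 4 ≤ κ) (hτ : 0 ≤ τ) (hx : τ * κ ≤ x) :
    τ + (2 + √κ) * (x / κ) ≤ 3 * x / √κ := by
  obtain ⟨ρ, hρ, rfl⟩ : ∃ ρ, 2 ≤ ρ ∧ κ = ρ ^ 2 :=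
    ⟨√κ, Real.le_sqrt_of_sq_le (by linarith), (Real.sq_sqrt (by linarith)).symm⟩
  rw [Real.sqrt_sq (by linarith), le_div_iff₀ (by linarith)]
  have hx₀ : 0 ≤ x := le_trans (by positivity) hx
  have hτρ : τ * ρ ≤ τ * ρ ^ 2 := by gcongr; nlinarith
  have hxρ : x / ρ ≤ x / 2 := by gcongr
  calc (τ + (2 + ρ) * (x / ρ ^ 2)) * ρ = τ * ρ + 2 * (x / ρ) + x := by
        field_simp
        ring
    _ ≤ 3 * x := by linarith

section Outcome

variable {μ : Vec d} {σ η τ ε c₁ c₂ b : ℝ} {y : Fin n → Bool} {ξ : Fin n → Vec d}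
  {W₀ : Weights d m} {T₁ T₁' Tstar : ℕ} {N : Fin n → ℝ} {t : ℕ}

lemma sgn_mul_network_gd_nonneg
    (hR : (correlations μ η y ξ W₀).Regular (η * (σ ^ 2 * d) / (n * m))
      (n * ‖μ‖ ^ 2 / (σ ^ 2 * d)) τ N)
    (hs : SmallParameters c₁ b (η * (σ ^ 2 * d) / (n * m)) (n * ‖μ‖ ^ 2 / (σ ^ 2 * d)) τ)
    (ht : 24 ≤ η * (σ ^ 2 * d) / (n * m) * t) (i : Fin n) :
    0 ≤ sgn (y i) * network (gd μ η y ξ W₀ t) (dataPoint μ (y i) (ξ i)) := by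
  rw [← margin_correlations, ← Real.one_le_exp_iff]
  linarith [(hR.invariant hs t).lower i]

lemma trainLoss_gd_le
    (hR : (correlations μ η y ξ W₀).Regular (η * (σ ^ 2 * d) / (n * m))
      (n * ‖μ‖ ^ 2 / (σ ^ 2 * d)) τ N)
    (hs : SmallParameters c₁ b (η * (σ ^ 2 * d) / (n * m)) (n * ‖μ‖ ^ 2 / (σ ^ 2 * d)) τ)
    (hε : 0 < ε) (ht : 48 * ε⁻¹ ≤ η * (σ ^ 2 * d) / (n * m) * t) :
    trainLoss μ y ξ (gd μ η y ξ W₀ t) ≤ ε := by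
  refine trainLoss_le hR.n_pos fun i => ?_
  rw [← margin_correlations, Real.exp_neg]
  refine inv_le_of_inv_le₀ hε ?_
  linarith [(hR.invariant hs t).lower i]

namespace Typical

lemma norm_gd_le_log (h : Typical μ σ τ ξ W₀) (hd : 0 < d) (hσ : 0 < σ) (hη : 0 < η)
    (hR : (correlations μ η y ξ W₀).Regular (η * (σ ^ 2 * d) / (n * m))
      (n * ‖μ‖ ^ 2 / (σ ^ 2 * d)) τ N)
    (hs : SmallParameters c₁ b (η * (σ ^ 2 * d) / (n * m)) (n * ‖μ‖ ^ 2 / (σ ^ 2 * d)) τ)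
    (hκ : 4 ≤ n * ‖μ‖ ^ 2 / (σ ^ 2 * d)) (ht : 2 * b + 2 ≤ η * (σ ^ 2 * d) / (n * m) * t)
    (hlog : 40 ≤ Real.log (η * (σ ^ 2 * d) / (n * m) * t)) (j : Bool) (r : Fin m) :
    σ * ‖gd μ η y ξ W₀ t j r‖ ≤ √((n : ℝ) / d) *
      (3 * (10000 * Real.log (η * (σ ^ 2 * d) / (n * m) * t)) / √(n * ‖μ‖ ^ 2 / (σ ^ 2 * d))) := by
  have hτ := hs.τ_le_one_div hR.τ_pos
  refine (h.norm_gd_le hd hσ hη.le hR.τ_pos.le (by linarith) (div_nonneg (by linarith) hs.κ_pos.le)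
    (hR.accGrad_le_log_div hs ht hlog) j r).trans ?_
  gcongr
  refine add_mul_div_le_div_sqrt hκ hR.τ_pos.le ?_
  linarith [hs.τ_le, mul_le_mul_of_nonneg_left hs.κ_le hR.τ_pos.le, hR.τ_pos]

/-- The learned signal is of order `L = log (s * t)` and the memorized noise of order `L / κ`, while
the weights, relative to the noise level, have norm at most of order `√(n / d) * L / √κ`. -/
lemma testError_gd_le (h : Typical μ σ τ ξ W₀) (hd : 0 < d) (hσ : 0 < σ) (hη : 0 < η)
    (hR : (correlations μ η y ξ W₀).Regular (η * (σ ^ 2 * d) / (n * m))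
      (n * ‖μ‖ ^ 2 / (σ ^ 2 * d)) τ N)
    (hs : SmallParameters c₁ b (η * (σ ^ 2 * d) / (n * m)) (n * ‖μ‖ ^ 2 / (σ ^ 2 * d)) τ)
    (hκ : 10 ^ 12 ≤ n * ‖μ‖ ^ 2 / (σ ^ 2 * d))
    (ht : 2 * b + 2 ≤ η * (σ ^ 2 * d) / (n * m) * t)
    (hlog : 40 ≤ Real.log (η * (σ ^ 2 * d) / (n * m) * t)) :
    testError μ σ ξ (gd μ η y ξ W₀ t) ≤
      ENNReal.ofReal (2 * m * Real.exp (-(d / n * (n * ‖μ‖ ^ 2 / (σ ^ 2 * d) / 10 ^ 12)))) := by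
  have hn := hR.n_pos
  have hB := h.norm_gd_le_log hd hσ hη hR hs (by linarith) ht hlog
  have hsignal := hR.log_le_signal hs (by linarith) (by linarith [hs.b_ge]) hlog
  have hmemory := hR.noise_le_accGrad hs t
  have hacc := hR.accGrad_le_log_div hs ht hlog
  have hτ := hs.τ_le_one_div hR.τ_pos
  set κ := n * ‖μ‖ ^ 2 / (σ ^ 2 * d)
  set L := Real.log (η * (σ ^ 2 * d) / (n * m) * t)
  have hκ₀ : 0 < κ := by linarith
  have hfew : 10000 * L / κ ≤ L / 100 := by
    rw [div_le_div_iff₀ hκ₀ (by norm_num)]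
    nlinarith
  refine (testError_le (θ := L / 16) (θ' := L / 16) hn (by positivity) (by positivity)
    (fun j r => (by ring : L / 16 + L / 16 = L / 8).trans_le (hsignal j r))
    (fun j r i => (hmemory j r i).trans (by linarith [hacc i]))
    (by rwa [abs_of_pos hσ])).trans ?_
  refine ENNReal.ofReal_le_ofReal ?_
  gcongr
  calc (d : ℝ) / n * (κ / 10 ^ 12)
      ≤ d / n * (κ / (2 * 16 ^ 2 * 30000 ^ 2)) := by gcongr; norm_num
    _ = (L / 16) ^ 2 / (2 * (√(n / d) * (3 * (10000 * L) / √κ)) ^ 2) := by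
      have : L ≠ 0 := by linarith
      rw [mul_pow, div_pow _ √κ, Real.sq_sqrt (by positivity), Real.sq_sqrt hκ₀.le]
      field_simp
      norm_num

end Typical

lemma div_sub_div_eq (hσ : 0 < σ) (hd : 0 < d) (hn : 0 < n) (c : ℝ) :
    (d : ℝ) / n - n * ‖μ‖ ^ 4 / (c * σ ^ 4 * d)
      = d / n * (1 - (n * ‖μ‖ ^ 2 / (σ ^ 2 * d)) ^ 2 / c) := by
  rcases eq_or_ne c 0 with rfl | hc
  · simp
  · field_simp

lemma two_mul_mul_exp_le {κ : ℝ} (hκ : 0 < κ) (hκc : κ ≤ c₂)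
    (hm : 2 * (m : ℝ) ≤ Real.exp ((d : ℝ) / n)) :
    2 * m * Real.exp (-((d : ℝ) / n * (κ / 10 ^ 12)))
      ≤ Real.exp (d / n * (1 - κ ^ 2 / (10 ^ 12 * c₂))) := by
  have hc : 0 < c₂ := hκ.trans_le hκc
  have hκ' : κ ^ 2 / (10 ^ 12 * c₂) ≤ κ / 10 ^ 12 := by
    rw [sq, mul_div_mul_comm]
    exact mul_le_of_le_one_right (by positivity) ((div_le_one hc).2 hκc)
  calc 2 * (m : ℝ) * Real.exp (-(d / n * (κ / 10 ^ 12)))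
      ≤ Real.exp ((d : ℝ) / n) * Real.exp (-(d / n * (κ / 10 ^ 12))) := by gcongr
    _ = Real.exp (d / n * (1 - κ / 10 ^ 12)) := by
        rw [← Real.exp_add]
        congr 1
        ring
    _ ≤ _ := by gcongr

theorem Typical.outcome (h : Typical μ σ τ ξ W₀) (hn : 0 < n) (hm : 0 < m)
    (hd : 0 < d) (hσ : 0 < σ) (hη : 0 < η) (hτ : 0 < τ) (hε : 0 < ε)
    (hy : ∀ j, (n : ℝ) / 4 ≤ (Finset.univ.filter fun i => y i = j).card)
    (hs : SmallParameters c₁ b (η * (σ ^ 2 * d) / (n * m)) (n * ‖μ‖ ^ 2 / (σ ^ 2 * d)) τ)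
    (hκ_le : n * ‖μ‖ ^ 2 / (σ ^ 2 * d) ≤ c₂) (hm_le : 2 * (m : ℝ) ≤ Real.exp ((d : ℝ) / n))
    (hT : T₁ ≤ T₁') (hT' : T₁' ≤ Tstar)
    (hT₁ : 24 ≤ η * (σ ^ 2 * d) / (n * m) * T₁)
    (hT₁' : max (48 * ε⁻¹) (max (2 * b + 2) (Real.exp 40)) ≤ η * (σ ^ 2 * d) / (n * m) * T₁') :
    Outcome μ σ η ε (10 ^ 12 * c₂) T₁ T₁' Tstar y ξ W₀ := by
  obtain ⟨hloss, hburn, hlog⟩ : _ ∧ _ ∧ _ := by simpa only [max_le_iff] using hT₁'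
  rw [← Real.le_log_iff_exp_le ((Real.exp_pos 40).trans_le hlog)] at hlog
  have hR := h.regular (η := η) hn hm hd hσ hη hτ hy
  have := hR.s_pos
  have hcorrect : ∀ t, T₁ ≤ t → ∀ i,
      0 ≤ sgn (y i) * network (gd μ η y ξ W₀ t) (dataPoint μ (y i) (ξ i)) := fun t ht =>
    sgn_mul_network_gd_nonneg hR hs (hT₁.trans (by gcongr))
  refine ⟨fun t ht _ => hcorrect t ht, T₁', le_rfl, hT', trainLoss_gd_le hR hs hε hloss,
    hcorrect T₁' hT, ?_⟩
  rw [div_sub_div_eq hσ hd hn]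
  have hκ₀ := hs.κ_pos
  rcases lt_or_ge (n * ‖μ‖ ^ 2 / (σ ^ 2 * d)) (10 ^ 12) with hκ | hκ
  -- For a weak signal the exponent is nonnegative.
  · refine (testError_le_one hn).trans (ENNReal.one_le_ofReal.2 (Real.one_le_exp
      (mul_nonneg (by positivity) (sub_nonneg.2 (div_le_one_of_le₀ ?_ ?_)))))
    · rw [sq]
      gcongr
    · linarith
  · exact (h.testError_gd_le hd hσ hη hR hs hκ hburn hlog).trans
      (ENNReal.ofReal_le_ofReal (two_mul_mul_exp_le hκ₀ hκ_le hm_le))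

end Outcome

/-! ### Consequences of the standing condition -/

/-- A weakening of the standing condition: the dimension does not depend on the number of
iterations, the step size and the initialization are only restricted in terms of the noise, and the
signal may be weak compared to a single noise patch. -/
structure MildCondition (C c₁ c₂ : ℝ) (d n m Tstar : ℕ) (μ : Vec d) (σξ σ₀ η ε δ : ℝ) : Prop where
  two_le_n : 2 ≤ n
  σξ_pos : 0 < σξ
  σ₀_pos : 0 < σ₀
  η_pos : 0 < η
  ε_pos : 0 < ε
  ε_le_one : ε ≤ 1
  δ_pos : 0 < δ
  δ_lt_one : δ < 1
  Tstar_ge : C * (ε⁻¹ * timeScale d n m σξ η) ≤ Tstar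
  snr_ge : c₁ ≤ n * SNR μ σξ ^ 2
  snr_le : n * SNR μ σξ ^ 2 ≤ c₂
  d_ge : C * ((n : ℝ) ^ 2 * Real.log (n * m / δ)) ≤ d
  m_ge : C * Real.log (n / δ) ≤ m
  n_ge : C * Real.log (m / δ) ≤ n
  σ₀_le : σ₀ ≤ C⁻¹ * (√(n : ℝ) * σξ⁻¹ * (d : ℝ)⁻¹)
  η_le : η ≤ C⁻¹ * ((σξ ^ 2)⁻¹ * (d : ℝ)⁻¹ * n)

section Parameters

variable {C δ η σ : ℝ}

lemma mul_SNR_sq (μ : Vec d) : n * SNR μ σ ^ 2 = n * ‖μ‖ ^ 2 / (σ ^ 2 * d) := by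
  unfold SNR
  rw [div_pow, mul_pow, Real.sq_sqrt (Nat.cast_nonneg d)]
  ring

lemma one_half_le_log_div (hn : 2 ≤ n) (hδ₀ : 0 < δ) (hδ : δ ≤ 1) :
    1 / 2 ≤ Real.log (n / δ) := by
  have hn' : (2 : ℝ) ≤ n := by exact_mod_cast hn
  have hlog := Real.log_le_log two_pos (hn'.trans (le_div_self (by positivity) hδ₀ hδ))
  linarith [Real.log_two_gt_d9]

lemma mul_le_timeScale (hC : 0 < C) (hη₀ : 0 < η)
    (hη : η ≤ C⁻¹ * ((σ ^ 2)⁻¹ * (d : ℝ)⁻¹ * n)) : C * m ≤ timeScale d n m σ η := by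
  rw [le_inv_mul_iff₀ hC, mul_comm, ← le_inv_mul_iff₀ hη₀] at hη
  calc C * m ≤ η⁻¹ * ((σ ^ 2)⁻¹ * (d : ℝ)⁻¹ * n) * m := by gcongr
    _ = timeScale d n m σ η := by
        unfold timeScale
        ring

lemma exp_neg_le_div {z u : ℝ} (hδ₀ : 0 < δ) (hδ : δ ≤ 1) (hz : 2 ≤ z)
    (hu : 8 * Real.log (z / δ) ≤ u) : Real.exp (-u) ≤ δ / (64 * z ^ 2) := by
  have hδ_pow : δ ^ 8 ≤ δ := pow_le_of_le_one hδ₀.le hδ (by norm_num)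
  calc Real.exp (-u) ≤ Real.exp ((8 : ℕ) * -Real.log (z / δ)) :=
        Real.exp_le_exp.2 (by push_cast; linarith)
    _ = δ ^ 8 / (z ^ 6 * z ^ 2) := by
        rw [Real.exp_nat_mul, Real.exp_neg, Real.exp_log (by positivity), inv_div, div_pow]
        ring
    _ ≤ δ / (2 ^ 6 * z ^ 2) := by gcongr
    _ = δ / (64 * z ^ 2) := by norm_num

lemma tail_sum_le {n m d : ℝ} (hδ₀ : 0 < δ) (hδ : δ ≤ 1) (hn : 2 ≤ n) (hm : 1 ≤ m)
    (hd : 160 * Real.log (n * m / δ) ≤ d) (hm_log : 64 * Real.log (n / δ) ≤ m) :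
    (2 * n + 2 * m) * Real.exp (-(d / 20))
      + (n * n + n + 2 * m * n + 2 * m)
        * (2 * Real.exp (-((4 * √(Real.log (n * m / δ))) ^ 2 / 2)))
      + 2 * n * Real.exp (-(m / 8)) ≤ δ / 2 := by
  have hnm : 2 ≤ n * m := by nlinarith
  have hlog : 0 ≤ Real.log (n * m / δ) :=
    Real.log_nonneg ((le_div_iff₀ hδ₀).2 (by linarith))
  have hexp_d : Real.exp (-(d / 20)) ≤ δ / (64 * (n * m) ^ 2) :=
    exp_neg_le_div hδ₀ hδ hnm (by linarith)
  have hexp_log : Real.exp (-((4 * √(Real.log (n * m / δ))) ^ 2 / 2)) ≤ δ / (64 * (n * m) ^ 2) :=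
    exp_neg_le_div hδ₀ hδ hnm (by rw [mul_pow, Real.sq_sqrt hlog]; linarith)
  have hexp_m : Real.exp (-(m / 8)) ≤ δ / (64 * n ^ 2) := exp_neg_le_div hδ₀ hδ hn (by linarith)
  have hcount : 2 * n + 2 * m + (n * n + n + 2 * m * n + 2 * m) * 2 ≤ 16 * (n * m) ^ 2 := by
    have : n ≤ n * m := le_mul_of_one_le_right (by linarith) hm
    have : m ≤ n * m := le_mul_of_one_le_left (by linarith) (by linarith)
    nlinarith
  calc _ ≤ (2 * n + 2 * m) * (δ / (64 * (n * m) ^ 2))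
        + (n * n + n + 2 * m * n + 2 * m) * (2 * (δ / (64 * (n * m) ^ 2)))
        + 2 * n * (δ / (64 * n ^ 2)) := by gcongr
    _ = (2 * n + 2 * m + (n * n + n + 2 * m * n + 2 * m) * 2) * (δ / (64 * (n * m) ^ 2))
        + 2 * n * (δ / (64 * n ^ 2)) := by ring
    _ ≤ 16 * (n * m) ^ 2 * (δ / (64 * (n * m) ^ 2)) + 2 * n * (δ / (64 * n ^ 2)) := by gcongr
    _ = δ / 4 + δ / (32 * n) := by field_simp; ring
    _ ≤ δ / 4 + δ / (32 * 1) := by gcongr; linarith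
    _ ≤ δ / 2 := by linarith

end Parameters

section Scales

variable {n d σ σ₀ τ Λ ρ : ℝ}

lemma noise_scale_le (hd : 0 ≤ d) (hτ : 0 ≤ τ) (hΛ : 0 ≤ Λ)
    (h : 32 * (n ^ 2 * Λ) ≤ τ ^ 2 * d) :
    n * (4 * √Λ * (σ * √(2 * (σ ^ 2 * d)))) ≤ τ * (σ ^ 2 * d) := by
  refine le_of_sq_le_sq ?_ (by positivity)
  calc (n * (4 * √Λ * (σ * √(2 * (σ ^ 2 * d))))) ^ 2
      = 32 * (n ^ 2 * Λ) * (σ ^ 4 * d) := by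
        simp only [mul_pow, Real.sq_sqrt hΛ, Real.sq_sqrt (by positivity : 0 ≤ 2 * (σ ^ 2 * d))]
        ring
    _ ≤ τ ^ 2 * d * (σ ^ 4 * d) := by gcongr
    _ = (τ * (σ ^ 2 * d)) ^ 2 := by ring

lemma signal_scale_le (hn : 1 ≤ n) (hd : 0 < d) (hσ : 0 < σ) (hτ : 0 ≤ τ) (hΛ : 0 ≤ Λ)
    (h : 16 * (n * ρ ^ 2 / (σ ^ 2 * d)) * (n ^ 2 * Λ) ≤ τ ^ 2 * d) :
    n * (4 * √Λ * (σ * ρ)) ≤ τ * (σ ^ 2 * d) := by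
  refine le_of_sq_le_sq ?_ (by positivity)
  calc (n * (4 * √Λ * (σ * ρ))) ^ 2 = 16 * (n ^ 2 * ρ ^ 2 * Λ) * σ ^ 2 := by
        simp only [mul_pow, Real.sq_sqrt hΛ]
        ring
    _ ≤ 16 * (n ^ 3 * ρ ^ 2 * Λ) * σ ^ 2 := by gcongr; norm_num
    _ = 16 * (n * ρ ^ 2 / (σ ^ 2 * d)) * (n ^ 2 * Λ) * (σ ^ 4 * d) := by field_simp
    _ ≤ τ ^ 2 * d * (σ ^ 4 * d) := by gcongr
    _ = (τ * (σ ^ 2 * d)) ^ 2 := by ring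

lemma init_noise_scale_le (hn : 1 ≤ n) (hd : 0 < d) (hσ : 0 < σ) (hτ : 0 ≤ τ) (hΛ : 0 ≤ Λ)
    (hσ₀ : σ₀ ^ 2 ≤ n / (σ ^ 2 * d ^ 2)) (h : 32 * (n ^ 2 * Λ) ≤ τ ^ 2 * d) :
    4 * √Λ * (σ₀ * √(2 * (σ ^ 2 * d))) ≤ τ := by
  refine le_of_sq_le_sq ?_ hτ
  calc (4 * √Λ * (σ₀ * √(2 * (σ ^ 2 * d)))) ^ 2 = 32 * Λ * (σ₀ ^ 2 * (σ ^ 2 * d)) := by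
        simp only [mul_pow, Real.sq_sqrt hΛ, Real.sq_sqrt (by positivity : 0 ≤ 2 * (σ ^ 2 * d))]
        ring
    _ ≤ 32 * Λ * (n / (σ ^ 2 * d ^ 2) * (σ ^ 2 * d)) := by gcongr
    _ = 32 * (n ^ 1 * Λ) / d := by field_simp
    _ ≤ 32 * (n ^ 2 * Λ) / d := by gcongr; norm_num
    _ ≤ τ ^ 2 := (div_le_iff₀ hd).2 h

lemma init_signal_scale_le (hn : 1 ≤ n) (hd : 0 < d) (hσ : 0 < σ) (hτ : 0 ≤ τ) (hΛ : 0 ≤ Λ)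
    (hσ₀ : σ₀ ^ 2 ≤ n / (σ ^ 2 * d ^ 2))
    (h : 16 * (n * ρ ^ 2 / (σ ^ 2 * d)) * (n ^ 2 * Λ) ≤ τ ^ 2 * d) :
    4 * √Λ * (σ₀ * ρ) ≤ τ := by
  refine le_of_sq_le_sq ?_ hτ
  calc (4 * √Λ * (σ₀ * ρ)) ^ 2 = 16 * Λ * (σ₀ ^ 2 * ρ ^ 2) := by
        simp only [mul_pow, Real.sq_sqrt hΛ]
        ring
    _ ≤ 16 * Λ * (n / (σ ^ 2 * d ^ 2) * ρ ^ 2) := by gcongr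
    _ = 16 * (n * ρ ^ 2 / (σ ^ 2 * d)) * (1 * Λ) / d := by field_simp
    _ ≤ 16 * (n * ρ ^ 2 / (σ ^ 2 * d)) * (n ^ 2 * Λ) / d := by
        gcongr
        exact one_le_pow₀ hn
    _ ≤ τ ^ 2 := (div_le_iff₀ hd).2 h

lemma init_norm_scale_le {C : ℝ} (hn : 0 ≤ n) (hd : 0 < d) (hσ : 0 < σ) (hτ : 0 ≤ τ) (hC : 0 < C)
    (hσ₀ : σ₀ ^ 2 ≤ n / (C ^ 2 * σ ^ 2 * d ^ 2)) (h : 2 ≤ τ ^ 2 * C ^ 2) :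
    σ * √(2 * (σ₀ ^ 2 * d)) ≤ τ * √(n / d) := by
  refine le_of_sq_le_sq ?_ (by positivity)
  rw [mul_pow, mul_pow, Real.sq_sqrt (by positivity), Real.sq_sqrt (by positivity)]
  calc σ ^ 2 * (2 * (σ₀ ^ 2 * d)) ≤ σ ^ 2 * (2 * (n / (C ^ 2 * σ ^ 2 * d ^ 2) * d)) := by gcongr
    _ = 2 / C ^ 2 * (n / d) := by field_simp
    _ ≤ τ ^ 2 * (n / d) := by
        gcongr
        exact (div_le_iff₀ (by positivity)).2 h

end Scales

section Constants

variable (c₁ c₂ : ℝ)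

/-- The constant `b` of the training invariant: the exponentials of the margins grow at most at
rate `2 * b` per unit of rescaled time. -/
def growthRate : ℝ := 400 * c₂ + 6

/-- The bound on the normalized correlations of typical data. -/
def tolerance : ℝ := min 1 c₁ / (3840 * growthRate c₂)

/-- The rescaled time after which the training loss is at most `ε`, in units of `ε⁻¹`. -/
def lossTimeFactor : ℝ := Real.exp 40 + (2 * growthRate c₂ + 2)

/-- The least admissible constant `C` in `MildCondition`. -/
def threshold : ℝ :=
  max (max 160 (40 * growthRate c₂))
    (max (lossTimeFactor c₂ + 1) ((32 + 16 * c₂) / tolerance c₁ c₂ ^ 2))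

variable {c₁ c₂}

lemma six_le_growthRate (hc₂ : 0 ≤ c₂) : 6 ≤ growthRate c₂ := by
  unfold growthRate
  linarith

lemma tolerance_pos (hc₁ : 0 < c₁) (hc₂ : 0 ≤ c₂) : 0 < tolerance c₁ c₂ :=
  div_pos (lt_min one_pos hc₁) (by linarith [six_le_growthRate hc₂])

lemma growthRate_mul_tolerance (hc₂ : 0 ≤ c₂) :
    3840 * growthRate c₂ * tolerance c₁ c₂ = min 1 c₁ :=
  mul_div_cancel₀ _ (by linarith [six_le_growthRate hc₂])

lemma lossTimeFactor_ge (hc₂ : 0 ≤ c₂) : 48 ≤ lossTimeFactor c₂ := by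
  unfold lossTimeFactor
  linarith [six_le_growthRate hc₂, Real.add_one_le_exp 40]

lemma smallParameters_of_le {s κ : ℝ} (hc₁ : 0 < c₁) (hκ_ge : c₁ ≤ κ) (hκ_le : κ ≤ c₂)
    (hs : 40 * growthRate c₂ * s ≤ 1) :
    SmallParameters c₁ (growthRate c₂) s κ (tolerance c₁ c₂) := by
  have hc₂ : 0 ≤ c₂ := hc₁.le.trans (hκ_ge.trans hκ_le)
  have hb := six_le_growthRate hc₂
  have hτ := tolerance_pos hc₁ hc₂
  have hbτ := growthRate_mul_tolerance (c₁ := c₁) hc₂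
  have hbτ_one := hbτ.trans_le (min_le_left _ _)
  have hbτ_c₁ := hbτ.trans_le (min_le_right _ _)
  have hburn : growthRate c₂ * (48 * tolerance c₁ c₂ / c₁) ≤ 1 / 40 := by
    rw [mul_div_assoc', div_le_div_iff₀ hc₁ (by norm_num)]
    linarith
  exact {
    c₁_pos := hc₁
    κ_ge := hκ_ge
    κ_le := by
      unfold growthRate
      linarith
    τ_le := by linarith
    τ_le' := by linarith
    burnIn_le := by nlinarith }

end Constants

section Times

variable (d n m) (σ η : ℝ)

/-- The time `T₁` from which on the training points are classified correctly. -/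
def fitTime : ℕ := ⌈24 * timeScale d n m σ η⌉₊

/-- The time `T₁'` from which on the training loss is at most `ε`. -/
def lossTime (c₂ ε : ℝ) : ℕ := ⌈lossTimeFactor c₂ * (ε⁻¹ * timeScale d n m σ η)⌉₊

lemma step_eq_inv_timeScale : η * (σ ^ 2 * d) / (n * m) = (timeScale d n m σ η)⁻¹ := by
  simp only [timeScale, mul_inv, inv_inv]
  ring

end Times

lemma ceil_mul_le {a x : ℝ} (ha : 0 ≤ a) (hx : 1 ≤ x) : (⌈a * x⌉₊ : ℝ) ≤ (a + 1) * x := by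
  linarith [Nat.ceil_lt_add_one (mul_nonneg ha (zero_le_one.trans hx))]

namespace MildCondition

variable {C c₁ c₂ : ℝ} {Tstar : ℕ} {μ : Vec d} {σ σ₀ η ε δ : ℝ}

lemma n_pos (h : MildCondition C c₁ c₂ d n m Tstar μ σ σ₀ η ε δ) : 0 < n :=
  two_pos.trans_le h.two_le_n

lemma signal_ge (h : MildCondition C c₁ c₂ d n m Tstar μ σ σ₀ η ε δ) :
    c₁ ≤ n * ‖μ‖ ^ 2 / (σ ^ 2 * d) :=
  mul_SNR_sq (n := n) (σ := σ) μ ▸ h.snr_ge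

lemma signal_le (h : MildCondition C c₁ c₂ d n m Tstar μ σ σ₀ η ε δ) :
    n * ‖μ‖ ^ 2 / (σ ^ 2 * d) ≤ c₂ :=
  mul_SNR_sq (n := n) (σ := σ) μ ▸ h.snr_le

lemma d_pos (h : MildCondition C c₁ c₂ d n m Tstar μ σ σ₀ η ε δ) (hc₁ : 0 < c₁) : 0 < d := by
  refine Nat.pos_of_ne_zero fun hd => ?_
  have := hc₁.trans_le h.signal_ge
  simp [hd] at this

lemma μ_ne_zero (h : MildCondition C c₁ c₂ d n m Tstar μ σ σ₀ η ε δ) (hc₁ : 0 < c₁) : μ ≠ 0 := by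
  rintro rfl
  have := hc₁.trans_le h.signal_ge
  simp at this

lemma mul_log_le_m (h : MildCondition C c₁ c₂ d n m Tstar μ σ σ₀ η ε δ) (hC : 160 ≤ C) :
    160 * Real.log (n / δ) ≤ m := by
  have := one_half_le_log_div h.two_le_n h.δ_pos h.δ_lt_one.le
  exact (mul_le_mul_of_nonneg_right hC (by linarith)).trans h.m_ge

lemma four_le_m (h : MildCondition C c₁ c₂ d n m Tstar μ σ σ₀ η ε δ) (hC : 160 ≤ C) :
    (4 : ℝ) ≤ m := by
  linarith [h.mul_log_le_m hC, one_half_le_log_div h.two_le_n h.δ_pos h.δ_lt_one.le]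

lemma le_timeScale (h : MildCondition C c₁ c₂ d n m Tstar μ σ σ₀ η ε δ) (hC : 160 ≤ C) :
    C ≤ timeScale d n m σ η :=
  (le_mul_of_one_le_right (by linarith) (by linarith [h.four_le_m hC])).trans
    (mul_le_timeScale (by linarith) h.η_pos h.η_le)

lemma timeScale_le (h : MildCondition C c₁ c₂ d n m Tstar μ σ σ₀ η ε δ) (hC : 160 ≤ C) :
    timeScale d n m σ η ≤ ε⁻¹ * timeScale d n m σ η :=
  le_mul_of_one_le_left (by linarith [h.le_timeScale hC]) ((one_le_inv₀ h.ε_pos).2 h.ε_le_one)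

lemma two_mul_m_le (h : MildCondition C c₁ c₂ d n m Tstar μ σ σ₀ η ε δ) :
    2 * (m : ℝ) ≤ n * m / δ := by
  have hn : (2 : ℝ) ≤ n := by exact_mod_cast h.two_le_n
  calc 2 * (m : ℝ) ≤ n * m := by gcongr
    _ ≤ n * m / δ := le_div_self (by positivity) h.δ_pos h.δ_lt_one.le

lemma one_le_log (h : MildCondition C c₁ c₂ d n m Tstar μ σ σ₀ η ε δ) (hC : 160 ≤ C) :
    1 ≤ Real.log (n * m / δ) := by
  have hm := h.four_le_m hC
  rw [Real.le_log_iff_exp_le (by linarith [h.two_mul_m_le])]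
  linarith [h.two_mul_m_le, Real.exp_one_lt_d9]

lemma two_mul_m_le_exp (h : MildCondition C c₁ c₂ d n m Tstar μ σ σ₀ η ε δ) (hC : 160 ≤ C) :
    2 * (m : ℝ) ≤ Real.exp (d / n) := by
  have hn : (1 : ℝ) ≤ n := by exact_mod_cast h.n_pos
  have hlog := h.one_le_log hC
  refine h.two_mul_m_le.trans ?_
  rw [← Real.log_le_iff_le_exp (by linarith [h.two_mul_m_le, h.four_le_m hC]),
    le_div_iff₀ (by linarith)]
  calc Real.log (n * m / δ) * n ≤ Real.log (n * m / δ) * n ^ 2 := by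
        gcongr
        exact le_self_pow₀ hn two_ne_zero
    _ = 1 * (n ^ 2 * Real.log (n * m / δ)) := by ring
    _ ≤ C * (n ^ 2 * Real.log (n * m / δ)) := by gcongr; linarith
    _ ≤ d := h.d_ge

lemma smallParameters (h : MildCondition C c₁ c₂ d n m Tstar μ σ σ₀ η ε δ) (hc₁ : 0 < c₁)
    (hC : threshold c₁ c₂ ≤ C) :
    SmallParameters c₁ (growthRate c₂) (η * (σ ^ 2 * d) / (n * m)) (n * ‖μ‖ ^ 2 / (σ ^ 2 * d))
      (tolerance c₁ c₂) := by
  obtain ⟨⟨hC, hCb⟩, -⟩ := by simpa only [threshold, max_le_iff] using hC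
  have hR := h.le_timeScale hC
  refine smallParameters_of_le hc₁ h.signal_ge h.signal_le ?_
  rw [step_eq_inv_timeScale, mul_inv_le_iff₀ (by linarith)]
  linarith

lemma σ₀_sq_le (h : MildCondition C c₁ c₂ d n m Tstar μ σ σ₀ η ε δ) :
    σ₀ ^ 2 ≤ n / (C ^ 2 * σ ^ 2 * d ^ 2) := by
  have hσ₀ := h.σ₀_pos
  calc σ₀ ^ 2 ≤ (C⁻¹ * (√(n : ℝ) * σ⁻¹ * (d : ℝ)⁻¹)) ^ 2 := by gcongr; exact h.σ₀_le
    _ = √(n : ℝ) ^ 2 / (C ^ 2 * σ ^ 2 * d ^ 2) := by field_simp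
    _ = n / (C ^ 2 * σ ^ 2 * d ^ 2) := by rw [Real.sq_sqrt (Nat.cast_nonneg n)]

lemma dimension_ge (h : MildCondition C c₁ c₂ d n m Tstar μ σ σ₀ η ε δ) (hC : 160 ≤ C) {τ : ℝ}
    (hCτ : 32 + 16 * c₂ ≤ C * τ ^ 2) :
    (32 + 16 * c₂) * ((n : ℝ) ^ 2 * Real.log (n * m / δ)) ≤ τ ^ 2 * d := by
  have hlog := h.one_le_log hC
  calc (32 + 16 * c₂) * ((n : ℝ) ^ 2 * Real.log (n * m / δ))
      ≤ C * τ ^ 2 * ((n : ℝ) ^ 2 * Real.log (n * m / δ)) := by gcongr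
    _ = τ ^ 2 * (C * ((n : ℝ) ^ 2 * Real.log (n * m / δ))) := by ring
    _ ≤ τ ^ 2 * d := by gcongr; exact h.d_ge

lemma dataLaw_not_typical_le (h : MildCondition C c₁ c₂ d n m Tstar μ σ σ₀ η ε δ) (hc₁ : 0 < c₁)
    (hC : 160 ≤ C) {τ : ℝ} (hτ : 0 ≤ τ) (hCτ : 32 + 16 * c₂ ≤ C * τ ^ 2) :
    dataLaw d n m σ σ₀ {ω | ¬ Typical μ σ τ ω.1 ω.2} ≤ ENNReal.ofReal (δ / 2) := by
  have hσ := h.σξ_pos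
  have hn : (2 : ℝ) ≤ n := by exact_mod_cast h.two_le_n
  have hn_one : (1 : ℝ) ≤ n := by linarith
  have hm : (1 : ℝ) ≤ m := by linarith [h.four_le_m hC]
  have hd : (0 : ℝ) < d := by exact_mod_cast h.d_pos hc₁
  have hΛ : 0 ≤ Real.log (n * m / δ) := by linarith [h.one_le_log hC]
  have hc₂ : 0 ≤ c₂ := hc₁.le.trans (h.signal_ge.trans h.signal_le)
  have hdim := h.dimension_ge hC hCτ
  have hdim_noise : 32 * (n ^ 2 * Real.log (n * m / δ)) ≤ τ ^ 2 * d := by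
    refine le_trans ?_ hdim
    gcongr
    linarith
  have hdim_signal :
      16 * (n * ‖μ‖ ^ 2 / (σ ^ 2 * d)) * (n ^ 2 * Real.log (n * m / δ)) ≤ τ ^ 2 * d := by
    refine le_trans ?_ hdim
    gcongr
    linarith [h.signal_le]
  have hσ₀_sq : σ₀ ^ 2 ≤ n / (σ ^ 2 * d ^ 2) := by
    refine h.σ₀_sq_le.trans ?_
    gcongr
    exact le_mul_of_one_le_left (sq_nonneg σ) (one_le_pow₀ (by linarith))
  have hτC : 2 ≤ τ ^ 2 * C ^ 2 := by nlinarith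
  have hdim_log : 160 * Real.log (n * m / δ) ≤ d := by
    refine le_trans ?_ h.d_ge
    gcongr
    exact le_mul_of_one_le_left hΛ (one_le_pow₀ hn_one)
  refine (FeatureLearning.dataLaw_not_typical_le (s := 4 * √(Real.log (n * m / δ)))
    (h.d_pos hc₁) hσ h.σ₀_pos (h.μ_ne_zero hc₁) (by positivity)
    (noise_scale_le hd.le hτ hΛ hdim_noise)
    (signal_scale_le hn_one hd hσ hτ hΛ hdim_signal)
    (init_noise_scale_le hn_one hd hσ hτ hΛ hσ₀_sq hdim_noise)
    (init_signal_scale_le hn_one hd hσ hτ hΛ hσ₀_sq hdim_signal)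
    (init_norm_scale_le (by linarith) hd hσ hτ (by linarith) h.σ₀_sq_le hτC)).trans ?_
  exact ENNReal.ofReal_le_ofReal (tail_sum_le h.δ_pos h.δ_lt_one.le hn hm hdim_log
    (by linarith [h.mul_log_le_m hC, one_half_le_log_div h.two_le_n h.δ_pos h.δ_lt_one.le]))

lemma labelLaw_unbalanced_le (h : MildCondition C c₁ c₂ d n m Tstar μ σ σ₀ η ε δ)
    (hC : 160 ≤ C) :
    labelLaw n {y | ∃ j, ((Finset.univ.filter fun i => y i = j).card : ℝ) < n / 4}
      ≤ ENNReal.ofReal (δ / 2) := by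
  refine (measure_exists_le (p := Real.exp (-((n : ℝ) / 8))) (labelLaw_card_lt n)).trans
    (ENNReal.ofReal_le_ofReal ?_)
  have hδ := h.δ_pos
  have hm := h.four_le_m hC
  have hlog : 0 ≤ Real.log (m / δ) :=
    Real.log_nonneg ((le_div_iff₀ hδ).2 (by linarith [h.δ_lt_one]))
  have hlog_le : 8 * Real.log (m / δ) ≤ n := by
    refine le_trans ?_ h.n_ge
    gcongr
    linarith
  calc (Fintype.card Bool : ℝ) * Real.exp (-(n / 8))
      ≤ 2 * Real.exp (-Real.log (m / δ)) := by
        rw [Fintype.card_bool]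
        gcongr
        · norm_num
        · linarith
    _ = 2 * (δ / m) := by rw [Real.exp_neg, Real.exp_log (by positivity), inv_div]
    _ ≤ 2 * (δ / 4) := by gcongr
    _ = δ / 2 := by ring

lemma fitTime_le_lossTime (h : MildCondition C c₁ c₂ d n m Tstar μ σ σ₀ η ε δ) (hC : 160 ≤ C)
    (hc₂ : 0 ≤ c₂) : fitTime d n m σ η ≤ lossTime d n m σ η c₂ ε :=
  Nat.ceil_le_ceil (mul_le_mul (by linarith [lossTimeFactor_ge hc₂]) (h.timeScale_le hC)
    (by linarith [h.le_timeScale hC]) (by linarith [lossTimeFactor_ge hc₂]))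

lemma fitTime_le (h : MildCondition C c₁ c₂ d n m Tstar μ σ σ₀ η ε δ) (hC : 160 ≤ C)
    (hc₂ : 0 ≤ c₂) :
    fitTime d n m σ η ≤ (lossTimeFactor c₂ + 1) * timeScale d n m σ η := by
  have hR := h.le_timeScale hC
  refine (ceil_mul_le (by norm_num) (by linarith)).trans ?_
  gcongr
  · linarith
  · linarith [lossTimeFactor_ge hc₂]

lemma lossTime_le (h : MildCondition C c₁ c₂ d n m Tstar μ σ σ₀ η ε δ) (hC : 160 ≤ C)
    (hc₂ : 0 ≤ c₂) :
    lossTime d n m σ η c₂ ε ≤ (lossTimeFactor c₂ + 1) * (ε⁻¹ * timeScale d n m σ η) :=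
  ceil_mul_le (by linarith [lossTimeFactor_ge hc₂])
    (by linarith [h.le_timeScale hC, h.timeScale_le hC])

lemma lossTime_le_Tstar (h : MildCondition C c₁ c₂ d n m Tstar μ σ σ₀ η ε δ)
    (hC : threshold c₁ c₂ ≤ C) (hc₂ : 0 ≤ c₂) : lossTime d n m σ η c₂ ε ≤ Tstar := by
  obtain ⟨⟨hC, -⟩, hCA, -⟩ := by simpa only [threshold, max_le_iff] using hC
  have hle : (lossTime d n m σ η c₂ ε : ℝ) ≤ Tstar := by
    refine (h.lossTime_le hC hc₂).trans (le_trans ?_ h.Tstar_ge)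
    gcongr
    linarith [h.le_timeScale hC, h.timeScale_le hC]
  exact_mod_cast hle

lemma outcome (h : MildCondition C c₁ c₂ d n m Tstar μ σ σ₀ η ε δ) (hc₁ : 0 < c₁)
    (hC : threshold c₁ c₂ ≤ C) {y : Fin n → Bool} {ξ : Fin n → Vec d} {W₀ : Weights d m}
    (hy : ∀ j, (n : ℝ) / 4 ≤ (Finset.univ.filter fun i => y i = j).card)
    (h_typical : Typical μ σ (tolerance c₁ c₂) ξ W₀) :
    Outcome μ σ η ε (10 ^ 12 * c₂) (fitTime d n m σ η) (lossTime d n m σ η c₂ ε) Tstar y ξ W₀ := by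
  have hc₂ : 0 ≤ c₂ := hc₁.le.trans (h.signal_ge.trans h.signal_le)
  have h160 : 160 ≤ C := (le_max_left _ _).trans ((le_max_left _ _).trans hC)
  have hR : 0 < timeScale d n m σ η := by linarith [h.le_timeScale h160]
  have hm : 0 < m := by
    have := h.four_le_m h160
    exact_mod_cast (by linarith : (0 : ℝ) < m)
  have hA := lossTimeFactor_ge hc₂
  have hε := (one_le_inv₀ h.ε_pos).2 h.ε_le_one
  refine h_typical.outcome h.n_pos hm (h.d_pos hc₁) h.σξ_pos h.η_pos (tolerance_pos hc₁ hc₂)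
    h.ε_pos hy (h.smallParameters hc₁ hC) h.signal_le (h.two_mul_m_le_exp h160)
    (h.fitTime_le_lossTime h160 hc₂) (h.lossTime_le_Tstar hC hc₂) ?_ ?_
  · rw [step_eq_inv_timeScale, le_inv_mul_iff₀ hR, mul_comm]
    exact Nat.le_ceil _
  · have hfactor : max (48 * ε⁻¹) (max (2 * growthRate c₂ + 2) (Real.exp 40))
        ≤ lossTimeFactor c₂ * ε⁻¹ := by
      have hA_le : lossTimeFactor c₂ ≤ lossTimeFactor c₂ * ε⁻¹ :=
        le_mul_of_one_le_right (by linarith) hε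
      refine max_le (by gcongr) (max_le (le_trans ?_ hA_le) (le_trans ?_ hA_le))
      · exact le_add_of_nonneg_left (Real.exp_pos _).le
      · exact le_add_of_nonneg_right (by linarith [six_le_growthRate hc₂])
    refine hfactor.trans ?_
    rw [step_eq_inv_timeScale, le_inv_mul_iff₀ hR, mul_comm, mul_assoc]
    exact Nat.le_ceil _

lemma dataLaw_not_typical_tolerance_le (h : MildCondition C c₁ c₂ d n m Tstar μ σ σ₀ η ε δ)
    (hc₁ : 0 < c₁) (hC : threshold c₁ c₂ ≤ C) :
    dataLaw d n m σ σ₀ {ω | ¬ Typical μ σ (tolerance c₁ c₂) ω.1 ω.2}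
      ≤ ENNReal.ofReal (δ / 2) := by
  have hτ := tolerance_pos hc₁ (hc₁.le.trans (h.signal_ge.trans h.signal_le))
  obtain ⟨⟨hC, -⟩, -, hCτ⟩ := by simpa only [threshold, max_le_iff] using hC
  exact h.dataLaw_not_typical_le hc₁ hC hτ.le ((div_le_iff₀ (by positivity)).1 hCτ)

lemma dataLaw_not_outcome_le (h : MildCondition C c₁ c₂ d n m Tstar μ σ σ₀ η ε δ) (hc₁ : 0 < c₁)
    (hC : threshold c₁ c₂ ≤ C) {y : Fin n → Bool}
    (hy : ∀ j, (n : ℝ) / 4 ≤ (Finset.univ.filter fun i => y i = j).card) :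
    dataLaw d n m σ σ₀ {ω | ¬ Outcome μ σ η ε (10 ^ 12 * c₂) (fitTime d n m σ η)
        (lossTime d n m σ η c₂ ε) Tstar y ω.1 ω.2} ≤ ENNReal.ofReal δ :=
  (measure_mono fun _ => mt (h.outcome hc₁ hC hy)).trans
    ((h.dataLaw_not_typical_tolerance_le hc₁ hC).trans
      (ENNReal.ofReal_le_ofReal (half_le_self h.δ_pos.le)))

lemma labelLaw_prod_dataLaw_not_outcome_le (h : MildCondition C c₁ c₂ d n m Tstar μ σ σ₀ η ε δ)
    (hc₁ : 0 < c₁) (hC : threshold c₁ c₂ ≤ C) :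
    (labelLaw n).prod (dataLaw d n m σ σ₀) {ω | ¬ Outcome μ σ η ε (10 ^ 12 * c₂)
        (fitTime d n m σ η) (lossTime d n m σ η c₂ ε) Tstar ω.1 ω.2.1 ω.2.2}
      ≤ ENNReal.ofReal δ := by
  have h160 : 160 ≤ C := (le_max_left _ _).trans ((le_max_left _ _).trans hC)
  have hlabels := (measurePreserving_fst (μ := labelLaw n)
    (ν := dataLaw d n m σ σ₀)).measure_preimage_le
      {y | ∃ j, ((Finset.univ.filter fun i => y i = j).card : ℝ) < n / 4}
  have hdata := (measurePreserving_snd (μ := labelLaw n)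
    (ν := dataLaw d n m σ σ₀)).measure_preimage_le
      {ω | ¬ Typical μ σ (tolerance c₁ c₂) ω.1 ω.2}
  have hδ := half_pos h.δ_pos
  rw [← add_halves δ, ENNReal.ofReal_add hδ.le hδ.le]
  refine le_trans (measure_mono fun ω hω => ?_) ((measure_union_le _ _).trans
    (add_le_add (hlabels.trans (h.labelLaw_unbalanced_le h160))
      (hdata.trans (h.dataLaw_not_typical_tolerance_le hc₁ hC))))
  by_contra hgood
  simp only [Set.mem_union, Set.mem_preimage, Set.mem_ofPred_eq, not_or, not_exists, not_lt,
    not_not] at hgood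
  exact hω (h.outcome hc₁ hC hgood.1 hgood.2)

end MildCondition

lemma Condition.mild {C c₁ c₂ : ℝ} {Tstar : ℕ} {μ : Vec d} {σ σ₀ η ε δ : ℝ}
    (h : Condition C c₁ c₂ d n m Tstar μ σ σ₀ η ε δ) (hC : 3 ≤ C) :
    MildCondition C c₁ c₂ d n m Tstar μ σ σ₀ η ε δ := by
  have hlog := one_half_le_log_div h.two_le_n h.δ_pos h.δ_lt_one.le
  have hn : (2 : ℝ) ≤ n := by exact_mod_cast h.two_le_n
  have hm : (1 : ℝ) ≤ m := by nlinarith [h.m_ge]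
  have hη : η ≤ C⁻¹ * ((σ ^ 2)⁻¹ * (d : ℝ)⁻¹ * n) :=
    h.η_le.trans (by gcongr; exact min_le_right _ _)
  have hTstar : 3 ≤ (Tstar : ℝ) := by
    have hR : 1 ≤ timeScale d n m σ η :=
      le_trans (by nlinarith) (mul_le_timeScale (by linarith) h.η_pos hη)
    calc (3 : ℝ) ≤ C * (ε⁻¹ * timeScale d n m σ η) := by
          nlinarith [one_le_mul_of_one_le_of_one_le ((one_le_inv₀ h.ε_pos).2 h.ε_le_one) hR]
      _ ≤ Tstar := h.Tstar_ge
  have hlog_Tstar : 1 ≤ Real.log Tstar := by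
    rw [Real.le_log_iff_exp_le (by linarith)]
    linarith [Real.exp_one_lt_d9]
  have hlog_nm : 0 ≤ Real.log (n * m / δ) :=
    Real.log_nonneg ((le_div_iff₀ h.δ_pos).2 (by nlinarith [h.δ_lt_one]))
  exact {
    two_le_n := h.two_le_n
    σξ_pos := h.σξ_pos
    σ₀_pos := h.σ₀_pos
    η_pos := h.η_pos
    ε_pos := h.ε_pos
    ε_le_one := h.ε_le_one
    δ_pos := h.δ_pos
    δ_lt_one := h.δ_lt_one
    Tstar_ge := h.Tstar_ge
    snr_ge := h.snr_ge
    snr_le := h.snr_le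
    d_ge := by
      refine le_trans ?_ h.d_ge
      gcongr
      exact le_max_of_le_left (le_mul_of_one_le_right (by positivity) (one_le_pow₀ hlog_Tstar))
    m_ge := h.m_ge
    n_ge := h.n_ge
    σ₀_le := h.σ₀_le.trans (by gcongr; exact min_le_left _ _)
    η_le := hη }

lemma Balanced.card_ge {y : Fin n → Bool} (h : Balanced y) (j : Bool) :
    (n : ℝ) / 4 ≤ (Finset.univ.filter fun i => y i = j).card := by
  have hsum := Finset.card_filter_add_card_filter_not (s := (Finset.univ : Finset (Fin n)))
    (fun i => y i = true)
  simp only [Bool.not_eq_true, Finset.card_univ, Fintype.card_fin] at hsum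
  have hcard : 2 * (Finset.univ.filter fun i => y i = j).card = n := by
    unfold Balanced at h
    cases j <;> omega
  have hcard_real : 2 * ((Finset.univ.filter fun i => y i = j).card : ℝ) = n := by
    exact_mod_cast hcard
  linarith [Nat.cast_nonneg (α := ℝ) n]

end FeatureLearning

end

theorem theorem4p4_general :
    ∃ K : ℝ, 0 < K ∧ ∀ c₁ c₂ : ℝ, 0 < c₁ → c₁ ≤ c₂ →
      ∃ C₀ C_D a b : ℝ, 0 < C_D ∧ C_D ≤ K * c₂ ∧ 0 < a ∧ 0 < b ∧
        ∀ (C : ℝ) (d n m Tstar : ℕ) (μ : Vec d) (σξ σ₀ η ε δ : ℝ), C₀ ≤ C →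
          MildCondition C c₁ c₂ d n m Tstar μ σξ σ₀ η ε δ →
          ∃ T₁ T₁' : ℕ,
            (a * timeScale d n m σξ η ≤ T₁ ∧ T₁ ≤ b * timeScale d n m σξ η) ∧
            (a * (ε⁻¹ * timeScale d n m σξ η) ≤ T₁' ∧
              T₁' ≤ b * (ε⁻¹ * timeScale d n m σξ η)) ∧
            T₁ ≤ T₁' ∧ T₁' ≤ Tstar ∧
            ((labelLaw n).prod ((noiseLaw d n σξ).prod (initLaw d m σ₀)))
                {ω | ¬ Outcome μ σξ η ε C_D T₁ T₁' Tstar ω.1 ω.2.1 ω.2.2} ≤ ENNReal.ofReal δ ∧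
            (∀ y : Fin n → Bool,
              (∀ j, (n : ℝ) / 4 ≤ (Finset.univ.filter fun i => y i = j).card) →
              ((noiseLaw d n σξ).prod (initLaw d m σ₀))
                {ω | ¬ Outcome μ σξ η ε C_D T₁ T₁' Tstar y ω.1 ω.2} ≤ ENNReal.ofReal δ) := by
  refine ⟨10 ^ 12, by norm_num, fun c₁ c₂ hc₁ hc => ?_⟩
  have hc₂ : 0 < c₂ := hc₁.trans_le hc
  have hA := lossTimeFactor_ge hc₂.le
  refine ⟨threshold c₁ c₂, 10 ^ 12 * c₂, 24, lossTimeFactor c₂ + 1, by positivity, le_rfl,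
    by norm_num, by linarith, fun C d n m Tstar μ σξ σ₀ η ε δ hC h => ?_⟩
  have h160 : 160 ≤ C := (le_max_left _ _).trans ((le_max_left _ _).trans hC)
  have hR := (h.le_timeScale h160).trans (h.timeScale_le h160)
  exact ⟨fitTime d n m σξ η, lossTime d n m σξ η c₂ ε,
    ⟨Nat.le_ceil _, h.fitTime_le h160 hc₂.le⟩,
    ⟨(mul_le_mul_of_nonneg_right (by linarith) (by linarith)).trans (Nat.le_ceil _),
      h.lossTime_le h160 hc₂.le⟩,
    h.fitTime_le_lossTime h160 hc₂.le, h.lossTime_le_Tstar hC hc₂.le,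
    h.labelLaw_prod_dataLaw_not_outcome_le hc₁ hC, fun _ => h.dataLaw_not_outcome_le hc₁ hC⟩

theorem theorem4p4 :
    ∃ K : ℝ, 0 < K ∧ ∀ c₁ c₂ : ℝ, 0 < c₁ → c₁ ≤ c₂ →
      ∃ C C_D a b : ℝ, 0 < C ∧ 0 < C_D ∧ C_D ≤ K * c₂ ∧ 0 < a ∧ 0 < b ∧
        ∀ (d n m Tstar : ℕ) (μ : Vec d) (σξ σ₀ η ε δ : ℝ),
          Condition C c₁ c₂ d n m Tstar μ σξ σ₀ η ε δ →
          ∃ T₁ T₁' : ℕ,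
            (a * timeScale d n m σξ η ≤ T₁ ∧ T₁ ≤ b * timeScale d n m σξ η) ∧
            (a * (ε⁻¹ * timeScale d n m σξ η) ≤ T₁' ∧
              T₁' ≤ b * (ε⁻¹ * timeScale d n m σξ η)) ∧
            T₁ ≤ T₁' ∧ T₁' ≤ Tstar ∧
            -- the labels are independent Rademacher variables
            ((labelLaw n).prod ((noiseLaw d n σξ).prod (initLaw d m σ₀)))
                {ω | ¬ Outcome μ σξ η ε C_D T₁ T₁' Tstar ω.1 ω.2.1 ω.2.2} ≤ ENNReal.ofReal δ ∧
            -- the labels are any given balanced labels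
            (∀ y : Fin n → Bool, Balanced y →
              ((noiseLaw d n σξ).prod (initLaw d m σ₀))
                {ω | ¬ Outcome μ σξ η ε C_D T₁ T₁' Tstar y ω.1 ω.2} ≤ ENNReal.ofReal δ) := by
  obtain ⟨K, hK, hgeneral⟩ := theorem4p4_general
  refine ⟨K, hK, fun c₁ c₂ hc₁ hc => ?_⟩
  obtain ⟨C₀, C_D, a, b, hC_D, hC_D_le, ha, hb, h⟩ := hgeneral c₁ c₂ hc₁ hc
  refine ⟨max C₀ 3, C_D, a, b, by positivity, hC_D, hC_D_le, ha, hb,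
    fun d n m Tstar μ σξ σ₀ η ε δ hcond => ?_⟩
  obtain ⟨T₁, T₁', hT₁, hT₁', hT, hT', hrandom, hfixed⟩ :=
    h _ d n m Tstar μ σξ σ₀ η ε δ (le_max_left _ _) (hcond.mild (le_max_right _ _))
  exact ⟨T₁, T₁', hT₁, hT₁', hT, hT', hrandom, fun y hy => hfixed y hy.card_ge⟩
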